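/- A $2$-tangle lies in a cube and is drawn in a square with end points $NW, NE, SW, SE$. Let $[0]$ consist of two uncrossed arcs joining $NW$ to $NE$ and $SW$ to $SE$; let $-T$ be the mirror image of $T$ (all crossings switched), $1/T$ the reflection of the diagram of $T$ in the diagonal through $NW$ and $SE$, and $S+T$ the tangle obtained by putting $S$ to the left of $T$ and connecting the close ends. For $n\ge 1$, let $[n]$ be the row of $n$ crossings whose upper strands have positive slope, $[-n]=-[n]$, and $[\infty]=1/[0]$. For $a_1\in\mathbb{Z}\cup\{\infty\}$ and $a_2,\dots,a_m\in\mathbb{Z}$ the rational tangle $[a_1\,a_2\cdots a_m]$ is $$[a_1\,a_2\cdots a_m]=[a_m]+\cfrac{1}{[a_{m-1}]+\cfrac{1}{\ddots+\cfrac{1}{[a_2]+\cfrac{1}{[a_1]}}}}.$$ The tangle $[a_1\cdots a_n]$ is in canonical form if $n$ is odd, its diagram is alternating, and either $n=1$, or $n\ge 3$ and $a_1,\dots,a_{n-1}$ are nonzero integers ($a_n$ may be $0$). The solid torus closure $\overline{T}$ of a tangle $T$ is the subset of the thickened annulus $S^1\times I\times I$ obtained by placing the projection disc of $T$ in the annulus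 and joining $NE$ to $NW$ and $SE$ to $SW$ by two parallel arcs running around the annulus. A link in the solid torus is rational if it is ambient isotopic in the solid torus to $\overline{T}$ for some rational tangle $T$. **Corollary.** Every rational knot or link $L$ in the solid torus can be isotoped to a canonical form: there is a rational tangle $[a_1\,a_2\cdots a_n]$ in canonical form such that $L$ is ambient isotopic in the solid torus to its solid torus closure $\overline{[a_1\,a_2\cdots a_n]}$. -/

import Mathlib

namespace SolidTorusLinks

/-! ### Ambient isotopy and links -/

/-- Two subsets of a topological space are ambient isotopic: a continuous family of
self-homeomorphisms `H_t`, `t ∈ [0,1]`, starts at the identity and `H_1` carries `A` onto `B`. -/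
def AmbientIsotopic {X : Type*} [TopologicalSpace X] (A B : Set X) : Prop :=
  ∃ H : unitInterval × X → X, Continuous H ∧
    (∀ t, IsHomeomorph fun x => H (t, x)) ∧
    (∀ x, H (0, x) = x) ∧
    (fun x => H (1, x)) '' A = B

/-- The solid torus, as the thickened annulus `(S¹ × [-2,2]) × [-2,2]`. The first two coordinates
are those of the annulus onto which links are projected, the last one is the height. -/
abbrev SolidTorus : Type :=
  AddCircle (4 : ℝ) × Set.Icc (-2 : ℝ) 2 × Set.Icc (-2 : ℝ) 2

/-- A link (a knot if `n = 1`): a disjoint union of `n` embedded circles. -/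
def IsLink (L : Set SolidTorus) : Prop :=
  ∃ n : ℕ, 1 ≤ n ∧ ∃ f : Fin n × Circle → SolidTorus,
    Topology.IsEmbedding f ∧ Set.range f = L

/-! ### Tangles

A `2`-tangle is a subset of the cube `[-1,1]³` with the four end points
`NW = (-1,1,0)`, `NE = (1,1,0)`, `SW = (-1,-1,0)`, `SE = (1,-1,0)`. It is projected along the last
coordinate and looked at from above, so that the strand with the larger last coordinate is the
upper one. -/

/-- Points of three-space. -/
abbrev Point : Type := ℝ × ℝ × ℝ

/-- The tangle `[0]`: an arc from `NW` to `NE` and an arc from `SW` to `SE`. -/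
def zeroTangle : Set Point :=
  segment ℝ (-1, 1, 0) (0, 1 / 2, 0) ∪ segment ℝ (0, 1 / 2, 0) (1, 1, 0) ∪
    (segment ℝ (-1, -1, 0) (0, -1 / 2, 0) ∪ segment ℝ (0, -1 / 2, 0) (1, -1, 0))

/-- The tangle `[1]`: one crossing, whose upper strand runs from `SW` to `NE` and so has positive
slope. -/
def oneTangle : Set Point :=
  segment ℝ (-1, -1, 0) (0, 0, 1 / 2) ∪ segment ℝ (0, 0, 1 / 2) (1, 1, 0) ∪
    (segment ℝ (-1, 1, 0) (0, 0, -1 / 2) ∪ segment ℝ (0, 0, -1 / 2) (1, -1, 0))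

/-- The mirror image `-T`: all crossings are switched. -/
def mirror (T : Set Point) : Set Point :=
  (fun p : Point => (p.1, p.2.1, -p.2.2)) '' T

/-- The tangle `1/T`: the diagram of `T` is reflected in the diagonal through `NW` and `SE`. -/
def inv (T : Set Point) : Set Point :=
  (fun p : Point => (-p.2.1, -p.1, p.2.2)) '' T

/-- The six segments that join the end points of the two small cubes in a sum to each other and to
the end points of the large cube. -/
def sumArcs : Set Point :=
  segment ℝ (-1, 1, 0) (-3 / 4, 1 / 4, 0) ∪ segment ℝ (-1, -1, 0) (-3 / 4, -1 / 4, 0) ∪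
    (segment ℝ (-1 / 4, 1 / 4, 0) (1 / 4, 1 / 4, 0) ∪
      segment ℝ (-1 / 4, -1 / 4, 0) (1 / 4, -1 / 4, 0)) ∪
    (segment ℝ (3 / 4, 1 / 4, 0) (1, 1, 0) ∪ segment ℝ (3 / 4, -1 / 4, 0) (1, -1, 0))

/-- The sum `S + T`: copies of `S` (on the left) and of `T` (on the right), scaled by `1/4`, with
the close ends connected. -/
def sum (S T : Set Point) : Set Point :=
  (fun p : Point => (-1 / 2 + p.1 / 4, p.2.1 / 4, p.2.2 / 4)) '' S ∪
    (fun p : Point => (1 / 2 + p.1 / 4, p.2.1 / 4, p.2.2 / 4)) '' T ∪ sumArcs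

/-- The tangle `[n]` for a natural number `n`: a row of `n` copies of `[1]`. -/
def natTangle : ℕ → Set Point
  | 0 => zeroTangle
  | 1 => oneTangle
  | n + 2 => sum oneTangle (natTangle (n + 1))

/-- The integer tangle `[n]`; `[-n]` is the mirror image of `[n]`. -/
def intTangle : ℤ → Set Point
  | Int.ofNat n => natTangle n
  | Int.negSucc n => mirror (natTangle (n + 1))

/-- The tangles `[a]` for `a ∈ ℤ ∪ {∞}`, where `[∞] = 1/[0]`. -/
def extTangle : WithTop ℤ → Set Point
  | none => inv zeroTangle
  | some n => intTangle n

/-- The rational tangle `[a₁ a₂ … aₘ]`, given by `a₁ ∈ ℤ ∪ {∞}` and the list `l = [a₂, …, aₘ]` of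
integers; the order is that of creation:
`[a₁ … aₘ] = [aₘ] + 1/([aₘ₋₁] + 1/(⋯ + 1/([a₂] + 1/[a₁])))`. -/
def rationalTangle (a₁ : WithTop ℤ) (l : List ℤ) : Set Point :=
  l.foldl (fun T a => sum (intTangle a) (inv T)) (extTangle a₁)

/-! ### Alternating tangles -/

/-- `p` is the upper point of a crossing in the projection of `T`. -/
def IsOver (T : Set Point) (p : Point) : Prop :=
  p ∈ T ∧ ∃ q ∈ T, q.1 = p.1 ∧ q.2.1 = p.2.1 ∧ q.2.2 < p.2.2

/-- `p` is the lower point of a crossing in the projection of `T`. -/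
def IsUnder (T : Set Point) (p : Point) : Prop :=
  p ∈ T ∧ ∃ q ∈ T, q.1 = p.1 ∧ q.2.1 = p.2.1 ∧ p.2.2 < q.2.2

/-- The diagram of `T` is alternating: whoever travels along `T` from one crossing to the next one
passes above at one of the two and below at the other. -/
def IsAlternating (T : Set Point) : Prop :=
  ∀ γ : unitInterval → Point, Continuous γ → Function.Injective γ → (∀ t, γ t ∈ T) →
    (∀ t, (IsOver T (γ t) ∨ IsUnder T (γ t)) ↔ (t = 0 ∨ t = 1)) →
    (IsOver T (γ 0) ↔ IsUnder T (γ 1))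

/-- The tangle `[a₁ a₂ … aₙ]`, `l = [a₂, …, aₙ]`, is in canonical form: `n` is odd and the diagram
is alternating. The terms other than `aₙ` are nonzero integers (so `∞` occurs only in the
tangle `[∞]`). -/
def IsCanonicalTangle (a₁ : WithTop ℤ) (l : List ℤ) : Prop :=
  Odd (l.length + 1) ∧ IsAlternating (rationalTangle a₁ l) ∧
    (l ≠ [] → a₁ ≠ 0 ∧ a₁ ≠ ⊤) ∧ (∀ a ∈ l.dropLast, a ≠ 0)

/-! ### Rational links in the solid torus -/

/-- The two parallel arcs from the right end points of the cube to its left end points around the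
annulus, in the coordinate `x ∈ ℝ` whose class modulo `4` is the angular coordinate. -/
def closureArcs : Set Point :=
  segment ℝ (1, 1, 0) (3, 1, 0) ∪ segment ℝ (1, -1, 0) (3, -1, 0)

/-- The solid torus closure of `T`: the projection disc of `T` is placed in the annulus, and
`NE` is joined with `NW`, and `SE` with `SW`, by parallel arcs around the annulus. -/
def solidTorusClosure (T : Set Point) : Set SolidTorus :=
  {p | ∃ x : ℝ, (x : AddCircle (4 : ℝ)) = p.1 ∧
    ((x, (p.2.1 : ℝ), (p.2.2 : ℝ)) : Point) ∈ T ∪ closureArcs}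

/-- `L` is, up to isotopy, the solid torus closure of a rational tangle. -/
def IsRationalLink (L : Set SolidTorus) : Prop :=
  IsLink L ∧ ∃ (a₁ : WithTop ℤ) (l : List ℤ),
    AmbientIsotopic L (solidTorusClosure (rationalTangle a₁ l))

/-- `L` is the solid torus closure of a rational tangle in canonical form. -/
def IsInCanonicalForm (L : Set SolidTorus) : Prop :=
  ∃ (a₁ : WithTop ℤ) (l : List ℤ),
    IsCanonicalTangle a₁ l ∧ L = solidTorusClosure (rationalTangle a₁ l)

end SolidTorusLinks

namespace SolidTorusLinks

open Set Filter Topology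

/-! ### Isotopy of tangles relative to the boundary of the cube -/

/-- Two subsets of three-space correspond to each other under a self-homeomorphism that is the
identity outside the open cube. By Alexander's trick it is isotopic to the identity. -/
def Isotopic (T T' : Set Point) : Prop :=
  ∃ g : Point ≃ₜ Point, (∀ p, 1 ≤ ‖p‖ → g p = p) ∧ g '' T = T'

theorem Isotopic.refl (T : Set Point) : Isotopic T T :=
  ⟨Homeomorph.refl _, fun _ _ => rfl, by simp⟩

theorem fixes_symm {g : Point ≃ₜ Point} (hg : ∀ p, 1 ≤ ‖p‖ → g p = p) :
    ∀ p, 1 ≤ ‖p‖ → g.symm p = p := fun p hp => by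
  rw [Homeomorph.symm_apply_eq, hg p hp]

theorem Isotopic.symm {T T' : Set Point} (h : Isotopic T T') : Isotopic T' T := by
  obtain ⟨g, hg, rfl⟩ := h
  exact ⟨g.symm, fixes_symm hg, by simp [← image_comp]⟩

theorem Isotopic.trans {T T' T'' : Set Point} (h : Isotopic T T') (h' : Isotopic T' T'') :
    Isotopic T T'' := by
  obtain ⟨g, hg, rfl⟩ := h
  obtain ⟨k, hk, rfl⟩ := h'
  exact ⟨g.trans k, fun p hp => by simp [hg p hp, hk p hp], by
    rw [← image_comp]; rfl⟩

/-- A continuous bijection that is the identity outside the open cube gives an isotopy. -/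
theorem Isotopic.of_bijective {g : Point → Point} (hc : Continuous g) (hb : Function.Bijective g)
    (hg : ∀ p, 1 ≤ ‖p‖ → g p = p) (T : Set Point) : Isotopic T (g '' T) := by
  have hp : IsProperMap g := by
    rw [isProperMap_iff_tendsto_cocompact]
    refine ⟨hc, tendsto_id.congr' ?_⟩
    have : (Metric.closedBall (0 : Point) 1)ᶜ ∈ cocompact Point :=
      (isCompact_closedBall _ _).compl_mem_cocompact
    filter_upwards [this] with p hp
    rw [hg p]
    · rfl
    · simp at hp; exact hp.le
  have h : IsHomeomorph g :=
    isHomeomorph_iff_continuous_isClosedMap_bijective.2 ⟨hc, hp.isClosedMap, hb⟩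
  exact ⟨h.homeomorph, hg, rfl⟩

theorem norm_point (p : Point) : ‖p‖ = max |p.1| (max |p.2.1| |p.2.2|) := by
  simp [Prod.norm_def]

theorem norm_lt_of_fixes {g : Point ≃ₜ Point} (hg : ∀ p, 1 ≤ ‖p‖ → g p = p) {p : Point}
    (hp : ‖p‖ < 1) : ‖g p‖ < 1 := by
  by_contra! h
  have : p = g p := g.injective (hg _ h).symm
  rw [← this] at h
  linarith

/-! ### Alexander's trick -/

/-- The isotopy from the identity to `g` in Alexander's trick. -/
noncomputable def alexander (g : Point → Point) (t : ℝ) (p : Point) : Point :=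
  if t = 0 then p else t • g (t⁻¹ • p)

theorem alexander_eq_self {g : Point → Point} (hg : ∀ p, 1 ≤ ‖p‖ → g p = p) {t : ℝ} {p : Point}
    (ht : |t| ≤ 1) (hp : 1 ≤ ‖p‖) : alexander g t p = p := by
  unfold alexander
  split_ifs with h
  · rfl
  rw [hg, smul_inv_smul₀ h]
  rw [norm_smul, norm_inv, Real.norm_eq_abs]
  have : 1 ≤ |t|⁻¹ := (one_le_inv₀ (abs_pos.2 h)).2 ht
  nlinarith

theorem alexander_left_inv {g k : Point → Point} (hk : ∀ p, k (g p) = p) (t : ℝ) (p : Point) :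
    alexander k t (alexander g t p) = p := by
  unfold alexander
  split_ifs with h
  · rfl
  · rw [inv_smul_smul₀ h, hk, smul_inv_smul₀ h]

theorem norm_alexander_sub_le {g : Point ≃ₜ Point} (hg : ∀ p, 1 ≤ ‖p‖ → g p = p) (t : ℝ)
    (p : Point) : ‖alexander g t p - p‖ ≤ 2 * |t| := by
  unfold alexander
  split_ifs with h
  · simp
  have hb : ∀ q : Point, ‖g q - q‖ ≤ 2 := fun q => by
    rcases le_or_gt 1 ‖q‖ with hq | hq
    · rw [hg q hq]; simp
    · have := norm_lt_of_fixes hg hq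
      exact (norm_sub_le _ _).trans (by linarith)
  have : t • g (t⁻¹ • p) - p = t • (g (t⁻¹ • p) - t⁻¹ • p) := by
    rw [smul_sub, smul_inv_smul₀ h]
  rw [this, norm_smul, Real.norm_eq_abs, mul_comm]
  exact mul_le_mul_of_nonneg_right (hb _) (abs_nonneg _)

theorem continuous_alexander {g : Point ≃ₜ Point} (hg : ∀ p, 1 ≤ ‖p‖ → g p = p) :
    Continuous fun a : ℝ × Point => alexander g a.1 a.2 := by
  rw [continuous_iff_continuousAt]
  rintro ⟨t, p⟩
  by_cases ht : t = 0
  · subst ht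
    have h1 : Tendsto (fun a : ℝ × Point => alexander g a.1 a.2 - a.2) (𝓝 (0, p)) (𝓝 0) := by
      refine squeeze_zero_norm (fun a => norm_alexander_sub_le hg a.1 a.2) ?_
      have : Continuous fun a : ℝ × Point => 2 * |a.1| := by fun_prop
      simpa using this.tendsto (0, p)
    have h2 : Tendsto (fun a : ℝ × Point => a.2) (𝓝 (0, p)) (𝓝 p) :=
      continuous_snd.tendsto (0, p)
    have h3 := h1.add h2
    simp only [sub_add_cancel, zero_add] at h3
    simpa [ContinuousAt, alexander] using h3
  · have h1 : ContinuousAt (fun a : ℝ × Point => a.1 • g (a.1⁻¹ • a.2)) (t, p) := by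
      refine continuousAt_fst.smul (g.continuous.continuousAt.comp ?_)
      exact (continuousAt_fst.inv₀ ht).smul continuousAt_snd
    refine h1.congr ?_
    have : ∀ᶠ a : ℝ × Point in 𝓝 (t, p), a.1 ≠ 0 := continuousAt_fst.eventually_ne ht
    filter_upwards [this] with a ha
    simp [alexander, ha]

/-! ### From the cube to the solid torus -/

instance : Fact ((0 : ℝ) < 4) := ⟨by norm_num⟩

/-- The representative in three-space, with first coordinate in `[-2,2)`, of a point of the solid
torus. -/
noncomputable def lift (p : SolidTorus) : Point :=
  ((AddCircle.equivIco (4 : ℝ) (-2) p.1 : ℝ), (p.2.1 : ℝ), (p.2.2 : ℝ))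

/-- The projection of three-space to the solid torus; the last two coordinates are clamped. -/
noncomputable def proj (p : Point) : SolidTorus :=
  ((p.1 : AddCircle (4 : ℝ)), projIcc (-2) 2 (by norm_num) p.2.1, projIcc (-2) 2 (by norm_num) p.2.2)

theorem continuous_proj : Continuous proj := by
  unfold proj
  refine Continuous.prodMk (continuous_quotient_mk'.comp continuous_fst) (Continuous.prodMk ?_ ?_)
  · exact continuous_projIcc.comp (by fun_prop)
  · exact continuous_projIcc.comp (by fun_prop)

theorem proj_lift (p : SolidTorus) : proj (lift p) = p := by
  obtain ⟨a, b, c⟩ := p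
  simp only [proj, lift, projIcc_val, Prod.mk.injEq, and_true]
  exact (AddCircle.equivIco (4 : ℝ) (-2)).symm_apply_apply a

theorem lift_proj {p : Point} (hp : ‖p‖ ≤ 1) : lift (proj p) = p := by
  rw [norm_point, max_le_iff, max_le_iff, abs_le, abs_le, abs_le] at hp
  obtain ⟨⟨h1, h2⟩, ⟨h3, h4⟩, h5, h6⟩ := hp
  obtain ⟨a, b, c⟩ := p
  simp only at *
  have ha : a ∈ Ico (-2 : ℝ) (-2 + 4) := ⟨by linarith, by linarith⟩
  simp only [lift, proj, Prod.mk.injEq]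
  refine ⟨AddCircle.equivIco_coe_of_mem ha, ?_, ?_⟩
  · rw [projIcc_of_mem _ (⟨by linarith, by linarith⟩ : b ∈ Icc (-2 : ℝ) 2)]
  · rw [projIcc_of_mem _ (⟨by linarith, by linarith⟩ : c ∈ Icc (-2 : ℝ) 2)]

theorem norm_fst_lift (p : SolidTorus) : ‖p.1‖ = |(lift p).1| := by
  have h := (AddCircle.equivIco (4 : ℝ) (-2) p.1).2
  have : (((AddCircle.equivIco (4 : ℝ) (-2) p.1 : ℝ)) : AddCircle (4 : ℝ)) = p.1 :=
    (AddCircle.equivIco (4 : ℝ) (-2)).symm_apply_apply p.1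
  rw [← this]
  refine (AddCircle.norm_coe_eq_abs_iff (4 : ℝ) (by norm_num)).2 ?_ |>.trans ?_
  · rw [abs_le, abs_of_pos (by norm_num : (0 : ℝ) < 4)]
    constructor <;> linarith [h.1, h.2]
  · rfl

theorem continuousAt_lift {p : SolidTorus} (hp : |(lift p).1| < 2) : ContinuousAt lift p := by
  have h : p.1 ≠ ((-2 : ℝ) : AddCircle (4 : ℝ)) := by
    intro h
    have h1 := norm_fst_lift p
    rw [h, (AddCircle.norm_coe_eq_abs_iff (4 : ℝ) (by norm_num)).2 (by norm_num)] at h1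
    norm_num at h1
    linarith
  unfold lift
  refine ContinuousAt.prodMk ?_ (by fun_prop)
  exact continuous_subtype_val.continuousAt.comp
    ((AddCircle.continuousAt_equivIco (4 : ℝ) (-2) h).comp continuousAt_fst)

/-- Isotopic tangles have ambient isotopic closures. -/
theorem Isotopic.closure {T T' : Set Point} (h : Isotopic T T') (hT : ∀ p ∈ T, ‖p‖ ≤ 1) :
    AmbientIsotopic (solidTorusClosure T) (solidTorusClosure T') := by
  obtain ⟨g, hg, hgT⟩ := h
  have hT' : ∀ p ∈ T', ‖p‖ ≤ 1 := by
    rw [← hgT]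
    rintro _ ⟨p, hp, rfl⟩
    rcases (hT p hp).eq_or_lt with h | h
    · rw [hg p h.ge, h]
    · exact (norm_lt_of_fixes hg h).le
  have habs : ∀ t : unitInterval, |(t : ℝ)| ≤ 1 := fun t => by
    rw [abs_of_nonneg t.2.1]; exact t.2.2
  let H (k : Point → Point) (t : unitInterval) (p : SolidTorus) : SolidTorus :=
    proj (alexander k t (lift p))
  have hfix : ∀ k : Point → Point, (∀ p, 1 ≤ ‖p‖ → k p = p) → ∀ t p, 1 ≤ ‖lift p‖ →
      H k t p = p := fun k hk t p hp => by
    simp only [H]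
    rw [alexander_eq_self hk (habs t) hp, proj_lift]
  have hball : ∀ k : Point ≃ₜ Point, (∀ p, 1 ≤ ‖p‖ → k p = p) → ∀ t : unitInterval,
      ∀ p : Point, ‖p‖ < 1 → ‖alexander k t p‖ < 1 := fun k hk t p hp => by
    by_contra! h
    have h1 := alexander_eq_self (g := k.symm) (fixes_symm hk) (habs t) h
    rw [alexander_left_inv (by simp)] at h1
    rw [← h1] at h
    linarith
  have hinv : ∀ k : Point ≃ₜ Point, (∀ p, 1 ≤ ‖p‖ → k p = p) → ∀ t p,
      H k.symm t (H k t p) = p := fun k hk t p => by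
    rcases le_or_gt 1 ‖lift p‖ with hp | hp
    · rw [hfix k hk t p hp, hfix k.symm (fixes_symm hk) t p hp]
    · simp only [H]
      rw [lift_proj (hball k hk t _ hp).le, alexander_left_inv (by simp), proj_lift]
  have hcont : ∀ k : Point ≃ₜ Point, (∀ p, 1 ≤ ‖p‖ → k p = p) →
      Continuous fun a : unitInterval × SolidTorus => H k a.1 a.2 := fun k hk => by
    rw [continuous_iff_continuousAt]
    rintro ⟨t, p⟩
    rcases lt_or_ge |(lift p).1| 2 with hp | hp
    · have h1 : ContinuousAt (fun a : unitInterval × SolidTorus => ((a.1 : ℝ), lift a.2)) (t, p) :=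
        ContinuousAt.prodMk (by fun_prop)
          (ContinuousAt.comp (f := Prod.snd) (x := (t, p)) (continuousAt_lift hp) continuousAt_snd)
      exact continuous_proj.continuousAt.comp
        (ContinuousAt.comp (f := fun a : unitInterval × SolidTorus => ((a.1 : ℝ), lift a.2))
          (continuous_alexander hk).continuousAt h1)
    · refine ContinuousAt.congr (f := Prod.snd) continuousAt_snd ?_
      have h1 : Continuous fun a : unitInterval × SolidTorus => ‖a.2.1‖ := by fun_prop
      have h2 : ∀ᶠ a : unitInterval × SolidTorus in 𝓝 (t, p), 1 < ‖a.2.1‖ := by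
        refine h1.continuousAt.eventually (lt_mem_nhds ?_)
        simp only [norm_fst_lift]
        linarith
      filter_upwards [h2] with a ha
      refine (hfix k hk a.1 a.2 ?_).symm
      rw [norm_fst_lift] at ha
      rw [norm_point]
      exact ha.le.trans (le_max_left _ _)
  have hmap : ∀ k : Point ≃ₜ Point, (∀ p, 1 ≤ ‖p‖ → k p = p) → ∀ A B : Set Point,
      (∀ p ∈ A, ‖p‖ ≤ 1) → (∀ p ∈ A, k p ∈ B) → ∀ p ∈ solidTorusClosure A,
      H k 1 p ∈ solidTorusClosure B := fun k hk A B hA hAB p hp => by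
    obtain ⟨x, hx, hp⟩ := hp
    have hal : ∀ q, alexander k ((1 : unitInterval) : ℝ) q = k q := fun q => by simp [alexander]
    rcases hp with hp | hp
    · have h1 : lift p = (x, (p.2.1 : ℝ), (p.2.2 : ℝ)) := by
        rw [← lift_proj (hA _ hp)]
        congr 1
        simp [proj, hx]
      have hq : lift (H k 1 p) = k (lift p) := by
        simp only [H, hal]
        refine lift_proj ?_
        rw [h1]
        rcases (hA _ hp).eq_or_lt with h | h
        · rw [hk _ h.ge, h]
        · exact (norm_lt_of_fixes hk h).le
      refine ⟨(lift (H k 1 p)).1, ?_, Or.inl ?_⟩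
      · exact congrArg Prod.fst (proj_lift (H k 1 p))
      · have : ((lift (H k 1 p)).1, ((H k 1 p).2.1 : ℝ), ((H k 1 p).2.2 : ℝ)) = lift (H k 1 p) := rfl
        rw [this, hq, h1]
        exact hAB _ hp
    · have h1 : 1 ≤ ‖lift p‖ := by
        have hy : |(p.2.1 : ℝ)| = 1 := by
          rcases hp with ⟨a, b, ha, hb, hab, h⟩ | ⟨a, b, ha, hb, hab, h⟩
          · have := congrArg (fun p : Point => p.2.1) h
            simp at this
            rw [← this, hab, abs_one]
          · have := congrArg (fun p : Point => p.2.1) h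
            simp at this
            rw [← this, ← neg_add, add_comm, add_comm, hab, abs_neg, abs_one]
        rw [norm_point]
        exact hy.ge.trans ((le_max_left _ _).trans (le_max_right _ _))
      rw [hfix k hk 1 p h1]
      exact ⟨x, hx, Or.inr hp⟩
  refine ⟨fun a => H g a.1 a.2, hcont g hg, fun t => ?_, fun p => ?_, ?_⟩
  · rw [isHomeomorph_iff_exists_inverse]
    refine ⟨(hcont g hg).comp (Continuous.prodMk_right t), H g.symm t, fun p => hinv g hg t p,
      fun p => ?_, (hcont g.symm (fixes_symm hg)).comp (Continuous.prodMk_right t)⟩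
    simpa using hinv g.symm (fixes_symm hg) t p
  · simp [H, alexander, proj_lift]
  · ext p
    constructor
    · rintro ⟨q, hq, rfl⟩
      exact hmap g hg T T' hT (fun p hp => hgT ▸ mem_image_of_mem _ hp) q hq
    · intro hp
      refine ⟨H g.symm 1 p, hmap g.symm (fixes_symm hg) T' T hT' ?_ p hp, ?_⟩
      · rw [← hgT]; rintro _ ⟨q, hq, rfl⟩; simpa using hq
      · simpa using hinv g.symm (fixes_symm hg) 1 p

/-! ### Operations on isotopy classes -/

theorem Isotopic.conj_union {T T' : Set Point} (h : Isotopic T T') (e : Point ≃ₜ Point)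
    (he : ∀ p, 1 ≤ ‖p‖ → 1 ≤ ‖e.symm p‖) (E : Set Point) (hE : ∀ p ∈ E, 1 ≤ ‖e.symm p‖) :
    Isotopic (e '' T ∪ E) (e '' T' ∪ E) := by
  obtain ⟨g, hg, rfl⟩ := h
  refine ⟨e.symm.trans (g.trans e), fun p hp => by simp [hg _ (he p hp)], ?_⟩
  rw [image_union]
  congr 1
  · ext p; simp [image_image]
  · ext p
    constructor
    · rintro ⟨q, hq, rfl⟩
      simpa [hg _ (hE q hq)] using hq
    · intro hp
      exact ⟨p, hp, by simp [hg _ (hE p hp)]⟩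

theorem Isotopic.conj {T T' : Set Point} (h : Isotopic T T') (e : Point ≃ₜ Point)
    (he : ∀ p, 1 ≤ ‖p‖ → 1 ≤ ‖e.symm p‖) : Isotopic (e '' T) (e '' T') := by
  simpa using h.conj_union e he ∅ (by simp)

/-- The homeomorphism that switches crossings. -/
def mirrorHomeo : Point ≃ₜ Point where
  toFun p := (p.1, p.2.1, -p.2.2)
  invFun p := (p.1, p.2.1, -p.2.2)
  left_inv p := by simp
  right_inv p := by simp

/-- The reflection in the plane over the diagonal through `NW` and `SE`. -/
def invHomeo : Point ≃ₜ Point where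
  toFun p := (-p.2.1, -p.1, p.2.2)
  invFun p := (-p.2.1, -p.1, p.2.2)
  left_inv p := by simp
  right_inv p := by simp

theorem mirror_mirror (T : Set Point) : mirror (mirror T) = T := by
  unfold mirror; simp [image_image]

theorem inv_inv (T : Set Point) : inv (inv T) = T := by
  unfold inv; simp [image_image]

theorem mirror_inv (T : Set Point) : mirror (inv T) = inv (mirror T) := by
  unfold inv mirror; simp [image_image]

theorem Isotopic.mirror {T T' : Set Point} (h : Isotopic T T') :
    Isotopic (mirror T) (mirror T') :=
  h.conj mirrorHomeo fun p hp => by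
    rw [norm_point] at hp ⊢; simpa [mirrorHomeo, Homeomorph.symm] using hp

theorem Isotopic.inv {T T' : Set Point} (h : Isotopic T T') : Isotopic (inv T) (inv T') :=
  h.conj invHomeo fun p hp => by
    rw [norm_point] at hp ⊢
    simp only [invHomeo, Homeomorph.symm, Homeomorph.homeomorph_mk_coe, Equiv.coe_fn_symm_mk, abs_neg]
    rwa [max_left_comm] at hp

/-- The map that places the cube, scaled by `1/4`, at the point `(c,0,0)`. -/
noncomputable def boxHomeo (c : ℝ) : Point ≃ₜ Point where
  toFun p := (c + p.1 / 4, p.2.1 / 4, p.2.2 / 4)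
  invFun p := (4 * (p.1 - c), 4 * p.2.1, 4 * p.2.2)
  left_inv p := by ext <;> simp <;> ring
  right_inv p := by ext <;> simp

theorem boxHomeo_symm_apply (c : ℝ) (p : Point) :
    (boxHomeo c).symm p = (4 * (p.1 - c), 4 * p.2.1, 4 * p.2.2) := rfl

theorem norm_le_one_iff (p : Point) : ‖p‖ ≤ 1 ↔ |p.1| ≤ 1 ∧ |p.2.1| ≤ 1 ∧ |p.2.2| ≤ 1 := by
  rw [norm_point, max_le_iff, max_le_iff]

theorem one_le_norm_iff (p : Point) : 1 ≤ ‖p‖ ↔ 1 ≤ |p.1| ∨ 1 ≤ |p.2.1| ∨ 1 ≤ |p.2.2| := by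
  rw [norm_point, le_max_iff, le_max_iff]

theorem mem_sumArcs {p : Point} (hp : p ∈ sumArcs) :
    ‖p‖ ≤ 1 ∧ (p.1 ≤ -3 / 4 ∨ |p.1| ≤ 1 / 4 ∨ 3 / 4 ≤ p.1) := by
  rw [norm_le_one_iff]
  simp only [abs_le]
  rcases hp with ((⟨a, b, ha, hb, hab, rfl⟩ | ⟨a, b, ha, hb, hab, rfl⟩) |
    (⟨a, b, ha, hb, hab, rfl⟩ | ⟨a, b, ha, hb, hab, rfl⟩)) |
    (⟨a, b, ha, hb, hab, rfl⟩ | ⟨a, b, ha, hb, hab, rfl⟩) <;>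
  simp only [Prod.fst_add, Prod.snd_add, Prod.smul_fst, Prod.smul_snd, smul_eq_mul] <;>
  obtain rfl : b = 1 - a := by linarith
  · exact ⟨⟨⟨by linarith, by linarith⟩, ⟨by linarith, by linarith⟩, by linarith, by linarith⟩,
      Or.inl (by linarith)⟩
  · exact ⟨⟨⟨by linarith, by linarith⟩, ⟨by linarith, by linarith⟩, by linarith, by linarith⟩,
      Or.inl (by linarith)⟩
  · exact ⟨⟨⟨by linarith, by linarith⟩, ⟨by linarith, by linarith⟩, by linarith, by linarith⟩,
      Or.inr (Or.inl ⟨by linarith, by linarith⟩)⟩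
  · exact ⟨⟨⟨by linarith, by linarith⟩, ⟨by linarith, by linarith⟩, by linarith, by linarith⟩,
      Or.inr (Or.inl ⟨by linarith, by linarith⟩)⟩
  · exact ⟨⟨⟨by linarith, by linarith⟩, ⟨by linarith, by linarith⟩, by linarith, by linarith⟩,
      Or.inr (Or.inr (by linarith))⟩
  · exact ⟨⟨⟨by linarith, by linarith⟩, ⟨by linarith, by linarith⟩, by linarith, by linarith⟩,
      Or.inr (Or.inr (by linarith))⟩

theorem sum_eq_union (S T : Set Point) :
    sum S T = boxHomeo (-1 / 2) '' S ∪ boxHomeo (1 / 2) '' T ∪ sumArcs := rfl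

theorem norm_le_one_boxHomeo {c : ℝ} (hc : |c| ≤ 3 / 4) {p : Point} (hp : ‖p‖ ≤ 1) :
    ‖boxHomeo c p‖ ≤ 1 := by
  rw [norm_le_one_iff, abs_le, abs_le, abs_le] at hp
  rw [abs_le] at hc
  obtain ⟨h1, h2, h3⟩ := hp
  rw [norm_le_one_iff, abs_le, abs_le, abs_le]
  simp only [boxHomeo, Homeomorph.homeomorph_mk_coe, Equiv.coe_fn_mk]
  refine ⟨⟨?_, ?_⟩, ⟨?_, ?_⟩, ?_, ?_⟩ <;> linarith

theorem Isotopic.sum_right {S T T' : Set Point} (h : Isotopic T T') (hS : ∀ p ∈ S, ‖p‖ ≤ 1) :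
    Isotopic (sum S T) (sum S T') := by
  have key := h.conj_union (boxHomeo (1 / 2)) (fun p hp => ?_)
    (boxHomeo (-1 / 2) '' S ∪ sumArcs) (fun p hp => ?_)
  · have e : ∀ T, sum S T = boxHomeo (1 / 2) '' T ∪ (boxHomeo (-1 / 2) '' S ∪ sumArcs) := fun T => by
      rw [sum_eq_union, ← union_assoc, union_comm (boxHomeo (1 / 2) '' T)]
    rwa [e, e]
  · rw [one_le_norm_iff] at hp
    rw [boxHomeo_symm_apply, one_le_norm_iff]
    simp only [abs_mul, abs_of_pos (by norm_num : (0 : ℝ) < 4)]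
    rcases hp with hp | hp | hp
    · left
      rw [le_abs] at hp
      rcases hp with hp | hp
      · linarith [le_abs_self (p.1 - 1 / 2)]
      · linarith [neg_le_abs (p.1 - 1 / 2)]
    · right; left; linarith
    · right; right; linarith
  · rw [boxHomeo_symm_apply, one_le_norm_iff]
    left
    simp only [abs_mul, abs_of_pos (by norm_num : (0 : ℝ) < 4)]
    rcases hp with ⟨q, hq, rfl⟩ | hp
    · have := (norm_le_one_iff q).1 (hS q hq)
      have h1 := abs_le.1 this.1
      simp only [boxHomeo, Homeomorph.homeomorph_mk_coe, Equiv.coe_fn_mk]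
      have := neg_le_abs (-1 / 2 + q.1 / 4 - 1 / 2)
      linarith
    · rcases (mem_sumArcs hp).2 with h | h | h
      · linarith [neg_le_abs (p.1 - 1 / 2)]
      · linarith [neg_le_abs (p.1 - 1 / 2), abs_le.1 h]
      · linarith [le_abs_self (p.1 - 1 / 2)]

/-! ### Tangles lie in the cube -/

theorem norm_le_of_mem_sum {S T : Set Point} (hS : ∀ p ∈ S, ‖p‖ ≤ 1) (hT : ∀ p ∈ T, ‖p‖ ≤ 1) :
    ∀ p ∈ sum S T, ‖p‖ ≤ 1 := by
  rintro p ((⟨q, hq, rfl⟩ | ⟨q, hq, rfl⟩) | hp)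
  · exact norm_le_one_boxHomeo (by norm_num [abs_le]) (hS q hq)
  · exact norm_le_one_boxHomeo (by norm_num [abs_le]) (hT q hq)
  · exact (mem_sumArcs hp).1

theorem norm_le_of_mem_mirror {T : Set Point} (hT : ∀ p ∈ T, ‖p‖ ≤ 1) :
    ∀ p ∈ mirror T, ‖p‖ ≤ 1 := by
  rintro _ ⟨p, hp, rfl⟩
  have := hT p hp
  rw [norm_point] at this ⊢
  simpa using this

theorem norm_le_of_mem_inv {T : Set Point} (hT : ∀ p ∈ T, ‖p‖ ≤ 1) :
    ∀ p ∈ inv T, ‖p‖ ≤ 1 := by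
  rintro _ ⟨p, hp, rfl⟩
  have := hT p hp
  rw [norm_point] at this ⊢
  simp only [abs_neg]
  rwa [max_left_comm]

theorem norm_le_of_mem_segment {a b : Point} (ha : ‖a‖ ≤ 1) (hb : ‖b‖ ≤ 1) :
    ∀ p ∈ segment ℝ a b, ‖p‖ ≤ 1 := fun p hp => by
  have := (convex_closedBall (0 : Point) 1).segment_subset (by simpa using ha) (by simpa using hb) hp
  simpa using this

theorem norm_le_of_mem_zeroTangle : ∀ p ∈ zeroTangle, ‖p‖ ≤ 1 := by
  rintro p ((h | h) | (h | h)) <;> revert p <;> apply norm_le_of_mem_segment <;>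
    norm_num [norm_le_one_iff, abs_le]

theorem norm_le_of_mem_oneTangle : ∀ p ∈ oneTangle, ‖p‖ ≤ 1 := by
  rintro p ((h | h) | (h | h)) <;> revert p <;> apply norm_le_of_mem_segment <;>
    norm_num [norm_le_one_iff, abs_le]

theorem norm_le_of_mem_natTangle : ∀ n, ∀ p ∈ natTangle n, ‖p‖ ≤ 1
  | 0 => norm_le_of_mem_zeroTangle
  | 1 => norm_le_of_mem_oneTangle
  | n + 2 => norm_le_of_mem_sum norm_le_of_mem_oneTangle (norm_le_of_mem_natTangle (n + 1))

theorem norm_le_of_mem_intTangle : ∀ n, ∀ p ∈ intTangle n, ‖p‖ ≤ 1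
  | Int.ofNat n => norm_le_of_mem_natTangle n
  | Int.negSucc n => norm_le_of_mem_mirror (norm_le_of_mem_natTangle (n + 1))

theorem rationalTangle_concat (a : WithTop ℤ) (l : List ℤ) (b : ℤ) :
    rationalTangle a (l ++ [b]) = sum (intTangle b) (inv (rationalTangle a l)) := by
  simp [rationalTangle]

theorem norm_le_of_mem_rationalTangle (a : WithTop ℤ) (l : List ℤ) :
    ∀ p ∈ rationalTangle a l, ‖p‖ ≤ 1 := by
  induction l using List.reverseRecOn with
  | nil =>
    cases a with
    | top => exact norm_le_of_mem_inv norm_le_of_mem_zeroTangle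
    | coe n => exact norm_le_of_mem_intTangle n
  | append_singleton l b ih =>
    rw [rationalTangle_concat]
    exact norm_le_of_mem_sum (norm_le_of_mem_intTangle b) (norm_le_of_mem_inv ih)

/-! ### Homeomorphisms of the cube that are fibred over the first coordinate -/

/-- The point with first coordinate `x` whose last two coordinates are those of `q`. -/
def pt (x : ℝ) (q : ℂ) : Point := (x, q.re, q.im)

/-- The last two coordinates of a point, as a complex number. -/
def cplx (p : Point) : ℂ := ⟨p.2.1, p.2.2⟩

@[simp] theorem pt_fst (x : ℝ) (q : ℂ) : (pt x q).1 = x := rfl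

@[simp] theorem cplx_pt (x : ℝ) (q : ℂ) : cplx (pt x q) = q := rfl

@[simp] theorem pt_cplx (p : Point) : pt p.1 (cplx p) = p := rfl

theorem pt_injective {x y : ℝ} {q w : ℂ} (h : pt x q = pt y w) : x = y ∧ q = w :=
  ⟨congrArg Prod.fst h, congrArg cplx h⟩

theorem continuous_cplx : Continuous cplx :=
  Complex.equivRealProdCLM.symm.continuous.comp continuous_snd

theorem continuous_pt : Continuous fun a : ℝ × ℂ => pt a.1 a.2 := by
  unfold pt
  exact continuous_fst.prodMk ((Complex.continuous_re.comp continuous_snd).prodMk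
    (Complex.continuous_im.comp continuous_snd))

theorem one_le_norm_cases {p : Point} (hp : 1 ≤ ‖p‖) : 1 ≤ |p.1| ∨ 1 ≤ ‖cplx p‖ := by
  rcases (one_le_norm_iff p).1 hp with h | h | h
  · exact Or.inl h
  · exact Or.inr (h.trans (Complex.abs_re_le_norm (cplx p)))
  · exact Or.inr (h.trans (Complex.abs_im_le_norm (cplx p)))

/-- The cutoff function that is `1` for `r ≤ a` and `0` for `r ≥ 1`. -/
noncomputable def cutoff (a r : ℝ) : ℝ := max 0 (min 1 (a * (1 - r) / (max r a * (1 - a))))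

theorem cutoff_nonneg (a r : ℝ) : 0 ≤ cutoff a r := le_max_left _ _

theorem cutoff_le_one (a r : ℝ) : cutoff a r ≤ 1 := max_le zero_le_one (min_le_left _ _)

theorem cutoff_of_le {a r : ℝ} (h0 : 0 < a) (h1 : a < 1) (h : r ≤ a) : cutoff a r = 1 := by
  have : 1 ≤ a * (1 - r) / (max r a * (1 - a)) := by
    rw [max_eq_right h, one_le_div (mul_pos h0 (by linarith))]
    exact mul_le_mul_of_nonneg_left (by linarith) h0.le
  rw [cutoff, min_eq_left this, max_eq_right zero_le_one]

theorem cutoff_of_one_le {a r : ℝ} (h0 : 0 < a) (h1 : a < 1) (h : 1 ≤ r) : cutoff a r = 0 := by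
  have : a * (1 - r) / (max r a * (1 - a)) ≤ 0 :=
    div_nonpos_of_nonpos_of_nonneg (mul_nonpos_of_nonneg_of_nonpos h0.le (by linarith))
      (mul_nonneg (h0.le.trans (le_max_right _ _)) (by linarith))
  rw [cutoff, max_eq_left ((min_le_right _ _).trans this)]

theorem mul_cutoff {a r : ℝ} (h0 : 0 < a) (h1 : a < 1) (h : a ≤ r) (h2 : r ≤ 1) :
    r * cutoff a r = a * (1 - r) / (1 - a) := by
  have hr : 0 < r := h0.trans_le h
  have h3 : a * (1 - r) / (r * (1 - a)) ≤ 1 := by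
    rw [div_le_one (mul_pos hr (by linarith))]
    nlinarith
  have h4 : 0 ≤ a * (1 - r) / (r * (1 - a)) :=
    div_nonneg (mul_nonneg h0.le (by linarith)) (mul_nonneg hr.le (by linarith))
  rw [cutoff, max_eq_left h, min_eq_right h3, max_eq_right h4]
  have : 1 - a ≠ 0 := by linarith
  field_simp

/-- The radial stretching map. -/
noncomputable def stretch (k a r : ℝ) : ℝ := r * (1 + (k - 1) * cutoff a r)

theorem stretch_of_le {k a r : ℝ} (h0 : 0 < a) (h1 : a < 1) (h : r ≤ a) :
    stretch k a r = k * r := by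
  rw [stretch, cutoff_of_le h0 h1 h]; ring

theorem stretch_of_one_le {k a r : ℝ} (h0 : 0 < a) (h1 : a < 1) (h : 1 ≤ r) :
    stretch k a r = r := by
  rw [stretch, cutoff_of_one_le h0 h1 h]; ring

theorem stretch_of_mem {k a r : ℝ} (h0 : 0 < a) (h1 : a < 1) (h : a ≤ r) (h2 : r ≤ 1) :
    stretch k a r = 1 - (1 - k * a) / (1 - a) * (1 - r) := by
  have h3 : 1 - a ≠ 0 := by linarith
  have : stretch k a r = r + (k - 1) * (r * cutoff a r) := by rw [stretch]; ring
  rw [this, mul_cutoff h0 h1 h h2]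
  field_simp
  ring

theorem strictMonoOn_stretch {k a : ℝ} (h0 : 0 < a) (h1 : a < 1) (hk : 0 < k) (hka : k * a < 1) :
    StrictMono (stretch k a) := by
  have s1 : StrictMonoOn (stretch k a) (Iic a) := fun x hx y hy h => by
    rw [stretch_of_le h0 h1 hx, stretch_of_le h0 h1 hy]
    exact mul_lt_mul_of_pos_left h hk
  have s2 : StrictMonoOn (stretch k a) (Icc a 1) := fun x hx y hy h => by
    rw [stretch_of_mem h0 h1 hx.1 hx.2, stretch_of_mem h0 h1 hy.1 hy.2]
    have : 0 < (1 - k * a) / (1 - a) := div_pos (by linarith) (by linarith)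
    nlinarith
  have s3 : StrictMonoOn (stretch k a) (Ici 1) := fun x hx y hy h => by
    rwa [stretch_of_one_le h0 h1 hx, stretch_of_one_le h0 h1 hy]
  have s12 := s1.union s2 (c := a) ⟨le_refl a, fun x hx => hx⟩ ⟨⟨le_refl a, h1.le⟩, fun x hx => hx.1⟩
  have s123 := s12.union s3 (c := 1) ⟨Or.inr ⟨h1.le, le_refl 1⟩, fun x hx => hx.elim
    (fun h => le_trans h h1.le) fun h => h.2⟩ ⟨le_refl (1 : ℝ), fun x hx => hx⟩
  intro x y h
  refine s123 ?_ ?_ h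
  all_goals
    simp only [mem_union, mem_Iic, mem_Icc, mem_Ici]
    grind

theorem continuous_cutoff {a : ℝ} (h0 : 0 < a) (h1 : a < 1) : Continuous (cutoff a) := by
  unfold cutoff
  refine continuous_const.max (continuous_const.min (Continuous.div (by fun_prop) (by fun_prop) ?_))
  intro r
  exact (mul_pos (h0.trans_le (le_max_right _ _)) (by linarith)).ne'

theorem exists_stretch_eq {k a s : ℝ} (h0 : 0 < a) (h1 : a < 1) (hs : 0 ≤ s) :
    ∃ r, 0 ≤ r ∧ stretch k a r = s := by
  have hc : Continuous (stretch k a) := by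
    have := continuous_cutoff h0 h1
    unfold stretch; fun_prop
  have h := intermediate_value_Icc (by positivity : (0 : ℝ) ≤ max 1 s) hc.continuousOn
  have h2 : s ∈ Icc (stretch k a 0) (stretch k a (max 1 s)) := by
    rw [stretch_of_le h0 h1 h0.le, stretch_of_one_le h0 h1 (le_max_left _ _), mul_zero]
    exact ⟨hs, le_max_right _ _⟩
  obtain ⟨r, hr, h⟩ := h h2
  exact ⟨r, hr.1, h⟩

/-- The factor by which the fibre map multiplies complex numbers of modulus `r`. -/
noncomputable def factor (m : ℂ) (a r : ℝ) : ℂ :=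
  ((1 + (‖m‖ - 1) * cutoff a r : ℝ) : ℂ) * Complex.exp (Complex.I * (m.arg * cutoff a r : ℝ))

theorem norm_factor_mul (m : ℂ) (a r : ℝ) (hm : 0 < ‖m‖) :
    ‖factor m a r‖ * r = stretch ‖m‖ a r := by
  have h : 0 ≤ 1 + (‖m‖ - 1) * cutoff a r := by
    nlinarith [cutoff_nonneg a r, cutoff_le_one a r]
  rw [factor, norm_mul, mul_comm Complex.I, Complex.norm_exp_ofReal_mul_I, mul_one,
    Complex.norm_real, Real.norm_of_nonneg h, stretch, mul_comm]

theorem factor_of_le {m : ℂ} {a r : ℝ} (h0 : 0 < a) (h1 : a < 1) (h : r ≤ a) :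
    factor m a r = m := by
  rw [factor, cutoff_of_le h0 h1 h, mul_one, mul_one, mul_comm Complex.I]
  simp only [add_sub_cancel]
  exact Complex.norm_mul_exp_arg_mul_I m

theorem factor_of_one_le {m : ℂ} {a r : ℝ} (h0 : 0 < a) (h1 : a < 1) (h : 1 ≤ r) :
    factor m a r = 1 := by
  rw [factor, cutoff_of_one_le h0 h1 h]; simp

theorem factor_one (a r : ℝ) : factor 1 a r = 1 := by simp [factor]

theorem norm_factor_sub_one_le (m : ℂ) (a r : ℝ) :
    ‖factor m a r - 1‖ ≤ |‖m‖ - 1| + |m.arg| := by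
  have h0 := cutoff_nonneg a r
  have h1 := cutoff_le_one a r
  have h : factor m a r - 1 = (((‖m‖ - 1) * cutoff a r : ℝ) : ℂ) *
      Complex.exp (Complex.I * (m.arg * cutoff a r : ℝ)) +
      (Complex.exp (Complex.I * (m.arg * cutoff a r : ℝ)) - 1) := by
    rw [factor]; push_cast; ring
  have hb : ∀ t : ℝ, |t * cutoff a r| ≤ |t| := fun t => by
    rw [abs_mul, abs_of_nonneg h0]
    exact mul_le_of_le_one_right (abs_nonneg _) h1
  rw [h]
  refine (norm_add_le _ _).trans (add_le_add ?_ ?_)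
  · rw [norm_mul, mul_comm Complex.I, Complex.norm_exp_ofReal_mul_I, mul_one, Complex.norm_real]
    exact hb _
  · exact (Real.norm_exp_I_mul_ofReal_sub_one_le).trans (hb _)

theorem bijective_factor_mul {m : ℂ} {a : ℝ} (hm : m ≠ 0) (h0 : 0 < a) (h1 : a < 1)
    (hma : ‖m‖ * a < 1) : Function.Bijective fun q : ℂ => factor m a ‖q‖ * q := by
  have hm' : 0 < ‖m‖ := norm_pos_iff.2 hm
  have hn : ∀ q : ℂ, ‖factor m a ‖q‖ * q‖ = stretch ‖m‖ a ‖q‖ := fun q => by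
    rw [norm_mul, norm_factor_mul m a _ hm']
  have hf : ∀ r, factor m a r ≠ 0 := fun r h => by
    rw [factor, mul_eq_zero] at h
    rcases h with h | h
    · have h3 : 1 + (‖m‖ - 1) * cutoff a r = 0 := by exact_mod_cast h
      rcases (cutoff_le_one a r).eq_or_lt with h4 | h4
      · rw [h4] at h3; linarith
      · nlinarith [cutoff_nonneg a r]
    · exact Complex.exp_ne_zero _ h
  constructor
  · intro q q' h
    have h2 : ‖q‖ = ‖q'‖ := (strictMonoOn_stretch h0 h1 hm' hma).injective <| by
      rw [← hn, ← hn]; exact congrArg _ h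
    simp only [h2] at h
    exact mul_left_cancel₀ (hf _) h
  · intro q
    obtain ⟨r, hr, h⟩ := exists_stretch_eq (k := ‖m‖) h0 h1 (norm_nonneg q)
    have hr2 : ‖q / factor m a r‖ = r := by
      rw [norm_div, ← h, ← norm_factor_mul m a r hm', mul_div_cancel_left₀]
      exact norm_ne_zero_iff.2 (hf r)
    exact ⟨q / factor m a r, by simp only [hr2]; exact mul_div_cancel₀ _ (hf r)⟩

/-- A fibred homeomorphism of the cube that multiplies the inner discs of the fibres by given
complex numbers. -/
theorem exists_fiber_mul {x₀ x₁ : ℝ} (hx₀ : -1 ≤ x₀) (hx₁ : x₁ ≤ 1) {a : ℝ → ℝ} {m : ℝ → ℂ}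
    (ha : Continuous a) (hm : Continuous m) (ha0 : ∀ x ∈ Ioo x₀ x₁, 0 < a x)
    (ha1 : ∀ x ∈ Ioo x₀ x₁, a x < 1) (hma : ∀ x ∈ Ioo x₀ x₁, ‖m x‖ * a x < 1)
    (hs : ∀ x, m x ∈ Complex.slitPlane) (h1 : ∀ x, x ∉ Ioo x₀ x₁ → m x = 1) :
    ∃ g : Point → Point, Continuous g ∧ Function.Bijective g ∧ (∀ p, 1 ≤ ‖p‖ → g p = p) ∧
      (∀ p : Point, p.1 ∉ Ioo x₀ x₁ → g p = p) ∧
      ∀ x q, ‖q‖ ≤ a x → g (pt x q) = pt x (m x * q) := by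
  let F : Point → ℂ := fun p => factor (m p.1) (a p.1) ‖cplx p‖
  let g : Point → Point := fun p => pt p.1 (F p * cplx p)
  have hF : Continuous F := by
    rw [continuous_iff_continuousAt]
    intro p
    by_cases hp : p.1 ∈ Ioo x₀ x₁
    · have ca : ContinuousAt (fun p : Point => a p.1) p := (ha.comp continuous_fst).continuousAt
      have cm : ContinuousAt (fun p : Point => m p.1) p := (hm.comp continuous_fst).continuousAt
      have cr : ContinuousAt (fun p : Point => ‖cplx p‖) p := continuous_cplx.norm.continuousAt
      have c1 : ContinuousAt (fun p : Point => cutoff (a p.1) ‖cplx p‖) p := by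
        unfold cutoff
        refine continuousAt_const.max (continuousAt_const.min (ContinuousAt.div ?_ ?_ ?_))
        · exact ca.mul (continuousAt_const.sub cr)
        · exact (cr.max ca).mul (continuousAt_const.sub ca)
        · exact (mul_pos ((ha0 _ hp).trans_le (le_max_right _ _)) (by linarith [ha1 _ hp])).ne'
      have c2 : ContinuousAt (fun p : Point => (m p.1).arg) p :=
        ContinuousAt.comp (f := fun p : Point => m p.1) (Complex.continuousAt_arg (hs _)) cm
      simp only [F, factor]
      refine ContinuousAt.mul ?_ ?_
      · exact Complex.continuous_ofReal.continuousAt.comp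
          (continuousAt_const.add ((cm.norm.sub continuousAt_const).mul c1))
      · exact Complex.continuous_exp.continuousAt.comp (continuousAt_const.mul
          (Complex.continuous_ofReal.continuousAt.comp (c2.mul c1)))
    · have h2 : F p = 1 := by simp only [F]; rw [h1 _ hp, factor_one]
      rw [ContinuousAt, h2]
      have h3 : ContinuousAt (fun p : Point => |‖m p.1‖ - 1| + |(m p.1).arg|) p := by
        have cm : ContinuousAt (fun p : Point => m p.1) p := (hm.comp continuous_fst).continuousAt
        have c2 : ContinuousAt (fun p : Point => (m p.1).arg) p :=
          ContinuousAt.comp (f := fun p : Point => m p.1) (Complex.continuousAt_arg (hs _)) cm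
        exact (cm.norm.sub continuousAt_const).abs.add c2.abs
      have h4 : Tendsto (fun p : Point => |‖m p.1‖ - 1| + |(m p.1).arg|) (𝓝 p) (𝓝 0) := by
        have := h3.tendsto
        rw [h1 _ hp] at this
        simpa using this
      have h5 := squeeze_zero_norm (fun q : Point => norm_factor_sub_one_le (m q.1) (a q.1) ‖cplx q‖) h4
      simpa [F] using h5.add_const 1
  have hout : ∀ p : Point, p.1 ∉ Ioo x₀ x₁ → g p = p := fun p hp => by
    simp only [g, F]
    rw [h1 _ hp, factor_one, one_mul, pt_cplx]
  have hfib : ∀ x, Function.Bijective fun q : ℂ => factor (m x) (a x) ‖q‖ * q := fun x => by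
    by_cases hx : x ∈ Ioo x₀ x₁
    · exact bijective_factor_mul (Complex.slitPlane_ne_zero (hs x)) (ha0 x hx) (ha1 x hx) (hma x hx)
    · simp only [h1 x hx, factor_one, one_mul]
      exact Function.bijective_id
  refine ⟨g, continuous_pt.comp (continuous_fst.prodMk (hF.mul continuous_cplx)), ⟨?_, ?_⟩, ?_, hout, ?_⟩
  · intro p p' h
    obtain ⟨h2, h3⟩ := pt_injective h
    simp only [F, h2] at h3
    rw [← pt_cplx p, ← pt_cplx p', h2, (hfib _).1 h3]
  · intro p
    obtain ⟨q, hq⟩ := (hfib p.1).2 (cplx p)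
    refine ⟨pt p.1 q, ?_⟩
    simp only [g, F, pt_fst, cplx_pt]
    simp only at hq
    rw [hq, pt_cplx]
  · intro p hp
    by_cases hx : p.1 ∈ Ioo x₀ x₁
    · rcases one_le_norm_cases hp with h | h
      · exfalso
        rcases le_abs.1 h with h | h <;> linarith [hx.1, hx.2]
      · simp only [g, F]
        rw [factor_of_one_le (ha0 _ hx) (ha1 _ hx) h, one_mul, pt_cplx]
    · exact hout p hx
  · intro x q hq
    by_cases hx : x ∈ Ioo x₀ x₁
    · simp only [g, F, pt_fst, cplx_pt]
      rw [factor_of_le (ha0 x hx) (ha1 x hx) hq]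
    · rw [hout _ (by simpa using hx), h1 x hx, one_mul]

/-- The piecewise linear function with a peak of height `1` at `b`. -/
noncomputable def tent (a b c x : ℝ) : ℝ := max 0 (min ((x - a) / (b - a)) ((c - x) / (c - b)))

theorem tent_of_le {a b c x : ℝ} (hab : a < b) (hbc : b < c) (h : x ∈ Icc a b) :
    tent a b c x = (x - a) / (b - a) := by
  have h1 : (x - a) / (b - a) ≤ 1 := (div_le_one (by linarith)).2 (by linarith [h.2])
  have h2 : 1 ≤ (c - x) / (c - b) := (one_le_div (by linarith)).2 (by linarith [h.2])
  rw [tent, min_eq_left (h1.trans h2), max_eq_right (div_nonneg (by linarith [h.1]) (by linarith))]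

theorem tent_of_ge {a b c x : ℝ} (hab : a < b) (hbc : b < c) (h : x ∈ Icc b c) :
    tent a b c x = (c - x) / (c - b) := by
  have h1 : 1 ≤ (x - a) / (b - a) := (one_le_div (by linarith)).2 (by linarith [h.1])
  have h2 : (c - x) / (c - b) ≤ 1 := (div_le_one (by linarith)).2 (by linarith [h.1])
  rw [tent, min_eq_right (h2.trans h1), max_eq_right (div_nonneg (by linarith [h.2]) (by linarith))]

theorem tent_of_notMem {a b c x : ℝ} (hab : a < b) (hbc : b < c) (h : x ∉ Ioo a c) :
    tent a b c x = 0 := by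
  rw [tent, max_eq_left]
  by_cases h1 : a < x
  · have h2 : c ≤ x := by by_contra! h2; exact h ⟨h1, h2⟩
    exact (min_le_right _ _).trans (div_nonpos_of_nonpos_of_nonneg (by linarith) (by linarith))
  · push Not at h1
    exact (min_le_left _ _).trans (div_nonpos_of_nonpos_of_nonneg (by linarith) (by linarith))

theorem strictMono_add_tent {a b c s : ℝ} (hab : a < b) (hbc : b < c) (h1 : a < b + s)
    (h2 : b + s < c) : StrictMono fun x => x + s * tent a b c x := by
  have hb : (0 : ℝ) < b - a := by linarith
  have hc : (0 : ℝ) < c - b := by linarith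
  have s1 : StrictMonoOn (fun x => x + s * tent a b c x) (Iic a) := fun x hx y hy h => by
    simp only
    rw [tent_of_notMem hab hbc (fun h => not_lt.2 hx h.1),
      tent_of_notMem hab hbc (fun h => not_lt.2 hy h.1)]
    simpa
  have s2 : StrictMonoOn (fun x => x + s * tent a b c x) (Icc a b) := fun x hx y hy h => by
    simp only
    rw [tent_of_le hab hbc hx, tent_of_le hab hbc hy, ← sub_pos]
    have : y + s * ((y - a) / (b - a)) - (x + s * ((x - a) / (b - a))) =
      (y - x) * (b + s - a) / (b - a) := by field_simp; ring
    rw [this]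
    exact div_pos (mul_pos (by linarith) (by linarith)) hb
  have s3 : StrictMonoOn (fun x => x + s * tent a b c x) (Icc b c) := fun x hx y hy h => by
    simp only
    rw [tent_of_ge hab hbc hx, tent_of_ge hab hbc hy, ← sub_pos]
    have : y + s * ((c - y) / (c - b)) - (x + s * ((c - x) / (c - b))) =
      (y - x) * (c - (b + s)) / (c - b) := by field_simp; ring
    rw [this]
    exact div_pos (mul_pos (by linarith) (by linarith)) hc
  have s4 : StrictMonoOn (fun x => x + s * tent a b c x) (Ici c) := fun x hx y hy h => by
    simp only
    rw [tent_of_notMem hab hbc (fun h => not_lt.2 hx h.2),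
      tent_of_notMem hab hbc (fun h => not_lt.2 hy h.2)]
    simpa
  have s12 := s1.union s2 (c := a) ⟨le_refl a, fun x hx => hx⟩ ⟨⟨le_refl a, hab.le⟩, fun x hx => hx.1⟩
  have s34 := s3.union s4 (c := c) ⟨⟨hbc.le, le_refl c⟩, fun x hx => hx.2⟩ ⟨le_refl c, fun x hx => hx⟩
  have s := s12.union s34 (c := b) ⟨Or.inr ⟨hab.le, le_refl b⟩, fun x hx => hx.elim
    (fun h => le_trans h hab.le) fun h => h.2⟩ ⟨Or.inl ⟨le_refl b, hbc.le⟩, fun x hx => hx.elim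
    (fun h => h.1) fun h => hbc.le.trans h⟩
  intro x y h
  refine s ?_ ?_ h
  all_goals
    simp only [mem_union, mem_Iic, mem_Icc, mem_Ici]
    grind

theorem continuous_tent (a b c : ℝ) : Continuous (tent a b c) := by
  unfold tent; fun_prop

theorem tent_mem (a b c x : ℝ) (hab : a < b) (hbc : b < c) : tent a b c x ∈ Icc (0 : ℝ) 1 := by
  refine ⟨le_max_left _ _, max_le zero_le_one ?_⟩
  rcases le_total x b with h | h
  · exact (min_le_left _ _).trans ((div_le_one (by linarith)).2 (by linarith))
  · exact (min_le_right _ _).trans ((div_le_one (by linarith)).2 (by linarith))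

/-- A homeomorphism of the cube that moves the disc at `b` to the disc at `b'`. -/
theorem exists_slide {a b b' c ρ : ℝ} (ha : -1 ≤ a) (hc : c ≤ 1) (hab : a < b) (hbc : b < c)
    (hab' : a < b') (hbc' : b' < c) (hρ0 : 0 < ρ) (hρ : ρ < 1) :
    ∃ g : Point → Point, Continuous g ∧ Function.Bijective g ∧ (∀ p, 1 ≤ ‖p‖ → g p = p) ∧
      (∀ p : Point, p.1 ∉ Ioo a c → g p = p) ∧
      (∀ x ∈ Icc a b, ∀ q, ‖q‖ ≤ ρ → g (pt x q) = pt (a + (x - a) * ((b' - a) / (b - a))) q) ∧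
      (∀ x ∈ Icc b c, ∀ q, ‖q‖ ≤ ρ → g (pt x q) = pt (c - (c - x) * ((c - b') / (c - b))) q) := by
  let g : Point → Point := fun p =>
    pt (p.1 + (b' - b) * cutoff ρ ‖cplx p‖ * tent a b c p.1) (cplx p)
  have hcut : ∀ r, a < b + (b' - b) * cutoff ρ r ∧ b + (b' - b) * cutoff ρ r < c := fun r => by
    have h0 := cutoff_nonneg ρ r
    have h1 := cutoff_le_one ρ r
    rcases le_total b b' with h | h <;> constructor <;> nlinarith
  have hmono := fun r => strictMono_add_tent hab hbc (hcut r).1 (hcut r).2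
  have hout : ∀ p : Point, p.1 ∉ Ioo a c → g p = p := fun p hp => by
    simp only [g]
    rw [tent_of_notMem hab hbc hp, mul_zero, add_zero, pt_cplx]
  have hcont : Continuous g := by
    refine continuous_pt.comp (Continuous.prodMk ?_ continuous_cplx)
    exact continuous_fst.add ((continuous_const.mul ((continuous_cutoff hρ0 hρ).comp
      continuous_cplx.norm)).mul ((continuous_tent a b c).comp continuous_fst))
  refine ⟨g, hcont, ⟨?_, ?_⟩, ?_, hout, ?_, ?_⟩
  · intro p p' h
    obtain ⟨h2, h3⟩ := pt_injective h
    rw [h3] at h2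
    rw [← pt_cplx p, ← pt_cplx p', h3, (hmono _).injective h2]
  · intro p
    have hs : Function.Surjective
        fun x => x + (b' - b) * cutoff ρ ‖cplx p‖ * tent a b c x := by
      have hb : ∀ x, |(b' - b) * cutoff ρ ‖cplx p‖ * tent a b c x| ≤ |b' - b| := fun x => by
        have h1 := tent_mem a b c x hab hbc
        rw [abs_mul, abs_mul, abs_of_nonneg (cutoff_nonneg _ _), abs_of_nonneg h1.1, mul_assoc]
        exact mul_le_of_le_one_right (abs_nonneg _)
          (mul_le_one₀ (cutoff_le_one _ _) h1.1 h1.2)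
      refine Continuous.surjective ?_ ?_ ?_
      · exact continuous_id.add (continuous_const.mul (continuous_tent a b c))
      · refine tendsto_atTop_mono (fun x => ?_) (tendsto_atTop_add_const_right atTop (-|b' - b|) tendsto_id)
        simp only [id]
        linarith [(abs_le.1 (hb x)).1]
      · refine tendsto_atBot_mono (fun x => ?_) (tendsto_atBot_add_const_right atBot (|b' - b|) tendsto_id)
        simp only [id]
        linarith [(abs_le.1 (hb x)).2]
    obtain ⟨x, hx⟩ := hs p.1
    simp only at hx
    exact ⟨pt x (cplx p), by simp only [g, pt_fst, cplx_pt]; rw [hx, pt_cplx]⟩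
  · intro p hp
    rcases one_le_norm_cases hp with h | h
    · refine hout p fun hx => ?_
      rcases le_abs.1 h with h | h <;> linarith [hx.1, hx.2]
    · simp only [g]
      rw [cutoff_of_one_le hρ0 hρ h, mul_zero, zero_mul, add_zero, pt_cplx]
  · intro x hx q hq
    simp only [g, pt_fst, cplx_pt]
    rw [cutoff_of_le hρ0 hρ hq, tent_of_le hab hbc hx]
    congr 1
    have : b - a ≠ 0 := by linarith
    field_simp
    ring
  · intro x hx q hq
    simp only [g, pt_fst, cplx_pt]
    rw [cutoff_of_le hρ0 hρ hq, tent_of_ge hab hbc hx]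
    congr 1
    have : c - b ≠ 0 := by linarith
    field_simp
    ring

/-! ### Pieces of tangles and local moves -/

/-- The point of the segment from `w` to `w'` with parameter `t`. -/
noncomputable def lin (w w' : ℂ) (t : ℝ) : ℂ := w + t * (w' - w)

@[simp] theorem lin_zero (w w' : ℂ) : lin w w' 0 = w := by simp [lin]

@[simp] theorem lin_one (w w' : ℂ) : lin w w' 1 = w' := by simp [lin]

/-- Two segments, opposite to each other with respect to the first coordinate axis. -/
def arc (x₀ x₁ : ℝ) (w₀ w₁ : ℂ) : Set Point :=
  segment ℝ (pt x₀ w₀) (pt x₁ w₁) ∪ segment ℝ (pt x₀ (-w₀)) (pt x₁ (-w₁))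

theorem segment_pt (x₀ x₁ : ℝ) (w₀ w₁ : ℂ) : segment ℝ (pt x₀ w₀) (pt x₁ w₁) =
    (fun t : ℝ => pt (x₀ + t * (x₁ - x₀)) (lin w₀ w₁ t)) '' Icc 0 1 := by
  rw [segment_eq_image']
  refine image_congr fun t _ => ?_
  ext <;> simp [pt, lin]

theorem lin_neg (w w' : ℂ) (t : ℝ) : lin (-w) (-w') t = -lin w w' t := by
  simp only [lin]; ring

theorem mul_lin (m w w' : ℂ) (t : ℝ) : lin (m * w) (m * w') t = m * lin w w' t := by
  simp only [lin]; ring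

theorem mem_arc {x₀ x₁ : ℝ} {w₀ w₁ : ℂ} {p : Point} : p ∈ arc x₀ x₁ w₀ w₁ ↔
    ∃ t ∈ Icc (0 : ℝ) 1, p = pt (x₀ + t * (x₁ - x₀)) (lin w₀ w₁ t) ∨
      p = pt (x₀ + t * (x₁ - x₀)) (-lin w₀ w₁ t) := by
  rw [arc, segment_pt, segment_pt]
  simp only [mem_union, mem_image, lin_neg]
  grind

theorem arc_neg (x₀ x₁ : ℝ) (w₀ w₁ : ℂ) : arc x₀ x₁ (-w₀) (-w₁) = arc x₀ x₁ w₀ w₁ := by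
  rw [arc, arc, neg_neg, neg_neg, union_comm]

theorem arc_fst_mem {x₀ x₁ : ℝ} (h : x₀ ≤ x₁) {w₀ w₁ : ℂ} {p : Point} (hp : p ∈ arc x₀ x₁ w₀ w₁) :
    p.1 ∈ Icc x₀ x₁ := by
  obtain ⟨t, ht, rfl | rfl⟩ := mem_arc.1 hp <;> simp only [pt_fst] <;>
    constructor <;> nlinarith [ht.1, ht.2]

theorem image_arc {g : Point → Point} {x₀ x₁ x₀' x₁' : ℝ} {w₀ w₁ w₀' w₁' : ℂ}
    (h : ∀ t ∈ Icc (0 : ℝ) 1,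
      g (pt (x₀ + t * (x₁ - x₀)) (lin w₀ w₁ t)) = pt (x₀' + t * (x₁' - x₀')) (lin w₀' w₁' t))
    (h' : ∀ t ∈ Icc (0 : ℝ) 1,
      g (pt (x₀ + t * (x₁ - x₀)) (-lin w₀ w₁ t)) = pt (x₀' + t * (x₁' - x₀')) (-lin w₀' w₁' t)) :
    g '' arc x₀ x₁ w₀ w₁ = arc x₀' x₁' w₀' w₁' := by
  simp only [arc, segment_pt, image_union, image_image, lin_neg]
  rw [image_congr h, image_congr h']

theorem arc_union_arc {x₀ x₁ x₂ : ℝ} (h₀ : x₀ < x₁) (h₁ : x₁ < x₂) {w₀ w₁ w₂ : ℂ}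
    (hw : w₁ = lin w₀ w₂ ((x₁ - x₀) / (x₂ - x₀))) :
    arc x₀ x₁ w₀ w₁ ∪ arc x₁ x₂ w₁ w₂ = arc x₀ x₂ w₀ w₂ := by
  have h2 : (0 : ℝ) < x₂ - x₀ := by linarith
  set s := (x₁ - x₀) / (x₂ - x₀) with hs
  have hs0 : 0 < s := div_pos (by linarith) h2
  have hs1 : s < 1 := (div_lt_one h2).2 (by linarith)
  have hx : x₁ = x₀ + s * (x₂ - x₀) := by rw [hs]; field_simp; ring
  have e1 : ∀ t : ℝ, x₀ + t * (x₁ - x₀) = x₀ + (t * s) * (x₂ - x₀) ∧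
      lin w₀ w₁ t = lin w₀ w₂ (t * s) := fun t => by
    rw [hx, hw]; simp only [lin]; push_cast; constructor <;> ring
  have e2 : ∀ t : ℝ, x₁ + t * (x₂ - x₁) = x₀ + (s + t * (1 - s)) * (x₂ - x₀) ∧
      lin w₁ w₂ t = lin w₀ w₂ (s + t * (1 - s)) := fun t => by
    rw [hx, hw]; simp only [lin]; push_cast; constructor <;> ring
  ext p
  simp only [mem_union, mem_arc]
  constructor
  · rintro (⟨t, ht, h⟩ | ⟨t, ht, h⟩)
    · rw [(e1 t).1, (e1 t).2] at h
      exact ⟨t * s, ⟨mul_nonneg ht.1 hs0.le, mul_le_one₀ ht.2 hs0.le hs1.le⟩, h⟩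
    · rw [(e2 t).1, (e2 t).2] at h
      exact ⟨s + t * (1 - s), ⟨by nlinarith [ht.1], by nlinarith [ht.2]⟩, h⟩
  · rintro ⟨t, ht, h⟩
    rcases le_total t s with hts | hts
    · left
      refine ⟨t / s, ⟨div_nonneg ht.1 hs0.le, (div_le_one hs0).2 hts⟩, ?_⟩
      rw [(e1 _).1, (e1 _).2, div_mul_cancel₀ _ hs0.ne']
      exact h
    · right
      have h1s : (0 : ℝ) < 1 - s := by linarith
      refine ⟨(t - s) / (1 - s), ⟨div_nonneg (by linarith) h1s.le,
        (div_le_one h1s).2 (by linarith [ht.2])⟩, ?_⟩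
      rw [(e2 _).1, (e2 _).2, div_mul_cancel₀ _ h1s.ne', add_sub_cancel]
      exact h

/-- A copy of `X` at `(c,0,0)`, scaled by `d` in the first coordinate and by the complex number `v`
in the other two. -/
def place (c d : ℝ) (v : ℂ) (X : Set Point) : Set Point :=
  (fun p : Point => pt (c + d * p.1) (v * cplx p)) '' X

/-- `X` lies in the cylinder of square radius `s` over `[-1,1]`. -/
def InCylinder (s : ℝ) (X : Set Point) : Prop :=
  ∀ p ∈ X, |p.1| ≤ 1 ∧ Complex.normSq (cplx p) ≤ s

theorem place_fst_mem {s : ℝ} {X : Set Point} (hX : InCylinder s X) {c d : ℝ} (hd : 0 ≤ d) {v : ℂ}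
    {p : Point} (hp : p ∈ place c d v X) : p.1 ∈ Icc (c - d) (c + d) := by
  obtain ⟨q, hq, rfl⟩ := hp
  have := abs_le.1 (hX q hq).1
  simp only [pt_fst]
  constructor <;> nlinarith

theorem place_place (c d c' d' : ℝ) (v v' : ℂ) (X : Set Point) :
    place c d v (place c' d' v' X) = place (c + d * c') (d * d') (v * v') X := by
  simp only [place, image_image, pt_fst, cplx_pt]
  refine image_congr fun p _ => ?_
  congr 1 <;> ring

theorem place_union (c d : ℝ) (v : ℂ) (X Y : Set Point) :
    place c d v (X ∪ Y) = place c d v X ∪ place c d v Y := image_union _ _ _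

theorem place_arc (c d : ℝ) (v : ℂ) (x₀ x₁ : ℝ) (w₀ w₁ : ℂ) :
    place c d v (arc x₀ x₁ w₀ w₁) = arc (c + d * x₀) (c + d * x₁) (v * w₀) (v * w₁) := by
  refine image_arc (fun t _ => ?_) fun t _ => ?_ <;> simp only [pt_fst, cplx_pt, mul_lin] <;>
    congr 1 <;> ring

/-- The union of a list of sets. -/
def chain (l : List (Set Point)) : Set Point := {p | ∃ s ∈ l, p ∈ s}

@[simp] theorem chain_nil : chain [] = ∅ := by simp [chain]

@[simp] theorem chain_cons (s : Set Point) (l : List (Set Point)) :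
    chain (s :: l) = s ∪ chain l := by
  ext; simp [chain]

theorem chain_append (l l' : List (Set Point)) : chain (l ++ l') = chain l ∪ chain l' := by
  induction l <;> simp_all [union_assoc]

/-- `A` is carried to `B` by a homeomorphism of the cube that moves only points with first
coordinate in `(a,b)`. -/
def LocalMove (a b : ℝ) (A B : Set Point) : Prop :=
  ∃ g : Point → Point, Continuous g ∧ Function.Bijective g ∧ (∀ p, 1 ≤ ‖p‖ → g p = p) ∧
    (∀ p : Point, p.1 ∉ Ioo a b → g p = p) ∧ g '' A = B

/-- No point of `A` has its first coordinate in `(a,b)`. -/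
def Outside (a b : ℝ) (A : Set Point) : Prop := ∀ p ∈ A, p.1 ∉ Ioo a b

theorem outside_arc {a b x₀ x₁ : ℝ} {w₀ w₁ : ℂ} (h : x₀ ≤ x₁) (h' : x₁ ≤ a ∨ b ≤ x₀) :
    Outside a b (arc x₀ x₁ w₀ w₁) := fun p hp hx => by
  have := arc_fst_mem h hp
  rcases h' with h' | h' <;> linarith [this.1, this.2, hx.1, hx.2]

theorem outside_place {a b c d s : ℝ} {v : ℂ} {X : Set Point} (hX : InCylinder s X) (hd : 0 ≤ d)
    (h' : c + d ≤ a ∨ b ≤ c - d) : Outside a b (place c d v X) := fun p hp hx => by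
  have := place_fst_mem hX hd hp
  rcases h' with h' | h' <;> linarith [this.1, this.2, hx.1, hx.2]

theorem LocalMove.chain {a b : ℝ} {A B : List (Set Point)}
    (h : LocalMove a b (chain A) (chain B)) (l l' : List (Set Point))
    (hl : ∀ s ∈ l ++ l', Outside a b s) :
    Isotopic (SolidTorusLinks.chain (l ++ A ++ l')) (SolidTorusLinks.chain (l ++ B ++ l')) := by
  obtain ⟨g, hc, hb, hg, ho, hA⟩ := h
  have hfix : ∀ m : List (Set Point), (∀ s ∈ m, Outside a b s) →
      g '' SolidTorusLinks.chain m = SolidTorusLinks.chain m := fun m hm => by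
    have : EqOn g id (SolidTorusLinks.chain m) := fun p ⟨s, hs, hp⟩ => ho p (hm s hs p hp)
    rw [this.image_eq, image_id]
  have e : g '' SolidTorusLinks.chain (l ++ A ++ l') = SolidTorusLinks.chain (l ++ B ++ l') := by
    rw [chain_append, chain_append, image_union, image_union, hA,
      hfix l fun s hs => hl s (List.mem_append_left _ hs),
      hfix l' fun s hs => hl s (List.mem_append_right _ hs), ← chain_append, ← chain_append]
  exact e ▸ Isotopic.of_bijective hc hb hg _

theorem LocalMove.trans {a b : ℝ} {A B C : Set Point} (h : LocalMove a b A B)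
    (h' : LocalMove a b B C) : LocalMove a b A C := by
  obtain ⟨g, hc, hb, hg, ho, rfl⟩ := h
  obtain ⟨k, kc, kb, kg, ko, rfl⟩ := h'
  exact ⟨k ∘ g, kc.comp hc, kb.comp hb, fun p hp => by simp [hg p hp, kg p hp],
    fun p hp => by simp [ho p hp, ko p hp], image_comp _ _ _⟩

/-! #### Multiplying a box by a complex number -/

/-- The affine function that is `0` at `a` and `1` at `b`, clamped to `[0,1]`. -/
noncomputable def ramp (a b x : ℝ) : ℝ := max 0 (min 1 ((x - a) / (b - a)))

theorem continuous_ramp (a b : ℝ) : Continuous (ramp a b) := by unfold ramp; fun_prop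

theorem ramp_mem (a b x : ℝ) : ramp a b x ∈ Icc (0 : ℝ) 1 :=
  ⟨le_max_left _ _, max_le zero_le_one (min_le_left _ _)⟩

theorem ramp_of_le {a b x : ℝ} (h : a < b) (hx : x ≤ a) : ramp a b x = 0 :=
  max_eq_left ((min_le_right _ _).trans
    (div_nonpos_of_nonpos_of_nonneg (by linarith) (by linarith)))

theorem ramp_of_ge {a b x : ℝ} (h : a < b) (hx : b ≤ x) : ramp a b x = 1 := by
  rw [ramp, min_eq_left ((one_le_div (by linarith)).2 (by linarith)), max_eq_right zero_le_one]

theorem ramp_add_mul {a b t : ℝ} (h : a < b) (ht : t ∈ Icc (0 : ℝ) 1) :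
    ramp a b (a + t * (b - a)) = t := by
  have : (a + t * (b - a) - a) / (b - a) = t := by
    have : b - a ≠ 0 := by linarith
    field_simp; ring
  rw [ramp, this, min_eq_right ht.2, max_eq_right ht.1]

theorem ramp_pos {a b x : ℝ} (h : a < b) (hx : a < x) : 0 < ramp a b x :=
  lt_max_of_lt_right (lt_min zero_lt_one (div_pos (by linarith) (by linarith)))

theorem ramp_lt_one {a b x : ℝ} (h : a < b) (hx : x < b) : ramp a b x < 1 :=
  max_lt zero_lt_one ((min_le_right _ _).trans_lt ((div_lt_one (by linarith)).2 (by linarith)))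

theorem continuous_lin (w w' : ℂ) : Continuous (lin w w') := by
  unfold lin
  exact continuous_const.add (Complex.continuous_ofReal.mul continuous_const)

theorem re_mul_lin_pos {u w w' : ℂ} (h : 0 < (u * w).re) (h' : 0 < (u * w').re) {t : ℝ}
    (ht : t ∈ Icc (0 : ℝ) 1) : 0 < (u * lin w w' t).re := by
  have : u * lin w w' t = ((1 - t : ℝ) : ℂ) * (u * w) + (t : ℂ) * (u * w') := by
    simp only [lin]; push_cast; ring
  rw [this, Complex.add_re, Complex.re_ofReal_mul, Complex.re_ofReal_mul]
  rcases ht.1.eq_or_lt with h0 | h0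
  · rw [← h0]; simpa using h
  · have := mul_pos h0 h'
    have := mul_nonneg (sub_nonneg.2 ht.2) h.le
    linarith

theorem norm_lin_le (w w' : ℂ) {t : ℝ} (ht : t ∈ Icc (0 : ℝ) 1) :
    ‖lin w w' t‖ ≤ (1 - t) * ‖w‖ + t * ‖w'‖ := by
  have : lin w w' t = ((1 - t : ℝ) : ℂ) * w + (t : ℂ) * w' := by
    simp only [lin]; push_cast; ring
  rw [this]
  refine (norm_add_le _ _).trans_eq ?_
  rw [norm_mul, norm_mul, Complex.norm_real, Complex.norm_real, Real.norm_of_nonneg ht.1,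
    Real.norm_of_nonneg (sub_nonneg.2 ht.2)]

theorem norm_lin_lt_one {w w' : ℂ} (h : ‖w‖ ≤ 1) (h' : ‖w'‖ < 1) {t : ℝ}
    (ht : t ∈ Icc (0 : ℝ) 1) (h0 : 0 < t) : ‖lin w w' t‖ < 1 := by
  refine (norm_lin_le w w' ht).trans_lt ?_
  nlinarith [ht.2]

theorem norm_lin_lt_one' {w w' : ℂ} (h : ‖w‖ < 1) (h' : ‖w'‖ ≤ 1) {t : ℝ}
    (ht : t ∈ Icc (0 : ℝ) 1) (h0 : t < 1) : ‖lin w w' t‖ < 1 := by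
  refine (norm_lin_le w w' ht).trans_lt ?_
  nlinarith [ht.1]

theorem div_mem_slitPlane {u a b : ℂ} (ha : 0 < (u * a).re) (hb : 0 < (u * b).re) :
    b / a ∈ Complex.slitPlane := by
  by_contra h
  rw [Complex.mem_slitPlane_iff] at h
  push Not at h
  have ha0 : a ≠ 0 := by rintro rfl; simp at ha
  have h1 : b / a = ((b / a).re : ℂ) := Complex.ext rfl (by simpa using h.2)
  have h2 : u * b = ((b / a).re : ℂ) * (u * a) := by
    rw [← h1]; field_simp
  rw [h2, Complex.re_ofReal_mul] at hb
  nlinarith [h.1]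

/-- A set between two arcs can be multiplied by a complex number if the ends of the arcs next to it
can be moved accordingly in half planes. -/
theorem localMove_mul {x₀ x₁ x₂ x₃ : ℝ} {w₀ w₁ w₂ w₃ m : ℂ} (u v : ℂ) {Y : Set Point}
    (hx : -1 ≤ x₀) (h₀ : x₀ < x₁) (h₁ : x₁ ≤ x₂) (h₂ : x₂ < x₃) (hx' : x₃ ≤ 1)
    (hw₀ : ‖w₀‖ ≤ 1) (hw₁ : ‖w₁‖ < 1) (hw : ‖w₁‖ = ‖w₂‖) (hw₃ : ‖w₃‖ ≤ 1) (hm : ‖m * w₁‖ < 1)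
    (u₀ : 0 < (u * w₀).re) (u₁ : 0 < (u * w₁).re) (u₂ : 0 < (u * (m * w₁)).re)
    (v₀ : 0 < (v * w₂).re) (v₁ : 0 < (v * (m * w₂)).re) (v₂ : 0 < (v * w₃).re)
    (hY : ∀ p ∈ Y, p.1 ∈ Icc x₁ x₂ ∧ ‖cplx p‖ ≤ ‖w₁‖) :
    LocalMove x₀ x₃ (arc x₀ x₁ w₀ w₁ ∪ Y ∪ arc x₂ x₃ w₂ w₃)
      (arc x₀ x₁ w₀ (m * w₁) ∪ (fun p => pt p.1 (m * cplx p)) '' Y ∪ arc x₂ x₃ (m * w₂) w₃) := by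
  have ne : ∀ {u w : ℂ}, 0 < (u * w).re → w ≠ 0 := by
    rintro u w h rfl; simp at h
  let L (x : ℝ) := lin w₀ w₁ (ramp x₀ x₁ x)
  let L' (x : ℝ) := lin w₀ (m * w₁) (ramp x₀ x₁ x)
  let R (x : ℝ) := lin w₂ w₃ (ramp x₂ x₃ x)
  let R' (x : ℝ) := lin (m * w₂) w₃ (ramp x₂ x₃ x)
  have pL : ∀ x, 0 < (u * L x).re := fun x => re_mul_lin_pos u₀ u₁ (ramp_mem _ _ _)
  have pL' : ∀ x, 0 < (u * L' x).re := fun x => re_mul_lin_pos u₀ u₂ (ramp_mem _ _ _)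
  have pR : ∀ x, 0 < (v * R x).re := fun x => re_mul_lin_pos v₀ v₂ (ramp_mem _ _ _)
  have pR' : ∀ x, 0 < (v * R' x).re := fun x => re_mul_lin_pos v₁ v₂ (ramp_mem _ _ _)
  have cL : Continuous L := (continuous_lin _ _).comp (continuous_ramp _ _)
  have cL' : Continuous L' := (continuous_lin _ _).comp (continuous_ramp _ _)
  have cR : Continuous R := (continuous_lin _ _).comp (continuous_ramp _ _)
  have cR' : Continuous R' := (continuous_lin _ _).comp (continuous_ramp _ _)
  have eL : L x₁ = w₁ ∧ L' x₁ = m * w₁ := by simp [L, L', ramp_of_ge h₀ le_rfl]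
  have eR : ∀ x ≤ x₂, R x = w₂ ∧ R' x = m * w₂ := fun x hx => by
    simp [R, R', ramp_of_le h₂ hx]
  let a (x : ℝ) : ℝ := if x ≤ x₁ then ‖L x‖ else ‖R x‖
  let k (x : ℝ) : ℂ := if x ≤ x₁ then L' x / L x else R' x / R x
  have ca : Continuous a := Continuous.if_le cL.norm cR.norm continuous_id continuous_const <| by
    rintro x rfl
    rw [eL.1, (eR x h₁).1, hw]
  have ck : Continuous k := by
    refine Continuous.if_le (cL'.div cL fun x => ne (pL x)) (cR'.div cR fun x => ne (pR x))
      continuous_id continuous_const ?_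
    rintro x rfl
    rw [eL.1, eL.2, (eR x h₁).1, (eR x h₁).2, mul_div_cancel_right₀ _ (ne u₁),
      mul_div_cancel_right₀ _ (ne v₀)]
  have hw₂ : ‖w₂‖ < 1 := hw ▸ hw₁
  have hm₂ : ‖m * w₂‖ < 1 := by rwa [norm_mul, ← hw, ← norm_mul]
  obtain ⟨g, hc, hb, hg, ho, hgm⟩ := exists_fiber_mul (a := a) (m := k) hx hx' ca ck
    (fun x _ => by
      simp only [a]
      split_ifs
      · exact norm_pos_iff.2 (ne (pL x))
      · exact norm_pos_iff.2 (ne (pR x)))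
    (fun x h => by
      simp only [a]
      split_ifs with h3
      · exact norm_lin_lt_one hw₀ hw₁ (ramp_mem _ _ _) (ramp_pos h₀ h.1)
      · exact norm_lin_lt_one' hw₂ hw₃ (ramp_mem _ _ _) (ramp_lt_one h₂ h.2))
    (fun x h => by
      simp only [a, k]
      split_ifs with h3
      · rw [← norm_mul, div_mul_cancel₀ _ (ne (pL x))]
        exact norm_lin_lt_one hw₀ hm (ramp_mem _ _ _) (ramp_pos h₀ h.1)
      · rw [← norm_mul, div_mul_cancel₀ _ (ne (pR x))]
        exact norm_lin_lt_one' hm₂ hw₃ (ramp_mem _ _ _) (ramp_lt_one h₂ h.2))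
    (fun x => by
      simp only [k]
      split_ifs
      · exact div_mem_slitPlane (pL x) (pL' x)
      · exact div_mem_slitPlane (pR x) (pR' x))
    (fun x h => by
      simp only [k]
      split_ifs with h3
      · have h4 : x ≤ x₀ := by
          by_contra! h4
          exact h ⟨h4, by linarith⟩
        simp only [L, L', ramp_of_le h₀ h4, lin_zero]
        exact div_self (ne u₀)
      · have h4 : x₃ ≤ x := by
          by_contra! h4
          exact h ⟨by linarith, h4⟩
        simp only [R, R', ramp_of_ge h₂ h4, lin_one]
        exact div_self (ne v₂))
  have gL : ∀ t ∈ Icc (0 : ℝ) 1, ∀ q, ‖q‖ ≤ ‖lin w₀ w₁ t‖ → g (pt (x₀ + t * (x₁ - x₀)) q) =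
      pt (x₀ + t * (x₁ - x₀)) (lin w₀ (m * w₁) t / lin w₀ w₁ t * q) := fun t ht q hq => by
    have hle : x₀ + t * (x₁ - x₀) ≤ x₁ := by nlinarith [ht.2]
    rw [hgm]
    · simp only [k, if_pos hle, L, L', ramp_add_mul h₀ ht]
    · simp only [a, if_pos hle, L, ramp_add_mul h₀ ht]; exact hq
  have kM : ∀ x ∈ Icc x₁ x₂, k x = m ∧ a x = ‖w₁‖ := fun x h => by
    rcases h.1.eq_or_lt with rfl | h3
    · simp only [a, k, if_pos le_rfl, eL.1, eL.2]
      exact ⟨mul_div_cancel_right₀ _ (ne u₁), trivial⟩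
    · simp only [a, k, if_neg (not_le.2 h3), (eR x h.2).1, (eR x h.2).2]
      exact ⟨mul_div_cancel_right₀ _ (ne v₀), hw.symm⟩
  have gR : ∀ t ∈ Icc (0 : ℝ) 1, ∀ q, ‖q‖ ≤ ‖lin w₂ w₃ t‖ → g (pt (x₂ + t * (x₃ - x₂)) q) =
      pt (x₂ + t * (x₃ - x₂)) (lin (m * w₂) w₃ t / lin w₂ w₃ t * q) := fun t ht q hq => by
    rcases ht.1.eq_or_lt with rfl | h0
    · simp only [zero_mul, add_zero, lin_zero] at hq ⊢
      rw [hgm, (kM x₂ ⟨h₁, le_rfl⟩).1, mul_div_cancel_right₀ _ (ne v₀)]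
      rwa [(kM x₂ ⟨h₁, le_rfl⟩).2, hw]
    · have hlt : ¬ x₂ + t * (x₃ - x₂) ≤ x₁ := by nlinarith
      rw [hgm]
      · simp only [k, if_neg hlt, R, R', ramp_add_mul h₂ ht]
      · simp only [a, if_neg hlt, R, ramp_add_mul h₂ ht]; exact hq
  refine ⟨g, hc, hb, hg, ho, ?_⟩
  rw [image_union, image_union]
  congr 1
  congr 1
  · refine image_arc (fun t ht => ?_) (fun t ht => ?_)
    · rw [gL t ht _ le_rfl, div_mul_cancel₀ _ (ne (re_mul_lin_pos u₀ u₁ ht))]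
    · rw [gL t ht _ (norm_neg _).le, mul_neg, div_mul_cancel₀ _ (ne (re_mul_lin_pos u₀ u₁ ht))]
  · refine image_congr fun p hp => ?_
    obtain ⟨h3, h4⟩ := hY p hp
    rw [← (kM _ h3).2] at h4
    rw [← pt_cplx p, hgm _ _ h4, pt_fst, cplx_pt, (kM _ h3).1]
  · refine image_arc (fun t ht => ?_) (fun t ht => ?_)
    · rw [gR t ht _ le_rfl, div_mul_cancel₀ _ (ne (re_mul_lin_pos v₀ v₂ ht))]
    · rw [gR t ht _ (norm_neg _).le, mul_neg, div_mul_cancel₀ _ (ne (re_mul_lin_pos v₀ v₂ ht))]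

theorem norm_lt_one_iff_normSq {w : ℂ} : ‖w‖ < 1 ↔ Complex.normSq w < 1 := by
  rw [Complex.normSq_eq_norm_sq, sq_lt_one_iff₀ (norm_nonneg w)]

theorem norm_le_one_iff_normSq {w : ℂ} : ‖w‖ ≤ 1 ↔ Complex.normSq w ≤ 1 := by
  rw [Complex.normSq_eq_norm_sq, sq_le_one_iff₀ (norm_nonneg w)]

theorem norm_le_norm_iff_normSq {w z : ℂ} : ‖w‖ ≤ ‖z‖ ↔ Complex.normSq w ≤ Complex.normSq z := by
  rw [Complex.normSq_eq_norm_sq, Complex.normSq_eq_norm_sq,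
    pow_le_pow_iff_left₀ (norm_nonneg w) (norm_nonneg z) two_ne_zero]

/-- A vertex between two pairs of arcs can be removed if the triangles do not meet the axis. -/
theorem isotopic_removeNode (l l' : List (Set Point)) {x₀ x₁ x₂ : ℝ} {w₀ w₁ w₂ : ℂ} (u : ℂ)
    (hl : ∀ s ∈ l ++ l', Outside x₀ x₂ s)
    (h : -1 ≤ x₀ ∧ x₀ < x₁ ∧ x₁ < x₂ ∧ x₂ ≤ 1 ∧
      Complex.normSq w₀ ≤ 1 ∧ Complex.normSq w₁ < 1 ∧ Complex.normSq w₂ ≤ 1 ∧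
      (Complex.normSq w₀ < 1 ∨ Complex.normSq w₂ < 1) ∧
      0 < (u * w₀).re ∧ 0 < (u * w₁).re ∧ 0 < (u * w₂).re) :
    Isotopic (chain (l ++ [arc x₀ x₁ w₀ w₁, arc x₁ x₂ w₁ w₂] ++ l'))
      (chain (l ++ [arc x₀ x₂ w₀ w₂] ++ l')) := by
  obtain ⟨hx, h₀, h₁, hx', hw₀, hw₁, hw₂, hw, u₀, u₁, u₂⟩ := h
  rw [← norm_le_one_iff_normSq] at hw₀ hw₂
  rw [← norm_lt_one_iff_normSq] at hw₁
  rw [← norm_lt_one_iff_normSq, ← norm_lt_one_iff_normSq] at hw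
  have h2 : (0 : ℝ) < x₂ - x₀ := by linarith
  set t := (x₁ - x₀) / (x₂ - x₀) with ht
  have t0 : 0 < t := div_pos (by linarith) h2
  have t1 : t < 1 := (div_lt_one h2).2 (by linarith)
  have n1 : w₁ ≠ 0 := by rintro rfl; simp at u₁
  set m := lin w₀ w₂ t / w₁ with hm
  have e : m * w₁ = lin w₀ w₂ t := div_mul_cancel₀ _ n1
  have hlt : ‖lin w₀ w₂ t‖ < 1 := by
    rcases hw with hw | hw
    · exact norm_lin_lt_one' hw hw₂ ⟨t0.le, t1.le⟩ t1
    · exact norm_lin_lt_one hw₀ hw ⟨t0.le, t1.le⟩ t0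
  have hu : 0 < (u * lin w₀ w₂ t).re := re_mul_lin_pos u₀ u₂ ⟨t0.le, t1.le⟩
  have key := localMove_mul (x₀ := x₀) (x₁ := x₁) (x₂ := x₁) (x₃ := x₂) (w₀ := w₀) (w₁ := w₁)
    (w₂ := w₁) (w₃ := w₂) (m := m) u u (Y := ∅) hx h₀ le_rfl h₁ hx' hw₀ hw₁ rfl hw₂
    (e ▸ hlt) u₀ u₁ (e ▸ hu) u₁ (e ▸ hu) u₂ (by simp)
  rw [e, image_empty, union_empty, union_empty, arc_union_arc h₀ h₁ rfl] at key
  have key' : LocalMove x₀ x₂ (chain [arc x₀ x₁ w₀ w₁, arc x₁ x₂ w₁ w₂])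
      (chain [arc x₀ x₂ w₀ w₂]) := by simpa using key
  exact key'.chain l l' hl

/-- A box can be multiplied by a complex number. -/
theorem isotopic_mulBox (l l' : List (Set Point)) {x₀ x₁ x₂ x₃ c d s : ℝ}
    {w₀ w₁ w₂ w₃ n w₁' w₂' n' : ℂ} {X : Set Point} (hX : InCylinder s X) (u v m : ℂ)
    (hl : ∀ s ∈ l ++ l', Outside x₀ x₃ s)
    (hm : w₁' = m * w₁ ∧ w₂' = m * w₂ ∧ n' = m * n)
    (h : 0 < d ∧ x₁ = c - d ∧ x₂ = c + d ∧ -1 ≤ x₀ ∧ x₀ < x₁ ∧ x₂ < x₃ ∧ x₃ ≤ 1 ∧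
      Complex.normSq w₀ ≤ 1 ∧ Complex.normSq w₁ < 1 ∧ Complex.normSq w₁ = Complex.normSq w₂ ∧
      Complex.normSq w₃ ≤ 1 ∧ Complex.normSq w₁' < 1 ∧ Complex.normSq n * s ≤ Complex.normSq w₁ ∧
      0 < (u * w₀).re ∧ 0 < (u * w₁).re ∧ 0 < (u * w₁').re ∧
      0 < (v * w₂).re ∧ 0 < (v * w₂').re ∧ 0 < (v * w₃).re) :
    Isotopic (chain (l ++ [arc x₀ x₁ w₀ w₁, place c d n X, arc x₂ x₃ w₂ w₃] ++ l'))
      (chain (l ++ [arc x₀ x₁ w₀ w₁', place c d n' X, arc x₂ x₃ w₂' w₃] ++ l')) := by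
  obtain ⟨hw₁', hw₂', hn⟩ := hm
  obtain ⟨hd, hx₁, hx₂, hx, h₀, h₂, hx', hw₀, hw₁, hw, hw₃, hm, hs, u₀, u₁, u₂, v₀, v₁, v₂⟩ := h
  rw [← norm_le_one_iff_normSq] at hw₀ hw₃
  rw [← norm_lt_one_iff_normSq] at hw₁ hm
  have hw' : ‖w₁‖ = ‖w₂‖ := le_antisymm (norm_le_norm_iff_normSq.2 hw.le)
    (norm_le_norm_iff_normSq.2 hw.ge)
  subst hw₁' hw₂' hn
  have key := localMove_mul u v (Y := place c d n X) hx h₀ (by linarith) h₂ hx' hw₀ hw₁ hw' hw₃ hm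
    u₀ u₁ u₂ v₀ v₁ v₂ (fun p hp => by
      refine ⟨?_, ?_⟩
      · have := place_fst_mem hX hd.le hp
        rwa [hx₁, hx₂]
      · obtain ⟨q, hq, rfl⟩ := hp
        rw [norm_le_norm_iff_normSq, cplx_pt, map_mul]
        exact (mul_le_mul_of_nonneg_left (hX q hq).2 (Complex.normSq_nonneg _)).trans hs)
  have e : (fun p => pt p.1 (m * cplx p)) '' place c d n X = place c d (m * n) X := by
    simp only [place, image_image, pt_fst, cplx_pt, mul_assoc]
  rw [e] at key
  have key' : LocalMove x₀ x₃ (chain [arc x₀ x₁ w₀ w₁, place c d n X, arc x₂ x₃ w₂ w₃])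
      (chain [arc x₀ x₁ w₀ (m * w₁), place c d (m * n) X, arc x₂ x₃ (m * w₂) w₃]) := by
    simpa [union_assoc] using key
  exact key'.chain l l' hl

/-- One end of a box can be moved in the direction of the first coordinate. -/
theorem localMove_slide_left {x₀ x₁ x₁' x₂ x₃ x₂' c d c' d' s : ℝ} {w₀ w₁ w₂ w₃ n : ℂ}
    {X : Set Point} (hX : InCylinder s X) (hx : -1 ≤ x₀) (h₀ : x₀ < x₁) (h₁ : x₁ < x₂)
    (h₂ : x₂ < x₃) (hx' : x₃ ≤ 1) (h₀' : x₀ < x₁') (h₁' : x₁' < x₃)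
    (e : x₃ - x₂' = (x₃ - x₂) * ((x₃ - x₁') / (x₃ - x₁)))
    (hx₁ : x₁ = c - d) (hx₂ : x₂ = c + d) (hx₁' : x₁' = c' - d') (hx₂' : x₂' = c' + d')
    {ρ : ℝ} (hρ0 : 0 < ρ) (hρ : ρ < 1)
    (hw₀ : ‖w₀‖ ≤ ρ) (hw₁ : ‖w₁‖ ≤ ρ) (hw₂ : ‖w₂‖ ≤ ρ) (hw₃ : ‖w₃‖ ≤ ρ)
    (hn : ∀ p ∈ X, ‖n * cplx p‖ ≤ ρ) :
    LocalMove x₀ x₃ (arc x₀ x₁ w₀ w₁ ∪ place c d n X ∪ arc x₂ x₃ w₂ w₃)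
      (arc x₀ x₁' w₀ w₁ ∪ place c' d' n X ∪ arc x₂' x₃ w₂ w₃) := by
  obtain ⟨g, hc, hb, hg, ho, hL, hR⟩ :=
    exists_slide (b' := x₁') hx hx' h₀ (h₁.trans h₂) h₀' h₁' hρ0 hρ
  have hlin : ∀ {w w' : ℂ} {t : ℝ}, ‖w‖ ≤ ρ → ‖w'‖ ≤ ρ → t ∈ Icc (0 : ℝ) 1 → ‖lin w w' t‖ ≤ ρ :=
    fun h h' ht => (norm_lin_le _ _ ht).trans (by nlinarith [ht.1, ht.2])
  have q1 : x₁ - x₀ ≠ 0 := by linarith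
  have q3 : x₃ - x₁ ≠ 0 := by linarith
  refine ⟨g, hc, hb, hg, ho, ?_⟩
  rw [image_union, image_union]
  congr 1
  congr 1
  · have : ∀ t ∈ Icc (0 : ℝ) 1, ∀ q, ‖q‖ ≤ ρ →
        g (pt (x₀ + t * (x₁ - x₀)) q) = pt (x₀ + t * (x₁' - x₀)) q := fun t ht q hq => by
      rw [hL _ ⟨by nlinarith [ht.1], by nlinarith [ht.2]⟩ _ hq]
      congr 1
      field_simp
      ring
    exact image_arc (fun t ht => this t ht _ (hlin hw₀ hw₁ ht))
      fun t ht => this t ht _ (by rw [norm_neg]; exact hlin hw₀ hw₁ ht)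
  · simp only [place, image_image]
    refine image_congr fun p hp => ?_
    have hp1 := abs_le.1 (hX p hp).1
    rw [hR _ ⟨by nlinarith, by nlinarith⟩ _ (hn p hp)]
    congr 1
    have e' := e
    rw [mul_div_assoc', eq_div_iff q3] at e'
    rw [sub_eq_iff_eq_add, ← sub_eq_iff_eq_add', mul_div_assoc', eq_div_iff q3]
    have d1 : d = (x₂ - x₁) / 2 := by linarith
    have c1 : c = (x₂ + x₁) / 2 := by linarith
    have d2 : d' = (x₂' - x₁') / 2 := by linarith
    have c2 : c' = (x₂' + x₁') / 2 := by linarith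
    rw [d1, c1, d2, c2]
    linear_combination (1 + p.1) / 2 * e'
  · have : ∀ t ∈ Icc (0 : ℝ) 1, ∀ q, ‖q‖ ≤ ρ →
        g (pt (x₂ + t * (x₃ - x₂)) q) = pt (x₂' + t * (x₃ - x₂')) q := fun t ht q hq => by
      rw [hR _ ⟨by nlinarith [ht.1], by nlinarith [ht.2]⟩ _ hq]
      congr 1
      linear_combination (1 - t) * e
    exact image_arc (fun t ht => this t ht _ (hlin hw₂ hw₃ ht))
      fun t ht => this t ht _ (by rw [norm_neg]; exact hlin hw₂ hw₃ ht)

/-- The reflection that reverses the first coordinate. -/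
def reflect (p : Point) : Point := (-p.1, p.2)

@[simp] theorem reflect_reflect (p : Point) : reflect (reflect p) = p := by simp [reflect]

@[simp] theorem reflect_pt (x : ℝ) (q : ℂ) : reflect (pt x q) = pt (-x) q := rfl

theorem LocalMove.reflect {a b : ℝ} {A B : Set Point} (h : LocalMove a b A B) :
    LocalMove (-b) (-a) (reflect '' A) (reflect '' B) := by
  obtain ⟨g, hc, hb, hg, ho, rfl⟩ := h
  have hr : Continuous SolidTorusLinks.reflect := by unfold SolidTorusLinks.reflect; fun_prop
  have hbr : Function.Bijective SolidTorusLinks.reflect :=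
    Function.bijective_iff_has_inverse.2 ⟨_, reflect_reflect, reflect_reflect⟩
  refine ⟨SolidTorusLinks.reflect ∘ g ∘ SolidTorusLinks.reflect, hr.comp (hc.comp hr),
    hbr.comp (hb.comp hbr), fun p hp => ?_, fun p hp => ?_, ?_⟩
  · simp only [Function.comp_apply]
    rw [hg, reflect_reflect]
    rw [norm_point] at hp ⊢
    simpa [SolidTorusLinks.reflect] using hp
  · simp only [Function.comp_apply]
    rw [ho, reflect_reflect]
    rintro ⟨h1, h2⟩
    simp only [SolidTorusLinks.reflect] at h1 h2
    exact hp ⟨by linarith, by linarith⟩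
  · simp [image_image]

theorem arc_symm (x₀ x₁ : ℝ) (w₀ w₁ : ℂ) : arc x₁ x₀ w₁ w₀ = arc x₀ x₁ w₀ w₁ := by
  rw [arc, arc, segment_symm, segment_symm ℝ (pt x₁ (-w₁))]

theorem reflect_arc (x₀ x₁ : ℝ) (w₀ w₁ : ℂ) :
    reflect '' arc x₀ x₁ w₀ w₁ = arc (-x₁) (-x₀) w₁ w₀ := by
  rw [arc_symm]
  refine image_arc (fun t _ => ?_) fun t _ => ?_ <;> rw [reflect_pt] <;> congr 1 <;> ring

theorem reflect_place (c d : ℝ) (n : ℂ) (X : Set Point) :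
    reflect '' place c d n X = place (-c) d n (reflect '' X) := by
  simp only [place, image_image, reflect_pt]
  refine image_congr fun p _ => ?_
  simp only [reflect, cplx]
  congr 1; ring

theorem InCylinder.reflect {s : ℝ} {X : Set Point} (h : InCylinder s X) :
    InCylinder s (reflect '' X) := by
  rintro _ ⟨p, hp, rfl⟩
  have := h p hp
  simpa [SolidTorusLinks.reflect, cplx] using this

theorem reflect_image_reflect (X : Set Point) : reflect '' (reflect '' X) = X := by
  simp [image_image]

/-- A box between two pairs of arcs can be moved and scaled in the direction of the first
coordinate. -/
theorem localMove_slide {x₀ x₁ x₂ x₃ y₁ y₂ c d c' d' s ρ : ℝ} {w₀ w₁ w₂ w₃ n : ℂ}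
    {X : Set Point} (hX : InCylinder s X) (hx : -1 ≤ x₀) (h₀ : x₀ < x₁) (h₁ : x₁ < x₂)
    (h₂ : x₂ < x₃) (hx' : x₃ ≤ 1) (h₀' : x₀ < y₁) (h₁' : y₁ < y₂) (h₂' : y₂ < x₃)
    (hx₁ : x₁ = c - d) (hx₂ : x₂ = c + d) (hy₁ : y₁ = c' - d') (hy₂ : y₂ = c' + d')
    (hρ0 : 0 < ρ) (hρ : ρ < 1)
    (hw₀ : ‖w₀‖ ≤ ρ) (hw₁ : ‖w₁‖ ≤ ρ) (hw₂ : ‖w₂‖ ≤ ρ) (hw₃ : ‖w₃‖ ≤ ρ)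
    (hn : ∀ p ∈ X, ‖n * cplx p‖ ≤ ρ) :
    LocalMove x₀ x₃ (arc x₀ x₁ w₀ w₁ ∪ place c d n X ∪ arc x₂ x₃ w₂ w₃)
      (arc x₀ y₁ w₀ w₁ ∪ place c' d' n X ∪ arc y₂ x₃ w₂ w₃) := by
  set K := (y₂ - y₁) / (x₂ - x₁) with hK
  set M := (y₁ - x₀ + K * (x₃ - x₁)) / (x₃ - x₀) with hM
  have q0 : (0 : ℝ) < x₃ - x₀ := by linarith
  have q1 : (0 : ℝ) < x₂ - x₁ := by linarith
  have q2 : (0 : ℝ) < x₃ - x₁ := by linarith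
  have K0 : 0 < K := div_pos (by linarith) q1
  have M0 : 0 < M := div_pos (by nlinarith) q0
  have eK : K * (x₂ - x₁) = y₂ - y₁ := div_mul_cancel₀ _ q1.ne'
  have eM : M * (x₃ - x₀) = y₁ - x₀ + K * (x₃ - x₁) := div_mul_cancel₀ _ q0.ne'
  set k := K / M with hk
  have k0 : 0 < k := div_pos K0 M0
  have ek : k * M = K := div_mul_cancel₀ _ M0.ne'
  set z₁ := x₃ - k * (x₃ - x₁) with hz₁
  set z₂ := x₃ - k * (x₃ - x₂) with hz₂
  have m1 : M * (z₁ - x₀) = y₁ - x₀ := by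
    rw [hz₁]; linear_combination eM - (x₃ - x₁) * ek
  have m2 : M * (z₂ - x₀) = y₂ - x₀ := by
    rw [hz₂]; linear_combination eM - (x₃ - x₂) * ek + eK
  have p1 : 0 < z₁ - x₀ := (mul_pos_iff_of_pos_left M0).1 (by rw [m1]; linarith)
  have p2 : 0 < z₂ - x₀ := (mul_pos_iff_of_pos_left M0).1 (by rw [m2]; linarith)
  have p3 : z₁ < x₃ := by have := mul_pos k0 q2; linarith
  have p4 : z₂ < x₃ := by have := mul_pos k0 (sub_pos.2 h₂); linarith
  have p5 : z₁ < z₂ := by have := mul_pos k0 q1; rw [hz₁, hz₂]; linarith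
  have s1 := localMove_slide_left (x₁' := z₁) (x₂' := z₂) (c' := (z₁ + z₂) / 2)
    (d' := (z₂ - z₁) / 2) hX hx h₀ h₁ h₂ hx' (by linarith) p3
    (by rw [hz₁, hz₂]; field_simp; ring) hx₁ hx₂ (by ring) (by ring) hρ0 hρ hw₀ hw₁ hw₂ hw₃ hn
  have s2 := localMove_slide_left (x₀ := -x₃) (x₁ := -z₂) (x₂ := -z₁) (x₃ := -x₀) (x₁' := -y₂)
    (x₂' := -y₁) (c := -((z₁ + z₂) / 2)) (d := (z₂ - z₁) / 2) (c' := -c') (d' := d') hX.reflect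
    (w₀ := w₃) (w₁ := w₂) (w₂ := w₁) (w₃ := w₀) (n := n)
    (by linarith) (by linarith) (by linarith) (by linarith) (by linarith) (by linarith)
    (by linarith) (by
      have : -x₀ - -z₂ ≠ 0 := by linarith
      have h3 : -x₀ - -y₂ = M * (-x₀ - -z₂) := by linear_combination -m2
      rw [h3, mul_div_cancel_right₀ _ this]
      linear_combination -m1) (by ring) (by ring) (by linarith) (by linarith) hρ0 hρ hw₃ hw₂ hw₁ hw₀
    (by
      rintro _ ⟨p, hp, rfl⟩
      exact hn p hp)
  have s3 := s2.reflect
  simp only [image_union, reflect_arc, reflect_place, reflect_image_reflect, neg_neg] at s3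
  refine s1.trans ?_
  have e : ∀ A B C : Set Point, A ∪ B ∪ C = C ∪ B ∪ A := fun A B C => by
    rw [union_comm (A ∪ B), union_comm A, union_assoc]
  rwa [e (arc z₂ x₃ w₂ w₃), e (arc y₂ x₃ w₂ w₃)] at s3

theorem isotopic_slideBox (l l' : List (Set Point)) {x₀ x₁ x₂ x₃ y₁ y₂ c d c' d' s : ℝ}
    {w₀ w₁ w₂ w₃ n : ℂ} {X : Set Point} (hX : InCylinder s X)
    (hl : ∀ s ∈ l ++ l', Outside x₀ x₃ s)
    (h : x₁ = c - d ∧ x₂ = c + d ∧ y₁ = c' - d' ∧ y₂ = c' + d' ∧ -1 ≤ x₀ ∧ x₀ < x₁ ∧ x₁ < x₂ ∧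
      x₂ < x₃ ∧ x₃ ≤ 1 ∧ x₀ < y₁ ∧ y₁ < y₂ ∧ y₂ < x₃)
    (hw : Complex.normSq w₀ < 1 ∧ Complex.normSq w₁ < 1 ∧ Complex.normSq w₂ < 1 ∧
      Complex.normSq w₃ < 1 ∧ Complex.normSq n * s < 1) :
    Isotopic (chain (l ++ [arc x₀ x₁ w₀ w₁, place c d n X, arc x₂ x₃ w₂ w₃] ++ l'))
      (chain (l ++ [arc x₀ y₁ w₀ w₁, place c' d' n X, arc y₂ x₃ w₂ w₃] ++ l')) := by
  obtain ⟨hx₁, hx₂, hy₁, hy₂, hx, h₀, h₁, h₂, hx', h₀', h₁', h₂'⟩ := h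
  obtain ⟨hw₀, hw₁, hw₂, hw₃, hn⟩ := hw
  set r := max (1 / 4 : ℝ) (max (Complex.normSq n * s) (max (max (Complex.normSq w₀)
    (Complex.normSq w₁)) (max (Complex.normSq w₂) (Complex.normSq w₃)))) with hr
  have r0 : 0 < r := lt_max_of_lt_left (by norm_num)
  have r1 : r < 1 := by simp only [hr, max_lt_iff]; norm_num; exact ⟨hn, ⟨hw₀, hw₁⟩, hw₂, hw₃⟩
  have hle : ∀ w : ℂ, Complex.normSq w ≤ r → ‖w‖ ≤ √r := fun w hw => by
    rw [Complex.normSq_eq_norm_sq] at hw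
    exact Real.le_sqrt_of_sq_le hw
  have key := localMove_slide (ρ := √r) hX hx h₀ h₁ h₂ hx' h₀' h₁' h₂' hx₁ hx₂ hy₁ hy₂
    (Real.sqrt_pos.2 r0) ((Real.sqrt_lt' one_pos).2 (by simpa using r1))
    (hle w₀ (by simp [hr])) (hle w₁ (by simp [hr])) (hle w₂ (by simp [hr]))
    (hle w₃ (by simp [hr])) (n := n) (fun p hp => hle _ (by
      rw [map_mul]
      refine (mul_le_mul_of_nonneg_left (hX p hp).2 (Complex.normSq_nonneg _)).trans ?_
      simp [hr]))
  have key' : LocalMove x₀ x₃ (chain [arc x₀ x₁ w₀ w₁, place c d n X, arc x₂ x₃ w₂ w₃])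
      (chain [arc x₀ y₁ w₀ w₁, place c' d' n X, arc y₂ x₃ w₂ w₃]) := by
    simpa [union_assoc] using key
  exact key'.chain l l' hl

/-! ### Tangles with ends at alternate vertices of a cube -/

theorem zeroTangle_eq : zeroTangle = chain [arc (-1) 0 ⟨1, 0⟩ ⟨1 / 2, 0⟩, arc 0 1 ⟨1 / 2, 0⟩ ⟨1, 0⟩] := by
  have e (a b : ℝ) : -(⟨a, b⟩ : ℂ) = ⟨-a, -b⟩ := rfl
  simp only [zeroTangle, chain_cons, chain_nil, union_empty, arc, pt, e, neg_zero, neg_div]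
  ext; simp only [mem_union]; tauto

theorem oneTangle_eq : oneTangle = chain [arc (-1) 0 ⟨-1, 0⟩ ⟨0, 1 / 2⟩, arc 0 1 ⟨0, 1 / 2⟩ ⟨1, 0⟩] := by
  have e (a b : ℝ) : -(⟨a, b⟩ : ℂ) = ⟨-a, -b⟩ := rfl
  simp only [oneTangle, chain_cons, chain_nil, union_empty, arc, pt, e, neg_zero, neg_div, neg_neg]
  ext; simp only [mem_union]; tauto

theorem sumArcs_eq : sumArcs = chain [arc (-1) (-3 / 4) ⟨1, 0⟩ ⟨1 / 4, 0⟩,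
    arc (-1 / 4) (1 / 4) ⟨1 / 4, 0⟩ ⟨1 / 4, 0⟩, arc (3 / 4) 1 ⟨1 / 4, 0⟩ ⟨1, 0⟩] := by
  have e (a b : ℝ) : -(⟨a, b⟩ : ℂ) = ⟨-a, -b⟩ := rfl
  simp only [sumArcs, chain_cons, chain_nil, union_empty, arc, pt, e, neg_zero, neg_div]
  ext; simp only [mem_union]; tauto

theorem sum_eq_place (S T : Set Point) : sum S T =
    place (-1 / 2) (1 / 4) ⟨1 / 4, 0⟩ S ∪ place (1 / 2) (1 / 4) ⟨1 / 4, 0⟩ T ∪ sumArcs := by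
  unfold sum place
  congr 1
  congr 1 <;> (refine image_congr fun p _ => ?_; ext <;> simp [pt, cplx] <;> ring)

/-- The tangle whose middle part is a copy of `X`, where `X` has its ends at those vertices of the
cube whose coordinates have a positive (if `e = 1`) or negative (if `e = -1`) product with the
opposite sign. -/
noncomputable def theta (e : ℝ) (X : Set Point) : Set Point :=
  chain [arc (-1) (-1 / 2) ⟨1, 0⟩ ⟨1 / 2, e / 2⟩, place 0 (1 / 2) ⟨1 / 2, 0⟩ X,
    arc (1 / 2) 1 ⟨1 / 2, -e / 2⟩ ⟨1, 0⟩]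

/-- The rotation by a quarter turn about the first coordinate axis. -/
def quarter (p : Point) : Point := (p.1, -p.2.2, p.2.1)

theorem place_quarter (c d r : ℝ) (X : Set Point) :
    place c d ⟨r, 0⟩ (quarter '' X) = place c d ⟨0, r⟩ X := by
  simp only [place, image_image]
  refine image_congr fun p _ => ?_
  ext <;> simp [pt, cplx, quarter]

theorem isotopic_theta_of_nodes {e : ℝ} (he : e = 1 ∨ e = -1) {n : ℂ}
    (hn : Complex.normSq n = 1 / 64) {X : Set Point} (hX : InCylinder 2 X) :
    Isotopic (chain [arc (-1) (-3 / 4) ⟨1, 0⟩ ⟨1 / 4, 0⟩, arc (-3 / 4) (3 / 8) ⟨1 / 4, 0⟩ ⟨1 / 8, e / 8⟩,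
      place (1 / 2) (1 / 8) n X, arc (5 / 8) (3 / 4) ⟨1 / 8, -e / 8⟩ ⟨1 / 4, 0⟩,
      arc (3 / 4) 1 ⟨1 / 4, 0⟩ ⟨1, 0⟩])
    (chain [arc (-1) (-1 / 2) ⟨1, 0⟩ ⟨1 / 2, e / 2⟩, place 0 (1 / 2) (4 * n) X,
      arc (1 / 2) 1 ⟨1 / 2, -e / 2⟩ ⟨1, 0⟩]) := by
  have s1 := isotopic_slideBox [arc (-1) (-3 / 4) ⟨1, 0⟩ ⟨1 / 4, 0⟩] [arc (3 / 4) 1 ⟨1 / 4, 0⟩ ⟨1, 0⟩]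
    (x₀ := -3 / 4) (x₁ := 3 / 8) (x₂ := 5 / 8) (x₃ := 3 / 4) (y₁ := -1 / 2) (y₂ := 1 / 2)
    (c := 1 / 2) (d := 1 / 8) (c' := 0) (d' := 1 / 2) (w₀ := ⟨1 / 4, 0⟩) (w₁ := ⟨1 / 8, e / 8⟩)
    (w₂ := ⟨1 / 8, -e / 8⟩) (w₃ := ⟨1 / 4, 0⟩) (n := n) hX (by norm_num [outside_arc])
    (by norm_num) (by rcases he with rfl | rfl <;> norm_num [Complex.normSq_apply, hn])
  have s2 := isotopic_removeNode []
    [place 0 (1 / 2) n X, arc (1 / 2) (3 / 4) ⟨1 / 8, -e / 8⟩ ⟨1 / 4, 0⟩,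
      arc (3 / 4) 1 ⟨1 / 4, 0⟩ ⟨1, 0⟩] (x₀ := -1) (x₁ := -3 / 4) (x₂ := -1 / 2) (w₀ := ⟨1, 0⟩)
    (w₁ := ⟨1 / 4, 0⟩) (w₂ := ⟨1 / 8, e / 8⟩) 1 (by norm_num [outside_arc, outside_place hX])
    (by rcases he with rfl | rfl <;> norm_num [Complex.normSq_apply])
  have s3 := isotopic_removeNode
    [arc (-1) (-1 / 2) ⟨1, 0⟩ ⟨1 / 8, e / 8⟩, place 0 (1 / 2) n X] []
    (x₀ := 1 / 2) (x₁ := 3 / 4) (x₂ := 1) (w₀ := ⟨1 / 8, -e / 8⟩)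
    (w₁ := ⟨1 / 4, 0⟩) (w₂ := ⟨1, 0⟩) 1 (by norm_num [outside_arc, outside_place hX])
    (by rcases he with rfl | rfl <;> norm_num [Complex.normSq_apply])
  have s4 := isotopic_mulBox [] [] (x₀ := -1) (x₁ := -1 / 2) (x₂ := 1 / 2) (x₃ := 1)
    (c := 0) (d := 1 / 2) (w₀ := ⟨1, 0⟩) (w₁ := ⟨1 / 8, e / 8⟩) (w₂ := ⟨1 / 8, -e / 8⟩)
    (w₃ := ⟨1, 0⟩) (w₁' := ⟨1 / 2, e / 2⟩) (w₂' := ⟨1 / 2, -e / 2⟩) (n := n) (n' := 4 * n) hX 1 1 4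
    (by simp) (by refine ⟨?_, ?_, rfl⟩ <;> apply Complex.ext <;> norm_num <;> ring)
    (by rcases he with rfl | rfl <;> norm_num [Complex.normSq_apply, hn])
  exact s1.trans (s2.trans (s3.trans s4))

theorem mk_mul_mk (a b c d : ℝ) : (⟨a, b⟩ : ℂ) * ⟨c, d⟩ = ⟨a * c - b * d, a * d + b * c⟩ := rfl

theorem sum_zeroTangle_theta (e : ℝ) (X : Set Point) : sum zeroTangle (theta e X) =
    chain [arc (-1) (-3 / 4) ⟨1, 0⟩ ⟨1 / 4, 0⟩, arc (-3 / 4) (-1 / 2) ⟨1 / 4, 0⟩ ⟨1 / 8, 0⟩,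
      arc (-1 / 2) (-1 / 4) ⟨1 / 8, 0⟩ ⟨1 / 4, 0⟩, arc (-1 / 4) (1 / 4) ⟨1 / 4, 0⟩ ⟨1 / 4, 0⟩,
      arc (1 / 4) (3 / 8) ⟨1 / 4, 0⟩ ⟨1 / 8, e / 8⟩, place (1 / 2) (1 / 8) ⟨1 / 8, 0⟩ X,
      arc (5 / 8) (3 / 4) ⟨1 / 8, -e / 8⟩ ⟨1 / 4, 0⟩, arc (3 / 4) 1 ⟨1 / 4, 0⟩ ⟨1, 0⟩] := by
  have h1 : 1 / 4 * (e / 2) = e / 8 := by ring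
  have h2 : 1 / 4 * (-e / 2) = -e / 8 := by ring
  rw [sum_eq_place, zeroTangle_eq, theta, sumArcs_eq]
  simp only [chain_cons, chain_nil, union_empty, place_union, place_arc, place_place, mk_mul_mk, h1, h2]
  norm_num
  ext; simp only [mem_union]; tauto

theorem isotopic_sum_zeroTangle_theta {e : ℝ} (he : e = 1 ∨ e = -1) {X : Set Point}
    (hX : InCylinder 2 X) : Isotopic (sum zeroTangle (theta e X)) (theta e X) := by
  rw [sum_zeroTangle_theta]
  have s1 := isotopic_removeNode [arc (-1) (-3 / 4) ⟨1, 0⟩ ⟨1 / 4, 0⟩]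
    [arc (-1 / 4) (1 / 4) ⟨1 / 4, 0⟩ ⟨1 / 4, 0⟩,
      arc (1 / 4) (3 / 8) ⟨1 / 4, 0⟩ ⟨1 / 8, e / 8⟩, place (1 / 2) (1 / 8) ⟨1 / 8, 0⟩ X,
      arc (5 / 8) (3 / 4) ⟨1 / 8, -e / 8⟩ ⟨1 / 4, 0⟩, arc (3 / 4) 1 ⟨1 / 4, 0⟩ ⟨1, 0⟩]
    (x₀ := -3 / 4) (x₁ := -1 / 2) (x₂ := -1 / 4) (w₀ := ⟨1 / 4, 0⟩)
    (w₁ := ⟨1 / 8, 0⟩) (w₂ := ⟨1 / 4, 0⟩) 1 (by norm_num [outside_arc, outside_place hX])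
    (by norm_num [Complex.normSq_apply])
  have s2 := isotopic_removeNode [arc (-1) (-3 / 4) ⟨1, 0⟩ ⟨1 / 4, 0⟩]
    [arc (1 / 4) (3 / 8) ⟨1 / 4, 0⟩ ⟨1 / 8, e / 8⟩, place (1 / 2) (1 / 8) ⟨1 / 8, 0⟩ X,
      arc (5 / 8) (3 / 4) ⟨1 / 8, -e / 8⟩ ⟨1 / 4, 0⟩, arc (3 / 4) 1 ⟨1 / 4, 0⟩ ⟨1, 0⟩]
    (x₀ := -3 / 4) (x₁ := -1 / 4) (x₂ := 1 / 4) (w₀ := ⟨1 / 4, 0⟩)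
    (w₁ := ⟨1 / 4, 0⟩) (w₂ := ⟨1 / 4, 0⟩) 1 (by norm_num [outside_arc, outside_place hX])
    (by norm_num [Complex.normSq_apply])
  have s3 := isotopic_removeNode [arc (-1) (-3 / 4) ⟨1, 0⟩ ⟨1 / 4, 0⟩]
    [place (1 / 2) (1 / 8) ⟨1 / 8, 0⟩ X,
      arc (5 / 8) (3 / 4) ⟨1 / 8, -e / 8⟩ ⟨1 / 4, 0⟩, arc (3 / 4) 1 ⟨1 / 4, 0⟩ ⟨1, 0⟩]
    (x₀ := -3 / 4) (x₁ := 1 / 4) (x₂ := 3 / 8) (w₀ := ⟨1 / 4, 0⟩)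
    (w₁ := ⟨1 / 4, 0⟩) (w₂ := ⟨1 / 8, e / 8⟩) 1 (by norm_num [outside_arc, outside_place hX])
    (by rcases he with rfl | rfl <;> norm_num [Complex.normSq_apply])
  have s4 := isotopic_theta_of_nodes he (n := ⟨1 / 8, 0⟩) (by norm_num [Complex.normSq_apply]) hX
  have e4 : (4 : ℂ) * ⟨1 / 8, 0⟩ = ⟨1 / 2, 0⟩ := by apply Complex.ext <;> norm_num
  rw [e4] at s4
  exact s1.trans (s2.trans (s3.trans s4))

theorem sum_oneTangle_theta (X : Set Point) : sum oneTangle (theta 1 X) =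
    chain [arc (-1) (-3 / 4) ⟨-1, 0⟩ ⟨-1 / 4, 0⟩, arc (-3 / 4) (-1 / 2) ⟨-1 / 4, 0⟩ ⟨0, 1 / 8⟩,
      arc (-1 / 2) (-1 / 4) ⟨0, 1 / 8⟩ ⟨1 / 4, 0⟩, arc (-1 / 4) (1 / 4) ⟨1 / 4, 0⟩ ⟨1 / 4, 0⟩,
      arc (1 / 4) (3 / 8) ⟨1 / 4, 0⟩ ⟨1 / 8, 1 / 8⟩, place (1 / 2) (1 / 8) ⟨1 / 8, 0⟩ X,
      arc (5 / 8) (3 / 4) ⟨1 / 8, -1 / 8⟩ ⟨1 / 4, 0⟩, arc (3 / 4) 1 ⟨1 / 4, 0⟩ ⟨1, 0⟩] := by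
  have e : arc (-1) (-3 / 4) ⟨-1, 0⟩ ⟨-1 / 4, 0⟩ = arc (-1) (-3 / 4) ⟨1, 0⟩ ⟨1 / 4, 0⟩ := by
    rw [← arc_neg]; congr 1 <;> apply Complex.ext <;> norm_num
  rw [e, sum_eq_place, oneTangle_eq, theta, sumArcs_eq]
  simp only [chain_cons, chain_nil, union_empty, place_union, place_arc, place_place, mk_mul_mk]
  norm_num
  ext; simp only [mem_union]; tauto

/-- Adding a crossing amounts to a quarter turn. -/
theorem isotopic_sum_oneTangle_theta {X : Set Point} (hX : InCylinder 2 X) :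
    Isotopic (sum oneTangle (theta 1 X)) (theta (-1) (quarter '' X)) := by
  rw [sum_oneTangle_theta]
  have s1 := isotopic_removeNode [arc (-1) (-3 / 4) ⟨-1, 0⟩ ⟨-1 / 4, 0⟩,
      arc (-3 / 4) (-1 / 2) ⟨-1 / 4, 0⟩ ⟨0, 1 / 8⟩]
    [arc (1 / 4) (3 / 8) ⟨1 / 4, 0⟩ ⟨1 / 8, 1 / 8⟩, place (1 / 2) (1 / 8) ⟨1 / 8, 0⟩ X,
      arc (5 / 8) (3 / 4) ⟨1 / 8, -1 / 8⟩ ⟨1 / 4, 0⟩, arc (3 / 4) 1 ⟨1 / 4, 0⟩ ⟨1, 0⟩]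
    (x₀ := -1 / 2) (x₁ := -1 / 4) (x₂ := 1 / 4) (w₀ := ⟨0, 1 / 8⟩)
    (w₁ := ⟨1 / 4, 0⟩) (w₂ := ⟨1 / 4, 0⟩) ⟨1, -1⟩ (by norm_num [outside_arc, outside_place hX])
    (by norm_num [Complex.normSq_apply])
  have s2 := isotopic_removeNode [arc (-1) (-3 / 4) ⟨-1, 0⟩ ⟨-1 / 4, 0⟩,
      arc (-3 / 4) (-1 / 2) ⟨-1 / 4, 0⟩ ⟨0, 1 / 8⟩]
    [place (1 / 2) (1 / 8) ⟨1 / 8, 0⟩ X,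
      arc (5 / 8) (3 / 4) ⟨1 / 8, -1 / 8⟩ ⟨1 / 4, 0⟩, arc (3 / 4) 1 ⟨1 / 4, 0⟩ ⟨1, 0⟩]
    (x₀ := -1 / 2) (x₁ := 1 / 4) (x₂ := 3 / 8) (w₀ := ⟨0, 1 / 8⟩)
    (w₁ := ⟨1 / 4, 0⟩) (w₂ := ⟨1 / 8, 1 / 8⟩) ⟨1, -1⟩ (by norm_num [outside_arc, outside_place hX])
    (by norm_num [Complex.normSq_apply])
  have s3 := isotopic_mulBox [arc (-1) (-3 / 4) ⟨-1, 0⟩ ⟨-1 / 4, 0⟩,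
      arc (-3 / 4) (-1 / 2) ⟨-1 / 4, 0⟩ ⟨0, 1 / 8⟩] [arc (3 / 4) 1 ⟨1 / 4, 0⟩ ⟨1, 0⟩]
    (x₀ := -1 / 2) (x₁ := 3 / 8) (x₂ := 5 / 8) (x₃ := 3 / 4) (c := 1 / 2) (d := 1 / 8)
    (w₀ := ⟨0, 1 / 8⟩) (w₁ := ⟨1 / 8, 1 / 8⟩) (w₂ := ⟨1 / 8, -1 / 8⟩) (w₃ := ⟨1 / 4, 0⟩)
    (w₁' := ⟨-1 / 8, 1 / 8⟩) (w₂' := ⟨1 / 8, 1 / 8⟩) (n := ⟨1 / 8, 0⟩) (n' := ⟨0, 1 / 8⟩)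
    hX ⟨0, -1⟩ 1 ⟨0, 1⟩ (by norm_num [outside_arc])
    (by refine ⟨?_, ?_, ?_⟩ <;> apply Complex.ext <;> norm_num)
    (by norm_num [Complex.normSq_apply])
  have s4 := isotopic_removeNode [arc (-1) (-3 / 4) ⟨-1, 0⟩ ⟨-1 / 4, 0⟩]
    [place (1 / 2) (1 / 8) ⟨0, 1 / 8⟩ X,
      arc (5 / 8) (3 / 4) ⟨1 / 8, 1 / 8⟩ ⟨1 / 4, 0⟩, arc (3 / 4) 1 ⟨1 / 4, 0⟩ ⟨1, 0⟩]
    (x₀ := -3 / 4) (x₁ := -1 / 2) (x₂ := 3 / 8) (w₀ := ⟨-1 / 4, 0⟩)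
    (w₁ := ⟨0, 1 / 8⟩) (w₂ := ⟨-1 / 8, 1 / 8⟩) ⟨-1, -1⟩ (by norm_num [outside_arc, outside_place hX])
    (by norm_num [Complex.normSq_apply])
  have s5 := isotopic_theta_of_nodes (e := -1) (Or.inr rfl) (n := ⟨0, 1 / 8⟩)
    (by norm_num [Complex.normSq_apply]) hX
  have e1 : arc (-1) (-3 / 4) ⟨1, 0⟩ ⟨1 / 4, 0⟩ = arc (-1) (-3 / 4) ⟨-1, 0⟩ ⟨-1 / 4, 0⟩ := by
    rw [← arc_neg]; congr 1 <;> apply Complex.ext <;> norm_num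
  have e2 : arc (-3 / 4) (3 / 8) ⟨1 / 4, 0⟩ ⟨1 / 8, -1 / 8⟩ =
      arc (-3 / 4) (3 / 8) ⟨-1 / 4, 0⟩ ⟨-1 / 8, 1 / 8⟩ := by
    rw [← arc_neg]; congr 1 <;> apply Complex.ext <;> norm_num
  have e4 : (4 : ℂ) * ⟨0, 1 / 8⟩ = ⟨0, 1 / 2⟩ := by apply Complex.ext <;> norm_num
  have e5 : theta (-1) (quarter '' X) = chain [arc (-1) (-1 / 2) ⟨1, 0⟩ ⟨1 / 2, -1 / 2⟩,
      place 0 (1 / 2) ⟨0, 1 / 2⟩ X, arc (1 / 2) 1 ⟨1 / 2, 1 / 2⟩ ⟨1, 0⟩] := by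
    rw [theta, place_quarter, neg_neg]
  simp only [neg_neg] at s5
  rw [e1, e2, e4] at s5
  rw [e5]
  exact s1.trans (s2.trans (s3.trans (s4.trans s5)))

/-- The set `X`, scaled, together with arcs that switch the tilt of its ends. -/
noncomputable def tilt (e : ℝ) (X : Set Point) : Set Point :=
  chain [arc (-1) (-1 / 2) ⟨1, -e⟩ ⟨1 / 2, e / 2⟩, place 0 (1 / 2) ⟨1 / 2, 0⟩ X,
    arc (1 / 2) 1 ⟨1 / 2, -e / 2⟩ ⟨1, e⟩]

theorem InCylinder.union {s : ℝ} {X Y : Set Point} (hX : InCylinder s X) (hY : InCylinder s Y) :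
    InCylinder s (X ∪ Y) := fun p hp => hp.elim (hX p) (hY p)

theorem inCylinder_arc {s x₀ x₁ : ℝ} {w₀ w₁ : ℂ} (h : x₀ ≤ x₁) (h₀ : -1 ≤ x₀) (h₁ : x₁ ≤ 1)
    (hw₀ : Complex.normSq w₀ ≤ s) (hw₁ : Complex.normSq w₁ ≤ s) :
    InCylinder s (arc x₀ x₁ w₀ w₁) := by
  intro p hp
  have hx := arc_fst_mem h hp
  refine ⟨abs_le.2 ⟨by linarith [hx.1], by linarith [hx.2]⟩, ?_⟩
  obtain ⟨t, ht, hp⟩ := mem_arc.1 hp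
  have hs : 0 ≤ s := (Complex.normSq_nonneg w₀).trans hw₀
  have hle : ∀ {w : ℂ}, Complex.normSq w ≤ s → ‖w‖ ≤ √s := fun h => by
    rw [Complex.normSq_eq_norm_sq] at h
    exact Real.le_sqrt_of_sq_le h
  have key : Complex.normSq (lin w₀ w₁ t) ≤ s := by
    rw [Complex.normSq_eq_norm_sq, ← Real.le_sqrt (norm_nonneg _) hs]
    refine (norm_lin_le _ _ ht).trans ?_
    nlinarith [ht.1, ht.2, hle hw₀, hle hw₁]
  rcases hp with rfl | rfl
  · simpa using key
  · simpa using key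

theorem inCylinder_place {s r c d : ℝ} {n : ℂ} {X : Set Point} (hX : InCylinder s X)
    (hc : |c| + |d| ≤ 1) (hn : Complex.normSq n * s ≤ r) : InCylinder r (place c d n X) := by
  rintro _ ⟨p, hp, rfl⟩
  obtain ⟨h1, h2⟩ := hX p hp
  simp only [pt_fst, cplx_pt, map_mul]
  refine ⟨(abs_add_le _ _).trans ?_, (mul_le_mul_of_nonneg_left h2 (Complex.normSq_nonneg _)).trans hn⟩
  rw [abs_mul]
  have := mul_le_of_le_one_right (abs_nonneg d) h1
  linarith

theorem isotopic_theta_tilt {e : ℝ} (he : e = 1 ∨ e = -1) {X : Set Point}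
    (hX : InCylinder 2 X) : Isotopic (theta (-e) (tilt e X)) (theta e X) := by
  have e0 : theta (-e) (tilt e X) = chain [arc (-1) (-1 / 2) ⟨1, 0⟩ ⟨1 / 2, -e / 2⟩,
      arc (-1 / 2) (-1 / 4) ⟨1 / 2, -e / 2⟩ ⟨1 / 4, e / 4⟩, place 0 (1 / 4) ⟨1 / 4, 0⟩ X,
      arc (1 / 4) (1 / 2) ⟨1 / 4, -e / 4⟩ ⟨1 / 2, e / 2⟩, arc (1 / 2) 1 ⟨1 / 2, e / 2⟩ ⟨1, 0⟩] := by
    have h1 : 1 / 2 * (e / 2) = e / 4 := by ring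
    have h2 : 1 / 2 * (-e / 2) = -e / 4 := by ring
    have h3 : 1 / 2 * -e = -e / 2 := by ring
    have h4 : 1 / 2 * e = e / 2 := by ring
    rw [theta, tilt]
    simp only [chain_cons, chain_nil, union_empty, place_union, place_arc, place_place, mk_mul_mk,
      h1, h2, h3, h4, neg_neg]
    norm_num
    ext; simp only [mem_union]; tauto
  rw [e0]
  have s1 := isotopic_removeNode []
    [place 0 (1 / 4) ⟨1 / 4, 0⟩ X,
      arc (1 / 4) (1 / 2) ⟨1 / 4, -e / 4⟩ ⟨1 / 2, e / 2⟩, arc (1 / 2) 1 ⟨1 / 2, e / 2⟩ ⟨1, 0⟩]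
    (x₀ := -1) (x₁ := -1 / 2) (x₂ := -1 / 4) (w₀ := ⟨1, 0⟩)
    (w₁ := ⟨1 / 2, -e / 2⟩) (w₂ := ⟨1 / 4, e / 4⟩) 1 (by norm_num [outside_arc, outside_place hX])
    (by rcases he with rfl | rfl <;> norm_num [Complex.normSq_apply])
  have s2 := isotopic_removeNode []
    [place 0 (1 / 4) ⟨1 / 4, 0⟩ X,
      arc (1 / 4) (1 / 2) ⟨1 / 4, -e / 4⟩ ⟨1 / 2, e / 2⟩, arc (1 / 2) 1 ⟨1 / 2, e / 2⟩ ⟨1, 0⟩]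
    (x₀ := -1) (x₁ := -3 / 4) (x₂ := -1 / 4) (w₀ := ⟨1, 0⟩)
    (w₁ := ⟨1 / 2, 0⟩) (w₂ := ⟨1 / 4, e / 4⟩) 1 (by norm_num [outside_arc, outside_place hX])
    (by rcases he with rfl | rfl <;> norm_num [Complex.normSq_apply])
  have s3 := isotopic_removeNode
    [arc (-1) (-3 / 4) ⟨1, 0⟩ ⟨1 / 2, 0⟩, arc (-3 / 4) (-1 / 4) ⟨1 / 2, 0⟩ ⟨1 / 4, e / 4⟩,
      place 0 (1 / 4) ⟨1 / 4, 0⟩ X] []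
    (x₀ := 1 / 4) (x₁ := 1 / 2) (x₂ := 1) (w₀ := ⟨1 / 4, -e / 4⟩)
    (w₁ := ⟨1 / 2, e / 2⟩) (w₂ := ⟨1, 0⟩) 1 (by norm_num [outside_arc, outside_place hX])
    (by rcases he with rfl | rfl <;> norm_num [Complex.normSq_apply])
  have s4 := isotopic_removeNode
    [arc (-1) (-3 / 4) ⟨1, 0⟩ ⟨1 / 2, 0⟩, arc (-3 / 4) (-1 / 4) ⟨1 / 2, 0⟩ ⟨1 / 4, e / 4⟩,
      place 0 (1 / 4) ⟨1 / 4, 0⟩ X] []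
    (x₀ := 1 / 4) (x₁ := 3 / 4) (x₂ := 1) (w₀ := ⟨1 / 4, -e / 4⟩)
    (w₁ := ⟨1 / 2, 0⟩) (w₂ := ⟨1, 0⟩) 1 (by norm_num [outside_arc, outside_place hX])
    (by rcases he with rfl | rfl <;> norm_num [Complex.normSq_apply])
  have s5 := isotopic_slideBox [arc (-1) (-3 / 4) ⟨1, 0⟩ ⟨1 / 2, 0⟩] [arc (3 / 4) 1 ⟨1 / 2, 0⟩ ⟨1, 0⟩]
    (x₀ := -3 / 4) (x₁ := -1 / 4) (x₂ := 1 / 4) (x₃ := 3 / 4) (y₁ := -1 / 2) (y₂ := 1 / 2)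
    (c := 0) (d := 1 / 4) (c' := 0) (d' := 1 / 2) (w₀ := ⟨1 / 2, 0⟩) (w₁ := ⟨1 / 4, e / 4⟩)
    (w₂ := ⟨1 / 4, -e / 4⟩) (w₃ := ⟨1 / 2, 0⟩) (n := ⟨1 / 4, 0⟩) hX (by norm_num [outside_arc])
    (by norm_num) (by rcases he with rfl | rfl <;> norm_num [Complex.normSq_apply])
  have s6 := isotopic_removeNode []
    [place 0 (1 / 2) ⟨1 / 4, 0⟩ X, arc (1 / 2) (3 / 4) ⟨1 / 4, -e / 4⟩ ⟨1 / 2, 0⟩,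
      arc (3 / 4) 1 ⟨1 / 2, 0⟩ ⟨1, 0⟩] (x₀ := -1) (x₁ := -3 / 4) (x₂ := -1 / 2) (w₀ := ⟨1, 0⟩)
    (w₁ := ⟨1 / 2, 0⟩) (w₂ := ⟨1 / 4, e / 4⟩) 1 (by norm_num [outside_arc, outside_place hX])
    (by rcases he with rfl | rfl <;> norm_num [Complex.normSq_apply])
  have s7 := isotopic_removeNode
    [arc (-1) (-1 / 2) ⟨1, 0⟩ ⟨1 / 4, e / 4⟩, place 0 (1 / 2) ⟨1 / 4, 0⟩ X] []
    (x₀ := 1 / 2) (x₁ := 3 / 4) (x₂ := 1) (w₀ := ⟨1 / 4, -e / 4⟩)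
    (w₁ := ⟨1 / 2, 0⟩) (w₂ := ⟨1, 0⟩) 1 (by norm_num [outside_arc, outside_place hX])
    (by rcases he with rfl | rfl <;> norm_num [Complex.normSq_apply])
  have s8 := isotopic_mulBox [] [] (x₀ := -1) (x₁ := -1 / 2) (x₂ := 1 / 2) (x₃ := 1)
    (c := 0) (d := 1 / 2) (w₀ := ⟨1, 0⟩) (w₁ := ⟨1 / 4, e / 4⟩) (w₂ := ⟨1 / 4, -e / 4⟩)
    (w₃ := ⟨1, 0⟩) (w₁' := ⟨1 / 2, e / 2⟩) (w₂' := ⟨1 / 2, -e / 2⟩) (n := ⟨1 / 4, 0⟩)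
    (n' := ⟨1 / 2, 0⟩) hX 1 1 2
    (by simp) (by refine ⟨?_, ?_, ?_⟩ <;> apply Complex.ext <;> norm_num <;> ring)
    (by rcases he with rfl | rfl <;> norm_num [Complex.normSq_apply])
  exact s1.trans (s2.symm.trans (s3.trans (s4.symm.trans (s5.trans (s6.trans (s7.trans s8))))))

/-- The middle part of the tangle `[0]`. -/
noncomputable def zeroCore : Set Point := arc (-1) 1 ⟨1, 1⟩ ⟨1, -1⟩

theorem isotopic_theta_zeroCore : Isotopic (theta 1 zeroCore) zeroTangle := by
  have e0 : theta 1 zeroCore = chain [arc (-1) (-1 / 2) ⟨1, 0⟩ ⟨1 / 2, 1 / 2⟩,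
      arc (-1 / 2) 0 ⟨1 / 2, 1 / 2⟩ ⟨1 / 2, 0⟩, arc 0 (1 / 2) ⟨1 / 2, 0⟩ ⟨1 / 2, -1 / 2⟩,
      arc (1 / 2) 1 ⟨1 / 2, -1 / 2⟩ ⟨1, 0⟩] := by
    have : arc (-1 / 2) 0 ⟨1 / 2, 1 / 2⟩ ⟨1 / 2, 0⟩ ∪ arc 0 (1 / 2) ⟨1 / 2, 0⟩ ⟨1 / 2, -1 / 2⟩ =
        arc (-1 / 2) (1 / 2) ⟨1 / 2, 1 / 2⟩ ⟨1 / 2, -1 / 2⟩ :=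
      arc_union_arc (by norm_num) (by norm_num)
        (by apply Complex.ext <;> norm_num [lin, Complex.div_re, Complex.div_im])
    simp only [theta, zeroCore, place_arc, mk_mul_mk, chain_cons, chain_nil, union_empty]
    rw [← union_assoc (arc (-1 / 2) 0 _ _), this]
    norm_num
  rw [e0, zeroTangle_eq]
  have s1 := isotopic_removeNode []
    [arc 0 (1 / 2) ⟨1 / 2, 0⟩ ⟨1 / 2, -1 / 2⟩, arc (1 / 2) 1 ⟨1 / 2, -1 / 2⟩ ⟨1, 0⟩]
    (x₀ := -1) (x₁ := -1 / 2) (x₂ := 0) (w₀ := ⟨1, 0⟩)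
    (w₁ := ⟨1 / 2, 1 / 2⟩) (w₂ := ⟨1 / 2, 0⟩) 1 (by norm_num [outside_arc])
    (by norm_num [Complex.normSq_apply])
  have s2 := isotopic_removeNode [arc (-1) 0 ⟨1, 0⟩ ⟨1 / 2, 0⟩] []
    (x₀ := 0) (x₁ := 1 / 2) (x₂ := 1) (w₀ := ⟨1 / 2, 0⟩)
    (w₁ := ⟨1 / 2, -1 / 2⟩) (w₂ := ⟨1, 0⟩) 1 (by norm_num [outside_arc])
    (by norm_num [Complex.normSq_apply])
  exact s1.trans s2

theorem quarter_image_arc (x₀ x₁ a b c d : ℝ) :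
    quarter '' arc x₀ x₁ ⟨a, b⟩ ⟨c, d⟩ = arc x₀ x₁ ⟨-b, a⟩ ⟨-d, c⟩ := by
  have h : ∀ t : ℝ, lin ⟨-b, a⟩ ⟨-d, c⟩ t = Complex.I * lin ⟨a, b⟩ ⟨c, d⟩ t := fun t => by
    have h1 : (⟨-b, a⟩ : ℂ) = Complex.I * ⟨a, b⟩ := by apply Complex.ext <;> simp
    have h2 : (⟨-d, c⟩ : ℂ) = Complex.I * ⟨c, d⟩ := by apply Complex.ext <;> simp
    rw [h1, h2, mul_lin]
  have h' : ∀ x q, quarter (pt x q) = pt x (Complex.I * q) := fun x q => by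
    ext <;> simp [quarter, pt]
  refine image_arc (fun t _ => ?_) fun t _ => ?_
  · rw [h', h]
  · rw [h', h, mul_neg]

theorem isotopic_theta_oneTangle : Isotopic (theta (-1) (quarter '' zeroCore)) oneTangle := by
  have e0 : theta (-1) (quarter '' zeroCore) = chain [arc (-1) (-1 / 2) ⟨-1, 0⟩ ⟨-1 / 2, 1 / 2⟩,
      arc (-1 / 2) 0 ⟨-1 / 2, 1 / 2⟩ ⟨0, 1 / 2⟩, arc 0 (1 / 2) ⟨0, 1 / 2⟩ ⟨1 / 2, 1 / 2⟩,
      arc (1 / 2) 1 ⟨1 / 2, 1 / 2⟩ ⟨1, 0⟩] := by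
    have h1 : arc (-1 / 2) 0 ⟨-1 / 2, 1 / 2⟩ ⟨0, 1 / 2⟩ ∪ arc 0 (1 / 2) ⟨0, 1 / 2⟩ ⟨1 / 2, 1 / 2⟩ =
        arc (-1 / 2) (1 / 2) ⟨-1 / 2, 1 / 2⟩ ⟨1 / 2, 1 / 2⟩ :=
      arc_union_arc (by norm_num) (by norm_num)
        (by apply Complex.ext <;> norm_num [lin, Complex.div_re, Complex.div_im])
    have h2 : arc (-1) (-1 / 2) ⟨-1, 0⟩ ⟨-1 / 2, 1 / 2⟩ = arc (-1) (-1 / 2) ⟨1, 0⟩ ⟨1 / 2, -1 / 2⟩ := by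
      rw [← arc_neg]; congr 1 <;> apply Complex.ext <;> norm_num
    simp only [theta, zeroCore, quarter_image_arc, place_arc, mk_mul_mk, chain_cons, chain_nil,
      union_empty]
    rw [← union_assoc (arc (-1 / 2) 0 _ _), h1, h2]
    norm_num
  rw [e0, oneTangle_eq]
  have s1 := isotopic_removeNode []
    [arc 0 (1 / 2) ⟨0, 1 / 2⟩ ⟨1 / 2, 1 / 2⟩, arc (1 / 2) 1 ⟨1 / 2, 1 / 2⟩ ⟨1, 0⟩]
    (x₀ := -1) (x₁ := -1 / 2) (x₂ := 0) (w₀ := ⟨-1, 0⟩)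
    (w₁ := ⟨-1 / 2, 1 / 2⟩) (w₂ := ⟨0, 1 / 2⟩) ⟨-1, -1⟩ (by norm_num [outside_arc])
    (by norm_num [Complex.normSq_apply])
  have s2 := isotopic_removeNode [arc (-1) 0 ⟨-1, 0⟩ ⟨0, 1 / 2⟩] []
    (x₀ := 0) (x₁ := 1 / 2) (x₂ := 1) (w₀ := ⟨0, 1 / 2⟩)
    (w₁ := ⟨1 / 2, 1 / 2⟩) (w₂ := ⟨1, 0⟩) ⟨1, -1⟩ (by norm_num [outside_arc])
    (by norm_num [Complex.normSq_apply])
  exact s1.trans s2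

theorem sum_sum_left_eq (A B T : Set Point) : sum (sum A B) T =
    chain [arc (-1) (-3 / 4) ⟨1, 0⟩ ⟨1 / 4, 0⟩,
      arc (-3 / 4) (-11 / 16) ⟨1 / 4, 0⟩ ⟨1 / 16, 0⟩,
      place (-5 / 8) (1 / 16) ⟨1 / 16, 0⟩ A,
      arc (-9 / 16) (-7 / 16) ⟨1 / 16, 0⟩ ⟨1 / 16, 0⟩,
      place (-3 / 8) (1 / 16) ⟨1 / 16, 0⟩ B,
      arc (-5 / 16) (-1 / 4) ⟨1 / 16, 0⟩ ⟨1 / 4, 0⟩,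
      arc (-1 / 4) (1 / 4) ⟨1 / 4, 0⟩ ⟨1 / 4, 0⟩,
      place (1 / 2) (1 / 4) ⟨1 / 4, 0⟩ T,
      arc (3 / 4) (1) ⟨1 / 4, 0⟩ ⟨1, 0⟩] := by
  rw [sum_eq_place, sum_eq_place, sumArcs_eq]
  simp only [chain_cons, chain_nil, union_empty, place_union, place_arc, place_place, mk_mul_mk]
  norm_num
  ext; simp only [mem_union]; tauto

theorem sum_sum_right_eq (A B T : Set Point) : sum A (sum B T) =
    chain [arc (-1) (-3 / 4) ⟨1, 0⟩ ⟨1 / 4, 0⟩,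
      place (-1 / 2) (1 / 4) ⟨1 / 4, 0⟩ A,
      arc (-1 / 4) (1 / 4) ⟨1 / 4, 0⟩ ⟨1 / 4, 0⟩,
      arc (1 / 4) (5 / 16) ⟨1 / 4, 0⟩ ⟨1 / 16, 0⟩,
      place (3 / 8) (1 / 16) ⟨1 / 16, 0⟩ B,
      arc (7 / 16) (9 / 16) ⟨1 / 16, 0⟩ ⟨1 / 16, 0⟩,
      place (5 / 8) (1 / 16) ⟨1 / 16, 0⟩ T,
      arc (11 / 16) (3 / 4) ⟨1 / 16, 0⟩ ⟨1 / 4, 0⟩,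
      arc (3 / 4) (1) ⟨1 / 4, 0⟩ ⟨1, 0⟩] := by
  rw [sum_eq_place, sum_eq_place, sumArcs_eq]
  simp only [chain_cons, chain_nil, union_empty, place_union, place_arc, place_place, mk_mul_mk]
  norm_num
  ext; simp only [mem_union]; tauto

/-- The sum of tangles is associative up to isotopy. -/
theorem isotopic_sum_assoc {A B T : Set Point} (hA : InCylinder 1 A) (hB : InCylinder 1 B) (hT : InCylinder 1 T) :
    Isotopic (sum (sum A B) T) (sum A (sum B T)) := by
  rw [sum_sum_left_eq, sum_sum_right_eq]
  have s1 := isotopic_removeNode []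
    [place (-5 / 8) (1 / 16) ⟨1 / 16, 0⟩ A,
      arc (-9 / 16) (-7 / 16) ⟨1 / 16, 0⟩ ⟨1 / 16, 0⟩,
      place (-3 / 8) (1 / 16) ⟨1 / 16, 0⟩ B,
      arc (-5 / 16) (-1 / 4) ⟨1 / 16, 0⟩ ⟨1 / 4, 0⟩,
      arc (-1 / 4) (1 / 4) ⟨1 / 4, 0⟩ ⟨1 / 4, 0⟩,
      place (1 / 2) (1 / 4) ⟨1 / 4, 0⟩ T,
      arc (3 / 4) (1) ⟨1 / 4, 0⟩ ⟨1, 0⟩]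
    (x₀ := -1) (x₁ := -3 / 4) (x₂ := -11 / 16) (w₀ := ⟨1, 0⟩) (w₁ := ⟨1 / 4, 0⟩) (w₂ := ⟨1 / 16, 0⟩) 1
    (by norm_num [outside_arc, outside_place hA, outside_place hB, outside_place hT])
    (by norm_num [Complex.normSq_apply])
  have s2 := isotopic_removeNode [arc (-1) (-11 / 16) ⟨1, 0⟩ ⟨1 / 16, 0⟩,
      place (-5 / 8) (1 / 16) ⟨1 / 16, 0⟩ A,
      arc (-9 / 16) (-7 / 16) ⟨1 / 16, 0⟩ ⟨1 / 16, 0⟩,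
      place (-3 / 8) (1 / 16) ⟨1 / 16, 0⟩ B]
    [place (1 / 2) (1 / 4) ⟨1 / 4, 0⟩ T,
      arc (3 / 4) (1) ⟨1 / 4, 0⟩ ⟨1, 0⟩]
    (x₀ := -5 / 16) (x₁ := -1 / 4) (x₂ := 1 / 4) (w₀ := ⟨1 / 16, 0⟩) (w₁ := ⟨1 / 4, 0⟩) (w₂ := ⟨1 / 4, 0⟩) 1
    (by norm_num [outside_arc, outside_place hA, outside_place hB, outside_place hT])
    (by norm_num [Complex.normSq_apply])
  have s3 := isotopic_mulBox [arc (-1) (-11 / 16) ⟨1, 0⟩ ⟨1 / 16, 0⟩,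
      place (-5 / 8) (1 / 16) ⟨1 / 16, 0⟩ A,
      arc (-9 / 16) (-7 / 16) ⟨1 / 16, 0⟩ ⟨1 / 16, 0⟩,
      place (-3 / 8) (1 / 16) ⟨1 / 16, 0⟩ B]
    []
    (x₀ := -5 / 16) (x₁ := 1 / 4) (x₂ := 3 / 4) (x₃ := 1) (c := 1 / 2) (d := 1 / 4)
    (w₀ := ⟨1 / 16, 0⟩) (w₁ := ⟨1 / 4, 0⟩) (w₂ := ⟨1 / 4, 0⟩) (w₃ := ⟨1, 0⟩)
    (w₁' := ⟨1 / 16, 0⟩) (w₂' := ⟨1 / 16, 0⟩) (n := ⟨1 / 4, 0⟩) (n' := ⟨1 / 16, 0⟩) hT 1 1 ⟨1 / 4, 0⟩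
    (by norm_num [outside_arc, outside_place hA, outside_place hB, outside_place hT])
    (by norm_num [mk_mul_mk]) (by norm_num [Complex.normSq_apply])
  have s4 := isotopic_removeNode [arc (-1) (-11 / 16) ⟨1, 0⟩ ⟨1 / 16, 0⟩,
      place (-5 / 8) (1 / 16) ⟨1 / 16, 0⟩ A,
      arc (-9 / 16) (-7 / 16) ⟨1 / 16, 0⟩ ⟨1 / 16, 0⟩,
      place (-3 / 8) (1 / 16) ⟨1 / 16, 0⟩ B,
      arc (-5 / 16) (1 / 4) ⟨1 / 16, 0⟩ ⟨1 / 16, 0⟩,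
      place (1 / 2) (1 / 4) ⟨1 / 16, 0⟩ T]
    []
    (x₀ := 3 / 4) (x₁ := 7 / 8) (x₂ := 1) (w₀ := ⟨1 / 16, 0⟩) (w₁ := ⟨1 / 2, 0⟩) (w₂ := ⟨1, 0⟩) 1
    (by norm_num [outside_arc, outside_place hA, outside_place hB, outside_place hT])
    (by norm_num [Complex.normSq_apply])
  have s5 := isotopic_slideBox [arc (-1) (-11 / 16) ⟨1, 0⟩ ⟨1 / 16, 0⟩,
      place (-5 / 8) (1 / 16) ⟨1 / 16, 0⟩ A,
      arc (-9 / 16) (-7 / 16) ⟨1 / 16, 0⟩ ⟨1 / 16, 0⟩,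
      place (-3 / 8) (1 / 16) ⟨1 / 16, 0⟩ B]
    [arc (7 / 8) (1) ⟨1 / 2, 0⟩ ⟨1, 0⟩]
    (x₀ := -5 / 16) (x₁ := 1 / 4) (x₂ := 3 / 4) (x₃ := 7 / 8) (y₁ := 9 / 16) (y₂ := 11 / 16)
    (c := 1 / 2) (d := 1 / 4) (c' := 5 / 8) (d' := 1 / 16)
    (w₀ := ⟨1 / 16, 0⟩) (w₁ := ⟨1 / 16, 0⟩) (w₂ := ⟨1 / 16, 0⟩) (w₃ := ⟨1 / 2, 0⟩) (n := ⟨1 / 16, 0⟩) hT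
    (by norm_num [outside_arc, outside_place hA, outside_place hB, outside_place hT])
    (by norm_num) (by norm_num [Complex.normSq_apply])
  have s6 := isotopic_removeNode [arc (-1) (-11 / 16) ⟨1, 0⟩ ⟨1 / 16, 0⟩,
      place (-5 / 8) (1 / 16) ⟨1 / 16, 0⟩ A,
      arc (-9 / 16) (-7 / 16) ⟨1 / 16, 0⟩ ⟨1 / 16, 0⟩,
      place (-3 / 8) (1 / 16) ⟨1 / 16, 0⟩ B,
      arc (-5 / 16) (9 / 16) ⟨1 / 16, 0⟩ ⟨1 / 16, 0⟩,
      place (5 / 8) (1 / 16) ⟨1 / 16, 0⟩ T]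
    []
    (x₀ := 11 / 16) (x₁ := 7 / 8) (x₂ := 1) (w₀ := ⟨1 / 16, 0⟩) (w₁ := ⟨1 / 2, 0⟩) (w₂ := ⟨1, 0⟩) 1
    (by norm_num [outside_arc, outside_place hA, outside_place hB, outside_place hT])
    (by norm_num [Complex.normSq_apply])
  have s7 := isotopic_removeNode [arc (-1) (-11 / 16) ⟨1, 0⟩ ⟨1 / 16, 0⟩,
      place (-5 / 8) (1 / 16) ⟨1 / 16, 0⟩ A,
      arc (-9 / 16) (-7 / 16) ⟨1 / 16, 0⟩ ⟨1 / 16, 0⟩,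
      place (-3 / 8) (1 / 16) ⟨1 / 16, 0⟩ B,
      arc (-5 / 16) (9 / 16) ⟨1 / 16, 0⟩ ⟨1 / 16, 0⟩,
      place (5 / 8) (1 / 16) ⟨1 / 16, 0⟩ T]
    []
    (x₀ := 11 / 16) (x₁ := 3 / 4) (x₂ := 1) (w₀ := ⟨1 / 16, 0⟩) (w₁ := ⟨1 / 4, 0⟩) (w₂ := ⟨1, 0⟩) 1
    (by norm_num [outside_arc, outside_place hA, outside_place hB, outside_place hT])
    (by norm_num [Complex.normSq_apply])
  have s8 := isotopic_slideBox [arc (-1) (-11 / 16) ⟨1, 0⟩ ⟨1 / 16, 0⟩,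
      place (-5 / 8) (1 / 16) ⟨1 / 16, 0⟩ A]
    [place (5 / 8) (1 / 16) ⟨1 / 16, 0⟩ T,
      arc (11 / 16) (3 / 4) ⟨1 / 16, 0⟩ ⟨1 / 4, 0⟩,
      arc (3 / 4) (1) ⟨1 / 4, 0⟩ ⟨1, 0⟩]
    (x₀ := -9 / 16) (x₁ := -7 / 16) (x₂ := -5 / 16) (x₃ := 9 / 16) (y₁ := 5 / 16) (y₂ := 7 / 16)
    (c := -3 / 8) (d := 1 / 16) (c' := 3 / 8) (d' := 1 / 16)
    (w₀ := ⟨1 / 16, 0⟩) (w₁ := ⟨1 / 16, 0⟩) (w₂ := ⟨1 / 16, 0⟩) (w₃ := ⟨1 / 16, 0⟩) (n := ⟨1 / 16, 0⟩) hB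
    (by norm_num [outside_arc, outside_place hA, outside_place hB, outside_place hT])
    (by norm_num) (by norm_num [Complex.normSq_apply])
  have s9 := isotopic_removeNode [arc (-1) (-11 / 16) ⟨1, 0⟩ ⟨1 / 16, 0⟩,
      place (-5 / 8) (1 / 16) ⟨1 / 16, 0⟩ A]
    [place (3 / 8) (1 / 16) ⟨1 / 16, 0⟩ B,
      arc (7 / 16) (9 / 16) ⟨1 / 16, 0⟩ ⟨1 / 16, 0⟩,
      place (5 / 8) (1 / 16) ⟨1 / 16, 0⟩ T,
      arc (11 / 16) (3 / 4) ⟨1 / 16, 0⟩ ⟨1 / 4, 0⟩,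
      arc (3 / 4) (1) ⟨1 / 4, 0⟩ ⟨1, 0⟩]
    (x₀ := -9 / 16) (x₁ := 1 / 4) (x₂ := 5 / 16) (w₀ := ⟨1 / 16, 0⟩) (w₁ := ⟨1 / 4, 0⟩) (w₂ := ⟨1 / 16, 0⟩) 1
    (by norm_num [outside_arc, outside_place hA, outside_place hB, outside_place hT])
    (by norm_num [Complex.normSq_apply])
  have s10 := isotopic_removeNode []
    [place (-5 / 8) (1 / 16) ⟨1 / 16, 0⟩ A,
      arc (-9 / 16) (1 / 4) ⟨1 / 16, 0⟩ ⟨1 / 4, 0⟩,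
      arc (1 / 4) (5 / 16) ⟨1 / 4, 0⟩ ⟨1 / 16, 0⟩,
      place (3 / 8) (1 / 16) ⟨1 / 16, 0⟩ B,
      arc (7 / 16) (9 / 16) ⟨1 / 16, 0⟩ ⟨1 / 16, 0⟩,
      place (5 / 8) (1 / 16) ⟨1 / 16, 0⟩ T,
      arc (11 / 16) (3 / 4) ⟨1 / 16, 0⟩ ⟨1 / 4, 0⟩,
      arc (3 / 4) (1) ⟨1 / 4, 0⟩ ⟨1, 0⟩]
    (x₀ := -1) (x₁ := -7 / 8) (x₂ := -11 / 16) (w₀ := ⟨1, 0⟩) (w₁ := ⟨1 / 2, 0⟩) (w₂ := ⟨1 / 16, 0⟩) 1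
    (by norm_num [outside_arc, outside_place hA, outside_place hB, outside_place hT])
    (by norm_num [Complex.normSq_apply])
  have s11 := isotopic_slideBox [arc (-1) (-7 / 8) ⟨1, 0⟩ ⟨1 / 2, 0⟩]
    [arc (1 / 4) (5 / 16) ⟨1 / 4, 0⟩ ⟨1 / 16, 0⟩,
      place (3 / 8) (1 / 16) ⟨1 / 16, 0⟩ B,
      arc (7 / 16) (9 / 16) ⟨1 / 16, 0⟩ ⟨1 / 16, 0⟩,
      place (5 / 8) (1 / 16) ⟨1 / 16, 0⟩ T,
      arc (11 / 16) (3 / 4) ⟨1 / 16, 0⟩ ⟨1 / 4, 0⟩,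
      arc (3 / 4) (1) ⟨1 / 4, 0⟩ ⟨1, 0⟩]
    (x₀ := -7 / 8) (x₁ := -11 / 16) (x₂ := -9 / 16) (x₃ := 1 / 4) (y₁ := -3 / 4) (y₂ := -1 / 4)
    (c := -5 / 8) (d := 1 / 16) (c' := -1 / 2) (d' := 1 / 4)
    (w₀ := ⟨1 / 2, 0⟩) (w₁ := ⟨1 / 16, 0⟩) (w₂ := ⟨1 / 16, 0⟩) (w₃ := ⟨1 / 4, 0⟩) (n := ⟨1 / 16, 0⟩) hA
    (by norm_num [outside_arc, outside_place hA, outside_place hB, outside_place hT])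
    (by norm_num) (by norm_num [Complex.normSq_apply])
  have s12 := isotopic_removeNode []
    [place (-1 / 2) (1 / 4) ⟨1 / 16, 0⟩ A,
      arc (-1 / 4) (1 / 4) ⟨1 / 16, 0⟩ ⟨1 / 4, 0⟩,
      arc (1 / 4) (5 / 16) ⟨1 / 4, 0⟩ ⟨1 / 16, 0⟩,
      place (3 / 8) (1 / 16) ⟨1 / 16, 0⟩ B,
      arc (7 / 16) (9 / 16) ⟨1 / 16, 0⟩ ⟨1 / 16, 0⟩,
      place (5 / 8) (1 / 16) ⟨1 / 16, 0⟩ T,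
      arc (11 / 16) (3 / 4) ⟨1 / 16, 0⟩ ⟨1 / 4, 0⟩,
      arc (3 / 4) (1) ⟨1 / 4, 0⟩ ⟨1, 0⟩]
    (x₀ := -1) (x₁ := -7 / 8) (x₂ := -3 / 4) (w₀ := ⟨1, 0⟩) (w₁ := ⟨1 / 2, 0⟩) (w₂ := ⟨1 / 16, 0⟩) 1
    (by norm_num [outside_arc, outside_place hA, outside_place hB, outside_place hT])
    (by norm_num [Complex.normSq_apply])
  have s13 := isotopic_mulBox []
    [arc (1 / 4) (5 / 16) ⟨1 / 4, 0⟩ ⟨1 / 16, 0⟩,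
      place (3 / 8) (1 / 16) ⟨1 / 16, 0⟩ B,
      arc (7 / 16) (9 / 16) ⟨1 / 16, 0⟩ ⟨1 / 16, 0⟩,
      place (5 / 8) (1 / 16) ⟨1 / 16, 0⟩ T,
      arc (11 / 16) (3 / 4) ⟨1 / 16, 0⟩ ⟨1 / 4, 0⟩,
      arc (3 / 4) (1) ⟨1 / 4, 0⟩ ⟨1, 0⟩]
    (x₀ := -1) (x₁ := -3 / 4) (x₂ := -1 / 4) (x₃ := 1 / 4) (c := -1 / 2) (d := 1 / 4)
    (w₀ := ⟨1, 0⟩) (w₁ := ⟨1 / 16, 0⟩) (w₂ := ⟨1 / 16, 0⟩) (w₃ := ⟨1 / 4, 0⟩)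
    (w₁' := ⟨1 / 4, 0⟩) (w₂' := ⟨1 / 4, 0⟩) (n := ⟨1 / 16, 0⟩) (n' := ⟨1 / 4, 0⟩) hA 1 1 ⟨4, 0⟩
    (by norm_num [outside_arc, outside_place hA, outside_place hB, outside_place hT])
    (by norm_num [mk_mul_mk]) (by norm_num [Complex.normSq_apply])
  exact s1.trans (s2.trans (s3.trans (s4.symm.trans (s5.trans (s6.trans (s7.symm.trans (s8.trans (s9.symm.trans (s10.symm.trans (s11.trans (s12.trans (s13))))))))))))

/-! ### The action of the elementary operations on rational tangles -/

/-- `X` lies in the cube. -/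
def InCube (X : Set Point) : Prop := ∀ p ∈ X, ‖p‖ ≤ 1

theorem InCube.union {X Y : Set Point} (hX : InCube X) (hY : InCube Y) : InCube (X ∪ Y) :=
  fun p hp => hp.elim (hX p) (hY p)

theorem InCube.inCylinder {X : Set Point} (hX : InCube X) : InCylinder 2 X := fun p hp => by
  have h := (norm_le_one_iff p).1 (hX p hp)
  refine ⟨h.1, ?_⟩
  simp only [Complex.normSq_apply, cplx]
  nlinarith [abs_le_one_iff_mul_self_le_one.1 h.2.1, abs_le_one_iff_mul_self_le_one.1 h.2.2]

theorem InCube.quarter {X : Set Point} (hX : InCube X) : InCube (quarter '' X) := by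
  rintro _ ⟨p, hp, rfl⟩
  have h := hX p hp
  rw [norm_le_one_iff] at h ⊢
  simp only [SolidTorusLinks.quarter, abs_neg]
  tauto

theorem inCube_arc {x₀ x₁ : ℝ} {w₀ w₁ : ℂ} (h₀ : ‖pt x₀ w₀‖ ≤ 1) (h₁ : ‖pt x₁ w₁‖ ≤ 1) :
    InCube (arc x₀ x₁ w₀ w₁) := by
  have e : ∀ x w, ‖pt x (-w)‖ = ‖pt x w‖ := fun x w => by simp [pt]
  rintro p (hp | hp)
  · exact norm_le_of_mem_segment h₀ h₁ p hp
  · exact norm_le_of_mem_segment ((e _ _).trans_le h₀) ((e _ _).trans_le h₁) p hp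

theorem inCube_tilt {e : ℝ} (he : e = 1 ∨ e = -1) {X : Set Point} (hX : InCube X) :
    InCube (tilt e X) := by
  simp only [tilt, chain_cons, chain_nil, union_empty]
  refine (inCube_arc ?_ ?_).union (InCube.union ?_ (inCube_arc ?_ ?_))
  · rcases he with rfl | rfl <;> norm_num [norm_le_one_iff, pt, abs_le]
  · rcases he with rfl | rfl <;> norm_num [norm_le_one_iff, pt, abs_le]
  · rintro _ ⟨p, hp, rfl⟩
    have h := (norm_le_one_iff p).1 (hX p hp)
    rw [norm_le_one_iff]
    simp only [abs_le] at h ⊢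
    simp only [pt, cplx, mk_mul_mk]
    refine ⟨⟨?_, ?_⟩, ⟨?_, ?_⟩, ?_, ?_⟩ <;> linarith
  · rcases he with rfl | rfl <;> norm_num [norm_le_one_iff, pt, abs_le]
  · rcases he with rfl | rfl <;> norm_num [norm_le_one_iff, pt, abs_le]

theorem inCube_zeroCore : InCube zeroCore := by
  apply inCube_arc <;> norm_num [norm_le_one_iff, pt, abs_le]

theorem inCylinder_theta {e : ℝ} (he : e = 1 ∨ e = -1) {X : Set Point} (hX : InCylinder 2 X) :
    InCylinder 1 (theta e X) := by
  simp only [theta, chain_cons, chain_nil, union_empty]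
  refine (inCylinder_arc ?_ ?_ ?_ ?_ ?_).union ((inCylinder_place hX ?_ ?_).union
    (inCylinder_arc ?_ ?_ ?_ ?_ ?_))
  all_goals rcases he with rfl | rfl <;> norm_num [Complex.normSq_apply, abs_of_pos]

theorem inCylinder_sum {S T : Set Point} (hS : InCylinder 1 S) (hT : InCylinder 1 T) :
    InCylinder 1 (sum S T) := by
  rw [sum_eq_place, sumArcs_eq]
  simp only [chain_cons, chain_nil, union_empty]
  refine ((inCylinder_place hS ?_ ?_).union (inCylinder_place hT ?_ ?_)).union
    ((inCylinder_arc ?_ ?_ ?_ ?_ ?_).union ((inCylinder_arc ?_ ?_ ?_ ?_ ?_).union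
    (inCylinder_arc ?_ ?_ ?_ ?_ ?_)))
  all_goals norm_num [Complex.normSq_apply, abs_div]

theorem inCylinder_natTangle : ∀ n, InCylinder 1 (natTangle n)
  | 0 => by
    rw [natTangle, zeroTangle_eq]
    simp only [chain_cons, chain_nil, union_empty]
    refine (inCylinder_arc ?_ ?_ ?_ ?_ ?_).union (inCylinder_arc ?_ ?_ ?_ ?_ ?_)
    all_goals norm_num [Complex.normSq_apply]
  | 1 => by
    rw [natTangle, oneTangle_eq]
    simp only [chain_cons, chain_nil, union_empty]
    refine (inCylinder_arc ?_ ?_ ?_ ?_ ?_).union (inCylinder_arc ?_ ?_ ?_ ?_ ?_)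
    all_goals norm_num [Complex.normSq_apply]
  | n + 2 => inCylinder_sum (inCylinder_natTangle 1) (inCylinder_natTangle (n + 1))

theorem mirror_union (S T : Set Point) : mirror (S ∪ T) = mirror S ∪ mirror T := image_union _ _ _

theorem inv_union (S T : Set Point) : inv (S ∪ T) = inv S ∪ inv T := image_union _ _ _

theorem mirror_segment (p q : Point) : mirror (segment ℝ p q) =
    segment ℝ (p.1, p.2.1, -p.2.2) (q.1, q.2.1, -q.2.2) := by
  let f : Point →ₗ[ℝ] Point :=
    { toFun := fun p => (p.1, p.2.1, -p.2.2)
      map_add' := fun p q => by ext <;> simp; ring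
      map_smul' := fun c p => by ext <;> simp }
  exact image_segment ℝ f.toAffineMap p q

theorem inv_segment (p q : Point) : inv (segment ℝ p q) =
    segment ℝ (-p.2.1, -p.1, p.2.2) (-q.2.1, -q.1, q.2.2) := by
  let f : Point →ₗ[ℝ] Point :=
    { toFun := fun p => (-p.2.1, -p.1, p.2.2)
      map_add' := fun p q => by ext <;> simp <;> ring
      map_smul' := fun c p => by ext <;> simp }
  exact image_segment ℝ f.toAffineMap p q

theorem mirror_arc (x₀ x₁ a b c d : ℝ) :
    mirror (arc x₀ x₁ ⟨a, b⟩ ⟨c, d⟩) = arc x₀ x₁ ⟨a, -b⟩ ⟨c, -d⟩ := by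
  rw [arc, mirror_union, mirror_segment, mirror_segment, arc]
  rfl

theorem mirror_place (c d r : ℝ) (X : Set Point) :
    mirror (place c d ⟨r, 0⟩ X) = place c d ⟨r, 0⟩ (mirror X) := by
  simp only [mirror, place, image_image]
  refine image_congr fun p _ => ?_
  ext <;> simp [pt, cplx]

theorem mirror_theta (e : ℝ) (X : Set Point) : mirror (theta e X) = theta (-e) (mirror X) := by
  simp only [theta, chain_cons, chain_nil, union_empty, mirror_union, mirror_arc, mirror_place,
    neg_zero, neg_div]

theorem inv_theta (e : ℝ) (X : Set Point) : inv (theta e X) = theta e (inv X) := by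
  have e1 : inv (place 0 (1 / 2) ⟨1 / 2, 0⟩ X) = place 0 (1 / 2) ⟨1 / 2, 0⟩ (inv X) := by
    simp only [inv, place, image_image]
    refine image_congr fun p _ => ?_
    ext <;> simp [pt, cplx]
  have e2 (a b : ℝ) : -(⟨a, b⟩ : ℂ) = ⟨-a, -b⟩ := rfl
  simp only [theta, chain_cons, chain_nil, union_empty, inv_union, arc, inv_segment, e1, e2, pt,
    neg_neg, neg_zero, neg_div]
  rw [segment_symm ℝ (1, 1, 0), segment_symm ℝ (-(1 / 2), -(1 / 2), _)]
  ext; simp only [mem_union]; tauto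

theorem mirror_sum (S T : Set Point) : mirror (sum S T) = sum (mirror S) (mirror T) := by
  simp only [sum_eq_place, sumArcs_eq, chain_cons, chain_nil, union_empty, mirror_union, mirror_arc,
    mirror_place, neg_zero]

theorem mirror_zeroTangle : mirror zeroTangle = zeroTangle := by
  simp only [zeroTangle_eq, chain_cons, chain_nil, union_empty, mirror_union, mirror_arc, neg_zero]

theorem inv_oneTangle : inv oneTangle = oneTangle := by
  simp only [oneTangle, inv_union, inv_segment, neg_neg, neg_zero]
  rw [segment_symm ℝ (1, 1, 0), segment_symm ℝ (0, 0, 1 / 2) (-1, -1, 0)]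
  ext; simp only [mem_union]; tauto

theorem quarter_mirror_quarter (X : Set Point) :
    quarter '' (mirror (quarter '' X)) = mirror X := by
  simp only [mirror, image_image]
  refine image_congr fun p _ => ?_
  simp [quarter]

theorem quarter_mirror_inv_quarter (X : Set Point) :
    quarter '' (mirror (inv (quarter '' X))) = inv (quarter '' (inv X)) := by
  simp only [mirror, inv, image_image]
  refine image_congr fun p _ => ?_
  simp [quarter]

theorem quarter_inv_zeroCore : quarter '' (inv zeroCore) = mirror (inv zeroCore) := by
  have h : ∀ p q : Point, quarter '' segment ℝ p q = segment ℝ (quarter p) (quarter q) := fun p q => by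
    let f : Point →ₗ[ℝ] Point :=
      { toFun := quarter
        map_add' := fun p q => by ext <;> simp [quarter]; ring
        map_smul' := fun c p => by ext <;> simp [quarter] }
    exact image_segment ℝ f.toAffineMap p q
  have e2 (a b : ℝ) : -(⟨a, b⟩ : ℂ) = ⟨-a, -b⟩ := rfl
  simp only [zeroCore, arc, inv_union, inv_segment, mirror_union, mirror_segment, image_union, h, pt,
    quarter, e2, neg_neg]
  rw [segment_symm ℝ (-1, -1, 1)]

/-- `T` is isotopic to a tangle with a standard collar. -/
def Collared (T : Set Point) : Prop := ∃ X, InCube X ∧ Isotopic T (theta 1 X)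

theorem Collared.of_isotopic {T T' : Set Point} (h : Collared T) (h' : Isotopic T T') :
    Collared T' := by
  obtain ⟨X, hX, hT⟩ := h
  exact ⟨X, hX, h'.symm.trans hT⟩

theorem collared_theta_neg {X : Set Point} (hX : InCube X) : Collared (theta (-1) X) :=
  ⟨tilt (-1) X, inCube_tilt (Or.inr rfl) hX, by
    simpa using (isotopic_theta_tilt (Or.inr rfl) hX.inCylinder).symm⟩

theorem isotopic_add {T T' : Set Point} (h : Isotopic T T') :
    Isotopic (sum oneTangle T) (sum oneTangle T') := h.sum_right norm_le_of_mem_oneTangle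

theorem isotopic_add_theta {T X : Set Point} (hX : InCube X) (h : Isotopic T (theta 1 X)) :
    Isotopic (sum oneTangle T) (theta (-1) (quarter '' X)) :=
  (isotopic_add h).trans (isotopic_sum_oneTangle_theta hX.inCylinder)

theorem Collared.add {T : Set Point} (h : Collared T) : Collared (sum oneTangle T) := by
  obtain ⟨X, hX, hT⟩ := h
  exact (collared_theta_neg hX.quarter).of_isotopic (isotopic_add_theta hX hT).symm

theorem Collared.inv {T : Set Point} (h : Collared T) : Collared (inv T) := by
  obtain ⟨X, hX, hT⟩ := h
  exact ⟨SolidTorusLinks.inv X, norm_le_of_mem_inv hX, inv_theta 1 X ▸ hT.inv⟩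

theorem Collared.mirror {T : Set Point} (h : Collared T) : Collared (mirror T) := by
  obtain ⟨X, hX, hT⟩ := h
  exact (collared_theta_neg (norm_le_of_mem_mirror hX)).of_isotopic (mirror_theta 1 X ▸ hT.mirror.symm)

theorem collared_zeroTangle : Collared zeroTangle :=
  ⟨zeroCore, inCube_zeroCore, isotopic_theta_zeroCore.symm⟩

theorem isotopic_add_zeroTangle : Isotopic (sum oneTangle zeroTangle) oneTangle :=
  (isotopic_add_theta inCube_zeroCore isotopic_theta_zeroCore.symm).trans isotopic_theta_oneTangle

theorem isotopic_add_inv_zeroTangle : Isotopic (sum oneTangle (inv zeroTangle)) (inv zeroTangle) := by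
  have h : Isotopic (inv zeroTangle) (theta 1 (inv zeroCore)) := by
    rw [← inv_theta]; exact isotopic_theta_zeroCore.symm.inv
  refine (isotopic_add_theta (norm_le_of_mem_inv inCube_zeroCore) h).trans ?_
  rw [quarter_inv_zeroCore, ← mirror_theta]
  refine h.mirror.symm.trans ?_
  rw [mirror_inv, mirror_zeroTangle]
  exact Isotopic.refl _

theorem Collared.isotopic_add_mirror_add {T : Set Point} (h : Collared T) :
    Isotopic (sum oneTangle (SolidTorusLinks.mirror (sum oneTangle T)))
      (SolidTorusLinks.mirror T) := by
  obtain ⟨X, hX, hT⟩ := h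
  have h1 := (isotopic_add_theta hX hT).mirror
  rw [mirror_theta, neg_neg] at h1
  have h2 := isotopic_add_theta (norm_le_of_mem_mirror hX.quarter) h1
  rw [quarter_mirror_quarter, ← mirror_theta] at h2
  exact h2.trans hT.symm.mirror

theorem Collared.isotopic_add_mirror_inv_add {T : Set Point} (h : Collared T) :
    Isotopic (sum oneTangle (SolidTorusLinks.mirror (SolidTorusLinks.inv (sum oneTangle T))))
      (SolidTorusLinks.inv (sum oneTangle (SolidTorusLinks.inv T))) := by
  obtain ⟨X, hX, hT⟩ := h
  have h1 := (isotopic_add_theta hX hT).inv.mirror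
  rw [inv_theta, mirror_theta, neg_neg] at h1
  have h2 := isotopic_add_theta (norm_le_of_mem_mirror (norm_le_of_mem_inv hX.quarter)) h1
  have h3 := hT.inv
  rw [inv_theta] at h3
  have h4 := (isotopic_add_theta (norm_le_of_mem_inv hX) h3).inv
  rw [inv_theta] at h4
  rw [quarter_mirror_inv_quarter] at h2
  exact h2.trans h4.symm

theorem Collared.isotopic_zero_add {T : Set Point} (h : Collared T) :
    Isotopic (sum zeroTangle T) T := by
  obtain ⟨X, hX, hT⟩ := h
  exact ((hT.sum_right norm_le_of_mem_zeroTangle).trans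
    (isotopic_sum_zeroTangle_theta (Or.inl rfl) hX.inCylinder)).trans hT.symm

theorem Collared.isotopic_add_natTangle {T : Set Point} (h : Collared T) (n : ℕ) :
    Isotopic (sum oneTangle (sum (natTangle n) T)) (sum (natTangle (n + 1)) T) := by
  cases n with
  | zero => exact isotopic_add h.isotopic_zero_add
  | succ n =>
    obtain ⟨X, hX, hT⟩ := h
    refine (isotopic_add (hT.sum_right (norm_le_of_mem_natTangle _))).trans ?_
    refine ((isotopic_sum_assoc (inCylinder_natTangle 1) (inCylinder_natTangle (n + 1))
      (inCylinder_theta (Or.inl rfl) hX.inCylinder)).symm).trans ?_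
    exact hT.symm.sum_right (norm_le_of_mem_natTangle (n + 2))

/-- The tangles isotopic to a rational tangle with positive fraction. -/
inductive Pos : Set Point → Prop
  | one : Pos oneTangle
  | add {T : Set Point} : Pos T → Pos (sum oneTangle T)
  | coadd {T : Set Point} : Pos T → Pos (inv (sum oneTangle (inv T)))
  | of_isotopic {T T' : Set Point} : Pos T → Isotopic T T' → Pos T'

theorem collared_oneTangle : Collared oneTangle :=
  collared_zeroTangle.add.of_isotopic isotopic_add_zeroTangle

theorem Pos.collared {T : Set Point} (h : Pos T) : Collared T := by
  induction h with
  | one => exact collared_oneTangle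
  | add _ ih => exact ih.add
  | coadd _ ih => exact ih.inv.add.inv
  | of_isotopic _ h ih => exact ih.of_isotopic h

theorem Pos.inv {T : Set Point} (h : Pos T) : Pos (inv T) := by
  induction h with
  | one => rw [inv_oneTangle]; exact Pos.one
  | @add T _ ih =>
    have := ih.coadd
    rwa [inv_inv] at this
  | coadd _ ih => rw [inv_inv]; exact ih.add
  | of_isotopic _ h ih => exact ih.of_isotopic h.inv

/-- The tangles isotopic to a rational tangle. -/
def Rat (T : Set Point) : Prop :=
  Isotopic T zeroTangle ∨ Isotopic T (inv zeroTangle) ∨ Pos T ∨ Pos (mirror T)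

theorem Rat.of_isotopic {T T' : Set Point} (h : Rat T) (h' : Isotopic T T') : Rat T' := by
  rcases h with h | h | h | h
  · exact Or.inl (h'.symm.trans h)
  · exact Or.inr (Or.inl (h'.symm.trans h))
  · exact Or.inr (Or.inr (Or.inl (h.of_isotopic h')))
  · exact Or.inr (Or.inr (Or.inr (h.of_isotopic h'.mirror)))

theorem Rat.mirror {T : Set Point} (h : Rat T) : Rat (mirror T) := by
  rcases h with h | h | h | h
  · have := h.mirror
    rw [mirror_zeroTangle] at this
    exact Or.inl this
  · have := h.mirror
    rw [mirror_inv, mirror_zeroTangle] at this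
    exact Or.inr (Or.inl this)
  · exact Or.inr (Or.inr (Or.inr (by rwa [mirror_mirror])))
  · exact Or.inr (Or.inr (Or.inl h))

theorem Rat.inv {T : Set Point} (h : Rat T) : Rat (inv T) := by
  rcases h with h | h | h | h
  · exact Or.inr (Or.inl h.inv)
  · have := h.inv
    rw [inv_inv] at this
    exact Or.inl this
  · exact Or.inr (Or.inr (Or.inl h.inv))
  · refine Or.inr (Or.inr (Or.inr ?_))
    rw [mirror_inv]; exact h.inv

theorem Rat.collared {T : Set Point} (h : Rat T) : Collared T := by
  rcases h with h | h | h | h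
  · exact collared_zeroTangle.of_isotopic h.symm
  · exact collared_zeroTangle.inv.of_isotopic h.symm
  · exact h.collared
  · have := h.collared.mirror
    rwa [mirror_mirror] at this

theorem Pos.rat {T : Set Point} (h : Pos T) : Rat T := Or.inr (Or.inr (Or.inl h))

theorem Pos.rat_add_mirror {T : Set Point} (h : Pos T) : Rat (sum oneTangle (mirror T)) := by
  induction h with
  | one =>
    refine Or.inl ?_
    refine (isotopic_add isotopic_add_zeroTangle.symm.mirror).trans ?_
    have := collared_zeroTangle.isotopic_add_mirror_add
    rwa [mirror_zeroTangle] at this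
  | add h _ => exact h.rat.mirror.of_isotopic h.collared.isotopic_add_mirror_add.symm
  | @coadd T h _ =>
    have := h.inv.collared.isotopic_add_mirror_inv_add.symm
    rw [inv_inv] at this
    exact h.add.inv.rat.of_isotopic this
  | of_isotopic _ h ih => exact ih.of_isotopic (isotopic_add h.mirror)

theorem Rat.add {T : Set Point} (h : Rat T) : Rat (sum oneTangle T) := by
  rcases h with h | h | h | h
  · exact Pos.one.rat.of_isotopic ((isotopic_add h).trans isotopic_add_zeroTangle).symm
  · exact Or.inr (Or.inl ((isotopic_add h).trans isotopic_add_inv_zeroTangle))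
  · exact h.add.rat
  · have := h.rat_add_mirror
    rwa [mirror_mirror] at this

theorem rat_natTangle : ∀ n, Rat (natTangle n)
  | 0 => Or.inl (Isotopic.refl _)
  | 1 => Pos.one.rat
  | n + 2 => (rat_natTangle (n + 1)).add

theorem rat_intTangle : ∀ n, Rat (intTangle n)
  | Int.ofNat n => rat_natTangle n
  | Int.negSucc n => (rat_natTangle (n + 1)).mirror

theorem Rat.natTangle_add {T : Set Point} (h : Rat T) (n : ℕ) : Rat (sum (natTangle n) T) := by
  induction n with
  | zero => exact h.of_isotopic h.collared.isotopic_zero_add.symm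
  | succ n ih => exact ih.add.of_isotopic (h.collared.isotopic_add_natTangle n)

theorem Rat.intTangle_add {T : Set Point} (h : Rat T) : ∀ n, Rat (sum (intTangle n) T)
  | Int.ofNat n => h.natTangle_add n
  | Int.negSucc n => by
    have := (h.mirror.natTangle_add (n + 1)).mirror
    rwa [mirror_sum, mirror_mirror] at this

theorem rat_rationalTangle (a : WithTop ℤ) (l : List ℤ) : Rat (rationalTangle a l) := by
  induction l using List.reverseRecOn with
  | nil =>
    cases a with
    | top => exact Or.inr (Or.inl (Isotopic.refl _))
    | coe n => exact rat_intTangle n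
  | append_singleton l b ih =>
    rw [rationalTangle_concat]
    exact ih.inv.intTangle_add b

/-! ### Positive continued fractions -/

/-- The rational tangle `[b+1 l₁ l₂ …]` for natural numbers. -/
def posTangle (b : ℕ) (l : List ℕ) : Set Point :=
  l.foldl (fun T a => sum (natTangle a) (inv T)) (natTangle (b + 1))

theorem posTangle_concat (b : ℕ) (l : List ℕ) (a : ℕ) :
    posTangle b (l ++ [a]) = sum (natTangle a) (inv (posTangle b l)) := by
  simp [posTangle]

theorem posTangle_eq (b : ℕ) (l : List ℕ) :
    posTangle b l = rationalTangle ((b + 1 : ℕ) : ℤ) (l.map (Nat.cast : ℕ → ℤ)) := by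
  induction l using List.reverseRecOn with
  | nil => rfl
  | append_singleton l a ih =>
    rw [posTangle_concat, List.map_append, List.map_singleton, rationalTangle_concat, ih]
    rfl

theorem collared_posTangle (b : ℕ) (l : List ℕ) : Collared (posTangle b l) := by
  rw [posTangle_eq]; exact (rat_rationalTangle _ _).collared

/-- The tangle with the last entry increased by one arises by adding a crossing. -/
theorem exists_isotopic_add_posTangle (b : ℕ) (l : List ℕ) : ∃ b' l',
    l'.length = l.length ∧ l'.dropLast = l.dropLast ∧ (∀ a ∈ l'.getLast?, 0 < a) ∧
      Isotopic (sum oneTangle (posTangle b l)) (posTangle b' l') := by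
  induction l using List.reverseRecOn with
  | nil => exact ⟨b + 1, [], rfl, rfl, by simp, Isotopic.refl _⟩
  | append_singleton l a _ =>
    refine ⟨b, l ++ [a + 1], by simp, by simp, by simp, ?_⟩
    rw [posTangle_concat, posTangle_concat]
    exact (collared_posTangle b l).inv.isotopic_add_natTangle a

theorem forall_pos_of_dropLast {l : List ℕ} (h : ∀ a ∈ l.dropLast, 0 < a)
    (h' : ∀ a ∈ l.getLast?, 0 < a) : ∀ a ∈ l, 0 < a := by
  induction l using List.reverseRecOn with
  | nil => simp
  | append_singleton l b _ =>
    simp only [List.dropLast_concat, List.getLast?_concat, Option.mem_some_iff, forall_eq'] at h h'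
    simp only [List.mem_append, List.mem_singleton]
    rintro a (ha | rfl)
    · exact h a ha
    · exact h'

theorem isotopic_inv_add_inv_posTangle (b : ℕ) (l : List ℕ) :
    Isotopic (inv (sum oneTangle (inv (posTangle b l)))) (posTangle b (l ++ [1, 0])) := by
  have e : l ++ [1, 0] = l ++ [1] ++ [0] := by simp
  rw [e, posTangle_concat, posTangle_concat]
  exact (collared_posTangle b l).inv.add.inv.isotopic_zero_add.symm

/-- Every tangle with positive fraction is isotopic to one in canonical form. -/
theorem Pos.exists_isotopic_posTangle {T : Set Point} (h : Pos T) : ∃ b l,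
    Even l.length ∧ (∀ a ∈ l.dropLast, 0 < a) ∧ Isotopic T (posTangle b l) := by
  induction h with
  | one => exact ⟨0, [], by simp, by simp, Isotopic.refl _⟩
  | of_isotopic _ h ih =>
    obtain ⟨b, l, h1, h2, h3⟩ := ih
    exact ⟨b, l, h1, h2, h.symm.trans h3⟩
  | add _ ih =>
    obtain ⟨b, l, h1, h2, h3⟩ := ih
    obtain ⟨b', l', h4, h5, -, h6⟩ := exists_isotopic_add_posTangle b l
    exact ⟨b', l', h4 ▸ h1, h5 ▸ h2, (isotopic_add h3).trans h6⟩
  | @coadd T _ ih =>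
    obtain ⟨b, l, h1, h2, h3⟩ := ih
    by_cases h0 : ∀ a ∈ l, 0 < a
    · refine ⟨b, l ++ [1, 0], ?_, ?_, (isotopic_add h3.inv).inv.trans
        (isotopic_inv_add_inv_posTangle b l)⟩
      · simpa [Nat.even_add] using h1
      · simp only [List.dropLast_append_cons, List.dropLast_cons_cons, List.dropLast_singleton,
          List.mem_append, List.mem_singleton]
        rintro a (ha | rfl)
        · exact h0 a ha
        · exact one_pos
    · rcases List.eq_nil_or_concat l with rfl | ⟨l₀, c, rfl⟩
      · simp at h0
      rw [List.concat_eq_append] at *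
      simp only [List.dropLast_concat] at h2
      obtain rfl : c = 0 := by
        by_contra hc
        refine h0 fun a ha => ?_
        simp only [List.mem_append, List.mem_singleton] at ha
        rcases ha with ha | rfl
        · exact h2 a ha
        · exact Nat.pos_of_ne_zero hc
      have h4 : Isotopic (SolidTorusLinks.inv T) (posTangle b l₀) := by
        rw [posTangle_concat] at h3
        have := (h3.trans (collared_posTangle b l₀).inv.isotopic_zero_add).inv
        rwa [inv_inv] at this
      obtain ⟨b', l', h5, h6, h7, h8⟩ := exists_isotopic_add_posTangle b l₀
      refine ⟨b', l' ++ [0], ?_, ?_, ?_⟩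
      · simpa [h5] using h1
      · rw [List.dropLast_concat]
        refine forall_pos_of_dropLast ?_ h7
        rw [h6]
        exact fun a ha => h2 a (List.mem_of_mem_dropLast ha)
      · rw [posTangle_concat]
        exact ((isotopic_add h4).trans h8).inv.trans
          (collared_posTangle b' l').inv.isotopic_zero_add.symm

/-! ### Alternating diagrams -/

theorem not_localMax_both {h : ℝ → ℝ} (hc : ContinuousOn h (Icc 0 1))
    (hi : ∀ t ∈ Ioo (0 : ℝ) 1, ∃ V ∈ 𝓝 t, InjOn h V)
    (h0 : ∀ᶠ t in 𝓝[Icc 0 1] (0 : ℝ), h t ≤ h 0) (h1 : ∀ᶠ t in 𝓝[Icc 0 1] (1 : ℝ), h t ≤ h 1) :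
    False := by
  have key : ∀ t ∈ Ioo (0 : ℝ) 1, ∀ W ∈ 𝓝 t, (∃ s ∈ W, h s < h t) := by
    intro t ht W hW
    obtain ⟨V, hV, hinj⟩ := hi t ht
    have hN : W ∩ V ∩ Icc 0 1 ∈ 𝓝 t :=
      inter_mem (inter_mem hW hV) (Icc_mem_nhds ht.1 ht.2)
    obtain ⟨δ, hδ, hball⟩ := Metric.mem_nhds_iff.1 hN
    have hsub : Icc (t - δ / 2) (t + δ / 2) ⊆ W ∩ V ∩ Icc 0 1 := fun s hs => hball <| by
      rw [Metric.mem_ball, Real.dist_eq, abs_lt]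
      constructor <;> linarith [hs.1, hs.2]
    have hle : t - δ / 2 ≤ t + δ / 2 := by linarith
    have hl : t - δ / 2 ∈ Icc (t - δ / 2) (t + δ / 2) := left_mem_Icc.2 hle
    have hr : t + δ / 2 ∈ Icc (t - δ / 2) (t + δ / 2) := right_mem_Icc.2 hle
    have hm : t ∈ Icc (t - δ / 2) (t + δ / 2) := ⟨by linarith, by linarith⟩
    rcases ContinuousOn.strictMonoOn_of_injOn_Icc' hle
      (hc.mono fun s hs => (hsub hs).2) (hinj.mono fun s hs => (hsub hs).1.2) with hs | hs
    · exact ⟨_, (hsub hl).1.1, hs hl hm (by linarith)⟩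
    · exact ⟨_, (hsub hr).1.1, hs hm hr (by linarith)⟩
  obtain ⟨t, ht, hmin⟩ := isCompact_Icc.exists_isMinOn (nonempty_Icc.2 zero_le_one) hc
  have hno : ∀ t ∈ Ioo (0 : ℝ) 1, ¬ ∀ s ∈ Icc (0 : ℝ) 1, h t ≤ h s := fun t ht hs => by
    obtain ⟨s, hs', hlt⟩ := key t ht _ (Icc_mem_nhds ht.1 ht.2)
    exact absurd (hs s hs') (not_le.2 hlt)
  have hend : ∀ c ∈ Icc (0 : ℝ) 1, (∀ᶠ s in 𝓝[Icc 0 1] c, h s ≤ h c) →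
      (∀ s ∈ Icc (0 : ℝ) 1, h c ≤ h s) → False := fun c hcI hcl hcm => by
    have hne : (𝓝[Ioo (0 : ℝ) 1] c).NeBot := by
      rw [← mem_closure_iff_nhdsWithin_neBot, closure_Ioo (zero_ne_one)]
      exact hcI
    obtain ⟨s, hs, hsI⟩ := ((hcl.filter_mono (nhdsWithin_mono c Ioo_subset_Icc_self)).and
      self_mem_nhdsWithin).exists
    exact hno s hsI fun u hu => hs.trans (hcm u hu)
  rcases eq_or_ne t 0 with rfl | h0'
  · exact hend 0 ht h0 hmin
  rcases eq_or_ne t 1 with rfl | h1'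
  · exact hend 1 ht h1 hmin
  · exact hno t ⟨lt_of_le_of_ne ht.1 h0'.symm, lt_of_le_of_ne ht.2 h1'⟩ hmin

/-- A continuous function on `A` that is locally injective except for a local maximum at every
upper and a local minimum at every lower point of a crossing. -/
structure IsProfile (A : Set Point) (f : Point → ℝ) : Prop where
  isClosed : IsClosed A
  continuousOn : ContinuousOn f A
  le_over : ∀ p, IsOver A p → ∀ᶠ q in 𝓝[A] p, f q ≤ f p
  under_le : ∀ p, IsUnder A p → ∀ᶠ q in 𝓝[A] p, f p ≤ f q
  inj : ∀ p ∈ A, ¬ IsOver A p → ¬ IsUnder A p → ∃ U ∈ 𝓝 p, InjOn f (U ∩ A)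

theorem IsProfile.isAlternating {A : Set Point} {f : Point → ℝ} (hf : IsProfile A f) :
    IsAlternating A := by
  intro γ hγ hinj hA hcross
  let c : ℝ → Point := fun t => γ (projIcc 0 1 zero_le_one t)
  have hcc : Continuous c := hγ.comp continuous_projIcc
  have hcA : ∀ t, c t ∈ A := fun t => hA _
  have c0 : c 0 = γ 0 := by simp only [c, projIcc_left]; rfl
  have c1 : c 1 = γ 1 := by simp only [c, projIcc_right]; rfl
  have hh : Continuous fun t => f (c t) := hf.continuousOn.comp_continuous hcc hcA
  have hi : ∀ t ∈ Ioo (0 : ℝ) 1, ∃ V ∈ 𝓝 t, InjOn (fun t => f (c t)) V := by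
    intro t ht
    have hct : c t = γ ⟨t, ht.1.le, ht.2.le⟩ := by
      simp only [c, projIcc_of_mem zero_le_one ⟨ht.1.le, ht.2.le⟩]
    have hn : ¬ (IsOver A (c t) ∨ IsUnder A (c t)) := by
      rw [hct, hcross]
      rintro (h | h)
      · exact ht.1.ne' (congrArg Subtype.val h)
      · exact ht.2.ne (congrArg Subtype.val h)
    obtain ⟨U, hU, hUi⟩ := hf.inj (c t) (hcA t) (fun h => hn (Or.inl h)) fun h => hn (Or.inr h)
    refine ⟨c ⁻¹' U ∩ Ioo 0 1, inter_mem (hcc.continuousAt.preimage_mem_nhds hU)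
      (Ioo_mem_nhds ht.1 ht.2), fun s hs u hu hsu => ?_⟩
    have h := hinj (hUi ⟨hs.1, hcA s⟩ ⟨hu.1, hcA u⟩ hsu)
    rw [projIcc_of_mem zero_le_one ⟨hs.2.1.le, hs.2.2.le⟩,
      projIcc_of_mem zero_le_one ⟨hu.2.1.le, hu.2.2.le⟩] at h
    exact congrArg Subtype.val h
  have hlim : ∀ t, Tendsto c (𝓝[Icc 0 1] t) (𝓝[A] (c t)) := fun t =>
    tendsto_nhdsWithin_iff.2 ⟨hcc.continuousAt.mono_left nhdsWithin_le_nhds,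
      Eventually.of_forall hcA⟩
  have hover : ∀ t, IsOver A (c t) → ∀ᶠ s in 𝓝[Icc 0 1] t, f (c s) ≤ f (c t) := fun t h =>
    (hlim t).eventually (hf.le_over _ h)
  have hunder : ∀ t, IsUnder A (c t) → ∀ᶠ s in 𝓝[Icc 0 1] t, f (c t) ≤ f (c s) := fun t h =>
    (hlim t).eventually (hf.under_le _ h)
  have e0 := (hcross 0).2 (Or.inl rfl)
  have e1 := (hcross 1).2 (Or.inr rfl)
  rw [← c0] at e0 ⊢
  rw [← c1] at e1 ⊢
  constructor
  · intro h
    refine e1.resolve_left fun h' => ?_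
    exact not_localMax_both hh.continuousOn hi (hover 0 h) (hover 1 h')
  · intro h
    refine e0.resolve_right fun h' => ?_
    refine not_localMax_both (h := fun t => -f (c t)) hh.neg.continuousOn (fun t ht => ?_) ?_ ?_
    · obtain ⟨V, hV, hVi⟩ := hi t ht
      exact ⟨V, hV, fun s hs u hu hsu => hVi hs hu (neg_injective hsu)⟩
    · exact (hunder 0 h').mono fun s hs => neg_le_neg hs
    · exact (hunder 1 h).mono fun s hs => neg_le_neg hs

theorem IsProfile.congr {A : Set Point} {f g : Point → ℝ} (hf : IsProfile A f) (h : EqOn f g A) :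
    IsProfile A g where
  isClosed := hf.isClosed
  continuousOn := hf.continuousOn.congr h.symm
  le_over p hp := by
    filter_upwards [hf.le_over p hp, self_mem_nhdsWithin] with q hq hqA
    rwa [← h hqA, ← h hp.1]
  under_le p hp := by
    filter_upwards [hf.under_le p hp, self_mem_nhdsWithin] with q hq hqA
    rwa [← h hqA, ← h hp.1]
  inj p hp ho hu := by
    obtain ⟨U, hU, hi⟩ := hf.inj p hp ho hu
    exact ⟨U, hU, hi.congr (h.mono inter_subset_right)⟩

theorem IsProfile.const_mul {A : Set Point} {f : Point → ℝ} (hf : IsProfile A f) {m : ℝ}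
    (hm : 0 < m) : IsProfile A fun p => m * f p where
  isClosed := hf.isClosed
  continuousOn := continuousOn_const.mul hf.continuousOn
  le_over p hp := (hf.le_over p hp).mono fun q hq => mul_le_mul_of_nonneg_left hq hm.le
  under_le p hp := (hf.under_le p hp).mono fun q hq => mul_le_mul_of_nonneg_left hq hm.le
  inj p hp ho hu := by
    obtain ⟨U, hU, hi⟩ := hf.inj p hp ho hu
    exact ⟨U, hU, fun x hx y hy hxy => hi hx hy (mul_left_cancel₀ hm.ne' hxy)⟩

theorem tendsto_symm_nhdsWithin_image (e : Point ≃ₜ Point) (A : Set Point) (p : Point) :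
    Tendsto e.symm (𝓝[e '' A] p) (𝓝[A] (e.symm p)) := by
  refine tendsto_nhdsWithin_iff.2 ⟨e.symm.continuous.continuousAt.mono_left nhdsWithin_le_nhds, ?_⟩
  filter_upwards [self_mem_nhdsWithin] with q hq
  obtain ⟨r, hr, rfl⟩ := hq
  simpa

theorem IsProfile.image {A : Set Point} {f : Point → ℝ} (hf : IsProfile A f) (e : Point ≃ₜ Point)
    (he : ∀ p q : Point, ((e q).1 = (e p).1 ∧ (e q).2.1 = (e p).2.1 ∧ (e q).2.2 < (e p).2.2) ↔
      (q.1 = p.1 ∧ q.2.1 = p.2.1 ∧ q.2.2 < p.2.2)) :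
    IsProfile (e '' A) fun p => f (e.symm p) := by
  have hmem : ∀ p, e p ∈ e '' A ↔ p ∈ A := fun p => e.injective.mem_set_image
  have ho : ∀ p, IsOver (e '' A) (e p) ↔ IsOver A p := fun p => by
    simp only [IsOver, hmem, exists_mem_image, he]
  have hu : ∀ p, IsUnder (e '' A) (e p) ↔ IsUnder A p := fun p => by
    have he' : ∀ q : Point,
        ((e q).1 = (e p).1 ∧ (e q).2.1 = (e p).2.1 ∧ (e p).2.2 < (e q).2.2) ↔
        (q.1 = p.1 ∧ q.2.1 = p.2.1 ∧ p.2.2 < q.2.2) := fun q => by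
      rw [eq_comm, @eq_comm _ (e q).2.1, he, eq_comm, @eq_comm _ p.2.1]
    simp only [IsUnder, hmem, exists_mem_image, he']
  refine ⟨e.isClosedMap _ hf.isClosed, ?_, ?_, ?_, ?_⟩
  · refine hf.continuousOn.comp e.symm.continuous.continuousOn ?_
    rintro _ ⟨p, hp, rfl⟩
    simpa
  · intro p hp
    obtain ⟨p, rfl⟩ := e.surjective p
    refine (tendsto_symm_nhdsWithin_image e A (e p)).eventually (p := fun q => f q ≤ f _) ?_
    simpa only [e.symm_apply_apply] using (hf.le_over p ((ho p).1 hp))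
  · intro p hp
    obtain ⟨p, rfl⟩ := e.surjective p
    refine (tendsto_symm_nhdsWithin_image e A (e p)).eventually (p := fun q => f _ ≤ f q) ?_
    simpa only [e.symm_apply_apply] using (hf.under_le p ((hu p).1 hp))
  · rintro _ ⟨p, hp, rfl⟩ h1 h2
    rw [ho] at h1
    rw [hu] at h2
    obtain ⟨U, hU, hi⟩ := hf.inj p hp h1 h2
    refine ⟨e.symm ⁻¹' U, e.symm.continuous.continuousAt.preimage_mem_nhds (by simpa), ?_⟩
    rintro _ ⟨hx, x, hxA, rfl⟩ _ ⟨hy, y, hyA, rfl⟩ hxy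
    simp only [mem_preimage, e.symm_apply_apply] at hx hy hxy
    rw [hi ⟨hx, hxA⟩ ⟨hy, hyA⟩ hxy]

/-- Profiles on sets that meet in transition points without crossing each other can be glued. -/
theorem IsProfile.union {A B : Set Point} {f g : Point → ℝ} (hf : IsProfile A f)
    (hg : IsProfile B g) (hpr : ∀ a ∈ A, ∀ b ∈ B, a.1 = b.1 → a.2.1 = b.2.1 → a = b)
    (hfg : EqOn f g (A ∩ B))
    (hside : ∀ p ∈ A ∩ B,
      ((∀ᶠ q in 𝓝[A] p, f q ≤ f p) ∧ ∀ᶠ q in 𝓝[B] p, g p ≤ g q) ∨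
      ((∀ᶠ q in 𝓝[A] p, f p ≤ f q) ∧ ∀ᶠ q in 𝓝[B] p, g q ≤ g p)) :
    ∃ h, EqOn h g B ∧ IsProfile (A ∪ B) h := by
  classical
  let h : Point → ℝ := B.piecewise g f
  have hB : EqOn h g B := piecewise_eqOn B g f
  have hA : EqOn h f A := fun p hp => by
    by_cases hpB : p ∈ B
    · rw [hB hpB, hfg ⟨hp, hpB⟩]
    · exact piecewise_eq_of_notMem B g f hpB
  have hf' := hf.congr hA.symm
  have hg' := hg.congr hB.symm
  have hside' : ∀ p ∈ A ∩ B,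
      ((∀ᶠ q in 𝓝[A] p, h q ≤ h p) ∧ ∀ᶠ q in 𝓝[B] p, h p ≤ h q) ∨
      ((∀ᶠ q in 𝓝[A] p, h p ≤ h q) ∧ ∀ᶠ q in 𝓝[B] p, h q ≤ h p) := by
    intro p hp
    have c1 : ∀ {P : ℝ → Prop}, (∀ᶠ q in 𝓝[A] p, P (f q)) → ∀ᶠ q in 𝓝[A] p, P (h q) := by
      intro P hP
      filter_upwards [hP, self_mem_nhdsWithin] with q hq hqA
      rwa [hA hqA]
    have c2 : ∀ {P : ℝ → Prop}, (∀ᶠ q in 𝓝[B] p, P (g q)) → ∀ᶠ q in 𝓝[B] p, P (h q) := by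
      intro P hP
      filter_upwards [hP, self_mem_nhdsWithin] with q hq hqA
      rwa [hB hqA]
    rcases hside p hp with ⟨h1, h2⟩ | ⟨h1, h2⟩
    · rw [← hA hp.1] at h1
      rw [← hB hp.2] at h2
      exact Or.inl ⟨c1 (P := (· ≤ h p)) h1, c2 (P := (h p ≤ ·)) h2⟩
    · rw [← hA hp.1] at h1
      rw [← hB hp.2] at h2
      exact Or.inr ⟨c1 (P := (h p ≤ ·)) h1, c2 (P := (· ≤ h p)) h2⟩
  have hover : ∀ p, IsOver (A ∪ B) p → (IsOver A p ∧ p ∉ B) ∨ (IsOver B p ∧ p ∉ A) := by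
    rintro p ⟨hp | hp, q, hq | hq, e1, e2, e3⟩
    · refine Or.inl ⟨⟨hp, q, hq, e1, e2, e3⟩, fun hpB => ?_⟩
      rw [hpr q hq p hpB e1 e2] at e3; exact lt_irrefl _ e3
    · rw [hpr p hp q hq e1.symm e2.symm] at e3; exact absurd e3 (lt_irrefl _)
    · rw [hpr q hq p hp e1 e2] at e3; exact absurd e3 (lt_irrefl _)
    · refine Or.inr ⟨⟨hp, q, hq, e1, e2, e3⟩, fun hpA => ?_⟩
      rw [hpr p hpA q hq e1.symm e2.symm] at e3; exact lt_irrefl _ e3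
  have hunder : ∀ p, IsUnder (A ∪ B) p → (IsUnder A p ∧ p ∉ B) ∨ (IsUnder B p ∧ p ∉ A) := by
    rintro p ⟨hp | hp, q, hq | hq, e1, e2, e3⟩
    · refine Or.inl ⟨⟨hp, q, hq, e1, e2, e3⟩, fun hpB => ?_⟩
      rw [hpr q hq p hpB e1 e2] at e3; exact lt_irrefl _ e3
    · rw [hpr p hp q hq e1.symm e2.symm] at e3; exact absurd e3 (lt_irrefl _)
    · rw [hpr q hq p hp e1 e2] at e3; exact absurd e3 (lt_irrefl _)
    · refine Or.inr ⟨⟨hp, q, hq, e1, e2, e3⟩, fun hpA => ?_⟩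
      rw [hpr p hpA q hq e1.symm e2.symm] at e3; exact lt_irrefl _ e3
  have hempty : ∀ {C : Set Point}, IsClosed C → ∀ {p}, p ∉ C → 𝓝[C] p = ⊥ := fun hC p hp => by
    rwa [← notMem_closure_iff_nhdsWithin_eq_bot, hC.closure_eq]
  refine ⟨h, hB, hf.isClosed.union hg.isClosed,
    hf'.continuousOn.union_of_isClosed hg'.continuousOn hf.isClosed hg.isClosed, ?_, ?_, ?_⟩
  · intro p hp
    rw [nhdsWithin_union]
    rcases hover p hp with ⟨h1, h2⟩ | ⟨h1, h2⟩
    · rw [hempty hg.isClosed h2, sup_bot_eq]; exact hf'.le_over p h1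
    · rw [hempty hf.isClosed h2, bot_sup_eq]; exact hg'.le_over p h1
  · intro p hp
    rw [nhdsWithin_union]
    rcases hunder p hp with ⟨h1, h2⟩ | ⟨h1, h2⟩
    · rw [hempty hg.isClosed h2, sup_bot_eq]; exact hf'.under_le p h1
    · rw [hempty hf.isClosed h2, bot_sup_eq]; exact hg'.under_le p h1
  · intro p hp hno hnu
    have oA : ¬ IsOver A p := fun ⟨h1, q, h2, h3⟩ => hno ⟨Or.inl h1, q, Or.inl h2, h3⟩
    have oB : ¬ IsOver B p := fun ⟨h1, q, h2, h3⟩ => hno ⟨Or.inr h1, q, Or.inr h2, h3⟩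
    have uA : ¬ IsUnder A p := fun ⟨h1, q, h2, h3⟩ => hnu ⟨Or.inl h1, q, Or.inl h2, h3⟩
    have uB : ¬ IsUnder B p := fun ⟨h1, q, h2, h3⟩ => hnu ⟨Or.inr h1, q, Or.inr h2, h3⟩
    by_cases hpA : p ∈ A
    · obtain ⟨U, hU, hUi⟩ := hf'.inj p hpA oA uA
      by_cases hpB : p ∈ B
      · obtain ⟨V, hV, hVi⟩ := hg'.inj p hpB oB uB
        have hp1 : ∀ q ∈ U ∩ A, ∀ r ∈ V ∩ B, h q = h r →
            (h q ≤ h p ∧ h p ≤ h r ∨ h p ≤ h q ∧ h r ≤ h p) → q = r := by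
          intro q hq r hr hqr hle
          have e1 : h q = h p := by rcases hle with ⟨h1, h2⟩ | ⟨h1, h2⟩ <;> linarith
          rw [hUi hq ⟨mem_of_mem_nhds hU, hpA⟩ e1,
            hVi hr ⟨mem_of_mem_nhds hV, hpB⟩ (hqr.symm.trans e1)]
        have main : ∃ W ∈ 𝓝 p, ∀ q ∈ W ∩ A, ∀ r ∈ W ∩ B,
            h q ≤ h p ∧ h p ≤ h r ∨ h p ≤ h q ∧ h r ≤ h p := by
          rcases hside' p ⟨hpA, hpB⟩ with ⟨h1, h2⟩ | ⟨h1, h2⟩ <;>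
          rw [eventually_nhdsWithin_iff] at h1 h2
          · exact ⟨_, inter_mem h1 h2, fun q hq r hr => Or.inl ⟨hq.1.1 hq.2, hr.1.2 hr.2⟩⟩
          · exact ⟨_, inter_mem h1 h2, fun q hq r hr => Or.inr ⟨hq.1.1 hq.2, hr.1.2 hr.2⟩⟩
        obtain ⟨W, hW, hWle⟩ := main
        refine ⟨U ∩ V ∩ W, inter_mem (inter_mem hU hV) hW, ?_⟩
        rintro q ⟨⟨⟨hqU, hqV⟩, hqW⟩, hqA | hqB⟩ r ⟨⟨⟨hrU, hrV⟩, hrW⟩, hrA | hrB⟩ hqr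
        · exact hUi ⟨hqU, hqA⟩ ⟨hrU, hrA⟩ hqr
        · exact hp1 q ⟨hqU, hqA⟩ r ⟨hrV, hrB⟩ hqr (hWle q ⟨hqW, hqA⟩ r ⟨hrW, hrB⟩)
        · exact (hp1 r ⟨hrU, hrA⟩ q ⟨hqV, hqB⟩ hqr.symm (hWle r ⟨hrW, hrA⟩ q ⟨hqW, hqB⟩)).symm
        · exact hVi ⟨hqV, hqB⟩ ⟨hrV, hrB⟩ hqr
      · refine ⟨U ∩ Bᶜ, inter_mem hU (hg.isClosed.isOpen_compl.mem_nhds hpB), hUi.mono ?_⟩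
        rintro q ⟨⟨hqU, hqB⟩, hq⟩
        exact ⟨hqU, hq.resolve_right hqB⟩
    · have hpB : p ∈ B := hp.resolve_left hpA
      obtain ⟨V, hV, hVi⟩ := hg'.inj p hpB oB uB
      refine ⟨V ∩ Aᶜ, inter_mem hV (hf.isClosed.isOpen_compl.mem_nhds hpA), hVi.mono ?_⟩
      rintro q ⟨⟨hqU, hqB⟩, hq⟩
      exact ⟨hqU, hq.resolve_left hqB⟩

theorem isClosed_segment (a b : Point) : IsClosed (segment ℝ a b) := by
  rw [segment_eq_image]
  exact (isCompact_Icc.image (by fun_prop)).isClosed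

theorem mem_sumArcs_iff_abs {p : Point} (hp : p ∈ sumArcs) : p.2.2 = 0 ∧
    ((p.1 ≤ -3 / 4 ∧ -1 ≤ p.1 ∧ |p.2.1| = -3 * p.1 - 2) ∨
      (-1 / 4 ≤ p.1 ∧ p.1 ≤ 1 / 4 ∧ |p.2.1| = 1 / 4) ∨
      (3 / 4 ≤ p.1 ∧ p.1 ≤ 1 ∧ |p.2.1| = 3 * p.1 - 2)) := by
  rcases hp with ((⟨a, b, ha, hb, hab, rfl⟩ | ⟨a, b, ha, hb, hab, rfl⟩) |
    (⟨a, b, ha, hb, hab, rfl⟩ | ⟨a, b, ha, hb, hab, rfl⟩)) |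
    (⟨a, b, ha, hb, hab, rfl⟩ | ⟨a, b, ha, hb, hab, rfl⟩) <;>
  simp only [Prod.fst_add, Prod.snd_add, Prod.smul_fst, Prod.smul_snd, smul_eq_mul] <;>
  obtain rfl : b = 1 - a := by linarith
  · rw [abs_of_nonneg (by linarith)]
    exact ⟨by ring, Or.inl ⟨by linarith, by linarith, by ring⟩⟩
  · rw [abs_of_nonpos (by linarith)]
    exact ⟨by ring, Or.inl ⟨by linarith, by linarith, by ring⟩⟩
  · rw [abs_of_nonneg (by linarith)]
    exact ⟨by ring, Or.inr (Or.inl ⟨by linarith, by linarith, by ring⟩)⟩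
  · rw [abs_of_nonpos (by linarith)]
    exact ⟨by ring, Or.inr (Or.inl ⟨by linarith, by linarith, by ring⟩)⟩
  · rw [abs_of_nonneg (by linarith)]
    exact ⟨by ring, Or.inr (Or.inr ⟨by linarith, by linarith, by ring⟩)⟩
  · rw [abs_of_nonpos (by linarith)]
    exact ⟨by ring, Or.inr (Or.inr ⟨by linarith, by linarith, by ring⟩)⟩

theorem mem_zeroTangle_abs {p : Point} (hp : p ∈ zeroTangle) :
    p.2.2 = 0 ∧ |p.1| ≤ 1 ∧ |p.2.1| = 1 / 2 + |p.1| / 2 := by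
  rcases hp with (⟨a, b, ha, hb, hab, rfl⟩ | ⟨a, b, ha, hb, hab, rfl⟩) |
    (⟨a, b, ha, hb, hab, rfl⟩ | ⟨a, b, ha, hb, hab, rfl⟩) <;>
  simp only [Prod.fst_add, Prod.snd_add, Prod.smul_fst, Prod.smul_snd, smul_eq_mul] <;>
  obtain rfl : b = 1 - a := by linarith
  · rw [abs_of_nonpos (by linarith), abs_of_nonneg (by linarith)]
    exact ⟨by ring, by linarith, by ring⟩
  · rw [abs_of_nonneg (by linarith), abs_of_nonneg (by linarith)]
    exact ⟨by ring, by linarith, by ring⟩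
  · rw [abs_of_nonpos (by linarith), abs_of_nonpos (by linarith)]
    exact ⟨by ring, by linarith, by ring⟩
  · rw [abs_of_nonneg (by linarith), abs_of_nonpos (by linarith)]
    exact ⟨by ring, by linarith, by ring⟩

theorem isClosed_zeroTangle : IsClosed zeroTangle :=
  ((isClosed_segment _ _).union (isClosed_segment _ _)).union
    ((isClosed_segment _ _).union (isClosed_segment _ _))

theorem isClosed_oneTangle : IsClosed oneTangle :=
  ((isClosed_segment _ _).union (isClosed_segment _ _)).union
    ((isClosed_segment _ _).union (isClosed_segment _ _))

theorem isClosed_sumArcs : IsClosed sumArcs :=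
  (((isClosed_segment _ _).union (isClosed_segment _ _)).union
    ((isClosed_segment _ _).union (isClosed_segment _ _))).union
    ((isClosed_segment _ _).union (isClosed_segment _ _))

/-! ### Profiles of planar arcs -/

/-- The function that is `k` along the upper and `-k` along the lower of two strands. -/
noncomputable def signed (k : ℝ → ℝ) (p : Point) : ℝ := if 0 < p.2.1 then k p.1 else -k p.1

/-- A function that decreases locally with constant slope near `x`. -/
def DecreasesAt (k : ℝ → ℝ) (x : ℝ) : Prop := ∃ c, ∃ d < 0, ∀ᶠ y in 𝓝 x, k y = c + d * y

theorem eventually_signed {k : ℝ → ℝ} {p : Point} (hp : p.2.1 ≠ 0) (hk : DecreasesAt k p.1) :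
    ∃ c d, d ≠ 0 ∧ ∀ᶠ q in 𝓝 p, signed k q = c + d * q.1 ∧ 0 < p.2.1 * q.2.1 := by
  obtain ⟨c, d, hd, h⟩ := hk
  have h1 : ∀ᶠ q : Point in 𝓝 p, k q.1 = c + d * q.1 := continuous_fst.continuousAt.eventually h
  have h2 : ∀ᶠ q : Point in 𝓝 p, 0 < p.2.1 * q.2.1 :=
    (Continuous.continuousAt (by fun_prop : Continuous fun q : Point => p.2.1 * q.2.1)).eventually
      (lt_mem_nhds (mul_self_pos.2 hp))
  rcases lt_or_gt_of_ne hp with hneg | hpos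
  · refine ⟨-c, -d, neg_ne_zero.2 hd.ne, ?_⟩
    filter_upwards [h1, h2] with q hq1 hq2
    refine ⟨?_, hq2⟩
    rw [signed, if_neg (by nlinarith), hq1]; ring
  · refine ⟨c, d, hd.ne, ?_⟩
    filter_upwards [h1, h2] with q hq1 hq2
    refine ⟨?_, hq2⟩
    rw [signed, if_pos (by nlinarith), hq1]

theorem not_isOver_of_flat {Z : Set Point} (hz : ∀ p ∈ Z, p.2.2 = 0) (p : Point) :
    ¬ IsOver Z p := by
  rintro ⟨hp, q, hq, -, -, h⟩
  rw [hz p hp, hz q hq] at h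
  exact lt_irrefl _ h

theorem not_isUnder_of_flat {Z : Set Point} (hz : ∀ p ∈ Z, p.2.2 = 0) (p : Point) :
    ¬ IsUnder Z p := by
  rintro ⟨hp, q, hq, -, -, h⟩
  rw [hz p hp, hz q hq] at h
  exact lt_irrefl _ h

theorem isAlternating_of_flat {Z : Set Point} (hz : ∀ p ∈ Z, p.2.2 = 0) : IsAlternating Z :=
  fun _ _ _ _ _ => iff_of_false (not_isOver_of_flat hz _) (not_isUnder_of_flat hz _)

theorem isProfile_signed {Z : Set Point} (hc : IsClosed Z) (hz : ∀ p ∈ Z, p.2.2 = 0)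
    (hy : ∀ p ∈ Z, p.2.1 ≠ 0) (hg : ∀ p ∈ Z, ∀ q ∈ Z, p.1 = q.1 → |p.2.1| = |q.2.1|) {k : ℝ → ℝ}
    (hk : ∀ p ∈ Z, DecreasesAt k p.1) : IsProfile Z (signed k) where
  isClosed := hc
  continuousOn p hp := by
    obtain ⟨c, d, -, h⟩ := eventually_signed (hy p hp) (hk p hp)
    have hc : ContinuousAt (fun q : Point => c + d * q.1) p := by fun_prop
    exact (hc.congr (h.mono fun q hq => hq.1.symm)).continuousWithinAt
  le_over p hp := absurd hp (not_isOver_of_flat hz p)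
  under_le p hp := absurd hp (not_isUnder_of_flat hz p)
  inj p hp _ _ := by
    obtain ⟨c, d, hd, h⟩ := eventually_signed (hy p hp) (hk p hp)
    refine ⟨_, h, ?_⟩
    rintro q ⟨⟨hq1, hq2⟩, hq⟩ r ⟨⟨hr1, hr2⟩, hr⟩ hqr
    rw [hq1, hr1] at hqr
    have e1 : q.1 = r.1 := mul_left_cancel₀ hd (add_left_cancel hqr)
    have e2 : q.2.1 = r.2.1 := by
      rcases abs_eq_abs.1 (hg q hq r hr e1) with h | h
      · exact h
      · rw [h] at hq2; nlinarith
    exact Prod.ext e1 (Prod.ext e2 ((hz q hq).trans (hz r hr).symm))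

/-! ### Profiles of sums -/

/-- A profile on a tangle that meets the sides of the cube in end points only, is `1` at `NE` and
`SW` and larger nearby, and is `-1` at `NW` and `SE` and smaller nearby. -/
structure IsTangleProfile (T : Set Point) (f : Point → ℝ) : Prop where
  isProfile : IsProfile T f
  inSquare : ∀ p ∈ T, |p.1| ≤ 1 ∧ |p.2.1| ≤ 1
  corner : ∀ p ∈ T, |p.1| = 1 ∨ |p.2.1| = 1 → |p.1| = 1 ∧ |p.2.1| = 1 ∧ p.2.2 = 0
  value : ∀ p ∈ T, |p.1| = 1 → f p = p.1 * p.2.1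
  side : ∀ p ∈ T, |p.1| = 1 → ∀ᶠ q in 𝓝[T] p, 1 ≤ p.1 * p.2.1 * f q

theorem boxHomeo_fst (c : ℝ) (p : Point) : (boxHomeo c p).1 = c + p.1 / 4 := rfl

theorem boxHomeo_snd (c : ℝ) (p : Point) : (boxHomeo c p).2.1 = p.2.1 / 4 := rfl

theorem boxHomeo_height (c : ℝ) (p : Point) : (boxHomeo c p).2.2 = p.2.2 / 4 := rfl

/-- A tangle can be inserted into a square that meets the remaining diagram in its vertices. -/
theorem IsTangleProfile.insert {S W : Set Point} {f F : Point → ℝ} (hS : IsTangleProfile S f)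
    {m : ℝ} (hm : 0 < m) (c : ℝ) (hW : IsProfile W F)
    (hmeet : ∀ w ∈ W, |w.1 - c| ≤ 1 / 4 → |w.2.1| ≤ 1 / 4 →
      |w.1 - c| = 1 / 4 ∧ |w.2.1| = 1 / 4 ∧ w.2.2 = 0 ∧ F w = 16 * m * (w.1 - c) * w.2.1 ∧
        ∀ᶠ q in 𝓝[W] w, 16 * (w.1 - c) * w.2.1 * F q ≤ m) :
    ∃ h, EqOn h F W ∧ IsProfile (boxHomeo c '' S ∪ W) h := by
  have hA : IsProfile (boxHomeo c '' S) fun p => m * f ((boxHomeo c).symm p) := by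
    refine (hS.isProfile.image (boxHomeo c) fun p q => ?_).const_mul hm
    simp only [boxHomeo_fst, boxHomeo_snd, boxHomeo_height]
    constructor <;> rintro ⟨h1, h2, h3⟩ <;> refine ⟨?_, ?_, ?_⟩ <;> linarith
  have hbox : ∀ s ∈ S, |(boxHomeo c s).1 - c| = |s.1| / 4 ∧ |(boxHomeo c s).2.1| = |s.2.1| / 4 := by
    intro s _
    rw [boxHomeo_fst, boxHomeo_snd, add_sub_cancel_left, abs_div, abs_div]
    norm_num
  have hpr : ∀ s ∈ S, ∀ b ∈ W, (boxHomeo c s).1 = b.1 → (boxHomeo c s).2.1 = b.2.1 →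
      |s.1| = 1 ∧ |s.2.1| = 1 ∧ s.2.2 = 0 ∧ b.2.2 = 0 := by
    intro s hs b hb e1 e2
    obtain ⟨h1, h2⟩ := hbox s hs
    have h3 := hS.inSquare s hs
    obtain ⟨h4, -, h6, -⟩ := hmeet b hb (by rw [← e1, h1]; linarith) (by rw [← e2, h2]; linarith)
    rw [← e1, h1] at h4
    obtain ⟨h7, h8, h9⟩ := hS.corner s hs (Or.inl (by linarith))
    exact ⟨h7, h8, h9, h6⟩
  have hmt : ∀ p ∈ boxHomeo c '' S ∩ W, ∃ s ∈ S, boxHomeo c s = p ∧ |s.1| = 1 ∧ |s.2.1| = 1 ∧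
      F p = m * (s.1 * s.2.1) ∧ ∀ᶠ q in 𝓝[W] p, s.1 * s.2.1 * F q ≤ m := by
    rintro _ ⟨⟨s, hs, rfl⟩, hw⟩
    obtain ⟨h1, h2, -⟩ := hpr s hs _ hw rfl rfl
    obtain ⟨h3, h4⟩ := hbox s hs
    obtain ⟨-, -, -, h5, h6⟩ := hmeet _ hw (by rw [h3, h1]) (by rw [h4, h2])
    refine ⟨s, hs, rfl, h1, h2, ?_, ?_⟩
    · rw [h5, boxHomeo_fst, boxHomeo_snd]; ring
    · filter_upwards [h6] with q hq
      rw [boxHomeo_fst, boxHomeo_snd] at hq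
      linarith
  refine hA.union hW ?_ ?_ ?_
  · rintro _ ⟨s, hs, rfl⟩ b hb e1 e2
    obtain ⟨-, -, h3, h4⟩ := hpr s hs b hb e1 e2
    exact Prod.ext e1 (Prod.ext e2 (by rw [h4, boxHomeo_height, h3, zero_div]))
  · intro p hp
    obtain ⟨s, hs, rfl, h1, h2, h3, -⟩ := hmt p hp
    simp only [h3, Homeomorph.symm_apply_apply, hS.value s hs h1]
  · intro p hp
    obtain ⟨s, hs, rfl, h1, h2, h3, h4⟩ := hmt p hp
    have h5 : ∀ᶠ q in 𝓝[boxHomeo c '' S] boxHomeo c s,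
        1 ≤ s.1 * s.2.1 * f ((boxHomeo c).symm q) := by
      refine (tendsto_symm_nhdsWithin_image (boxHomeo c) S _).eventually
        (p := fun q => 1 ≤ s.1 * s.2.1 * f q) ?_
      simpa only [Homeomorph.symm_apply_apply] using hS.side s hs h1
    simp only [Homeomorph.symm_apply_apply, hS.value s hs h1]
    rw [h3]
    have h6 : s.1 * s.2.1 = 1 ∨ s.1 * s.2.1 = -1 := by
      rw [← abs_eq zero_le_one, abs_mul, h1, h2, one_mul]
    rcases h6 with h6 | h6 <;> rw [h6] at h4 h5 ⊢
    · refine Or.inr ⟨h5.mono fun q hq => ?_, h4.mono fun q hq => ?_⟩ <;> nlinarith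
    · refine Or.inl ⟨h5.mono fun q hq => ?_, h4.mono fun q hq => ?_⟩ <;> nlinarith

theorem eventually_signed_eq (k : ℝ → ℝ) {p : Point} (hp : p.2.1 ≠ 0) :
    ∀ᶠ q in 𝓝 p, |p.2.1| * signed k q = p.2.1 * k q.1 := by
  have h : ∀ᶠ q : Point in 𝓝 p, 0 < p.2.1 * q.2.1 :=
    (Continuous.continuousAt (by fun_prop : Continuous fun q : Point => p.2.1 * q.2.1)).eventually
      (lt_mem_nhds (mul_self_pos.2 hp))
  filter_upwards [h] with q hq
  rcases lt_or_gt_of_ne hp with hneg | hpos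
  · rw [signed, if_neg (by nlinarith), abs_of_neg hneg]; ring
  · rw [signed, if_pos (by nlinarith), abs_of_pos hpos]

theorem signed_meet {k : ℝ → ℝ} {W : Set Point} {c m : ℝ} {w : Point}
    (hy : |w.2.1| = 1 / 4) (hk : k w.1 = 4 * m * (w.1 - c))
    (hs : ∀ᶠ q in 𝓝[W] w, 4 * (w.1 - c) * k q.1 ≤ m) :
    signed k w = 16 * m * (w.1 - c) * w.2.1 ∧
      ∀ᶠ q in 𝓝[W] w, 16 * (w.1 - c) * w.2.1 * signed k q ≤ m := by
  have h0 : w.2.1 ≠ 0 := fun h => by norm_num [h] at hy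
  have h1 := eventually_signed_eq k h0
  rw [hy] at h1
  have h2 : w.2.1 * w.2.1 = 1 / 16 := by rw [← abs_mul_abs_self, hy]; norm_num
  constructor
  · have := h1.self_of_nhds
    rw [hk] at this
    linarith
  · filter_upwards [hs, h1.filter_mono nhdsWithin_le_nhds] with q hq hq1
    have e : 16 * (w.1 - c) * w.2.1 * signed k q =
        64 * (w.1 - c) * (w.2.1 * w.2.1) * k q.1 := by
      linear_combination 64 * (w.1 - c) * w.2.1 * hq1
    rw [e, h2]
    linarith

theorem nhdsWithin_union_of_notMem {A Z : Set Point} (hA : IsClosed A) {p : Point} (hp : p ∉ A) :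
    𝓝[A ∪ Z] p = 𝓝[Z] p := by
  rw [nhdsWithin_union, notMem_closure_iff_nhdsWithin_eq_bot.1 (by rwa [hA.closure_eq]), bot_sup_eq]

theorem IsTangleProfile.abs_fst_boxHomeo_le {S : Set Point} {f : Point → ℝ}
    (hS : IsTangleProfile S f) {c : ℝ} {p : Point} (hp : p ∈ boxHomeo c '' S) :
    |p.1 - c| ≤ 1 / 4 ∧ |p.2.1| ≤ 1 / 4 := by
  obtain ⟨s, hs, rfl⟩ := hp
  have h := hS.inSquare s hs
  simp only [abs_le] at h ⊢
  rw [boxHomeo_fst, boxHomeo_snd]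
  refine ⟨⟨?_, ?_⟩, ?_, ?_⟩ <;> linarith

/-- A profile along the upper connecting arcs of a sum. -/
noncomputable def sumSlope (x : ℝ) : ℝ :=
  if x < -1 / 2 then -5 - 4 * x else if x < 1 / 2 then -8 * x else 5 - 4 * x

theorem sumSlope_left {x : ℝ} (hx : x < -1 / 2) : sumSlope x = -5 - 4 * x := if_pos hx

theorem sumSlope_middle {x : ℝ} (hx : -1 / 2 ≤ x) (hx' : x < 1 / 2) : sumSlope x = -8 * x := by
  rw [sumSlope, if_neg (not_lt.2 hx), if_pos hx']

theorem sumSlope_right {x : ℝ} (hx : 1 / 2 ≤ x) : sumSlope x = 5 - 4 * x := by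
  rw [sumSlope, if_neg (by linarith), if_neg (not_lt.2 hx)]

theorem decreasesAt_sumSlope {x : ℝ} (h : x ≠ -1 / 2) (h' : x ≠ 1 / 2) :
    DecreasesAt sumSlope x := by
  rcases lt_or_gt_of_ne h with h | h
  · refine ⟨-5, -4, by norm_num, ?_⟩
    filter_upwards [gt_mem_nhds h] with y hy
    rw [sumSlope_left hy]; ring
  rcases lt_or_gt_of_ne h' with h' | h'
  · refine ⟨0, -8, by norm_num, ?_⟩
    filter_upwards [gt_mem_nhds h', lt_mem_nhds h] with y hy hy'
    rw [sumSlope_middle hy'.le hy]; ring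
  · refine ⟨5, -4, by norm_num, ?_⟩
    filter_upwards [lt_mem_nhds h'] with y hy
    rw [sumSlope_right hy.le]; ring

theorem eventually_fst_lt {A : Set Point} {p : Point} {a : ℝ} (h : p.1 < a) :
    ∀ᶠ q in 𝓝[A] p, q.1 < a :=
  (continuous_fst.continuousAt.eventually (gt_mem_nhds h)).filter_mono nhdsWithin_le_nhds

theorem eventually_lt_fst {A : Set Point} {p : Point} {a : ℝ} (h : a < p.1) :
    ∀ᶠ q in 𝓝[A] p, a < q.1 :=
  (continuous_fst.continuousAt.eventually (lt_mem_nhds h)).filter_mono nhdsWithin_le_nhds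

theorem isProfile_sumArcs : IsProfile sumArcs (signed sumSlope) := by
  refine isProfile_signed isClosed_sumArcs (fun p hp => (mem_sumArcs_iff_abs hp).1) ?_ ?_ ?_
  · intro p hp h
    rcases (mem_sumArcs_iff_abs hp).2 with ⟨h1, h2, h3⟩ | ⟨h1, h2, h3⟩ | ⟨h1, h2, h3⟩ <;>
    rw [h, abs_zero] at h3 <;> linarith
  · intro p hp q hq h
    rcases (mem_sumArcs_iff_abs hp).2 with ⟨h1, h2, h3⟩ | ⟨h1, h2, h3⟩ | ⟨h1, h2, h3⟩ <;>
    rcases (mem_sumArcs_iff_abs hq).2 with ⟨h4, h5, h6⟩ | ⟨h4, h5, h6⟩ | ⟨h4, h5, h6⟩ <;>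
    linarith
  · intro p hp
    rcases (mem_sumArcs_iff_abs hp).2 with ⟨h1, h2, h3⟩ | ⟨h1, h2, h3⟩ | ⟨h1, h2, h3⟩ <;>
    apply decreasesAt_sumSlope <;> intro h <;> linarith

theorem sumArcs_meet_left {w : Point} (hw : w ∈ sumArcs) (h : |w.1 - -1 / 2| ≤ 1 / 4) :
    |w.1 - -1 / 2| = 1 / 4 ∧ |w.2.1| = 1 / 4 ∧ w.2.2 = 0 ∧
      signed sumSlope w = 16 * 2 * (w.1 - -1 / 2) * w.2.1 ∧
        ∀ᶠ q in 𝓝[sumArcs] w, 16 * (w.1 - -1 / 2) * w.2.1 * signed sumSlope q ≤ 2 := by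
  obtain ⟨h1, h2⟩ := abs_le.1 h
  obtain ⟨hz, hw'⟩ := mem_sumArcs_iff_abs hw
  rcases hw' with ⟨h3, h4, h5⟩ | ⟨h3, h4, h5⟩ | ⟨h3, h4, h5⟩
  · have e : w.1 = -3 / 4 := by linarith
    refine ⟨by rw [e, abs_of_neg] <;> norm_num, by rw [h5, e]; norm_num, hz, ?_⟩
    apply signed_meet (by rw [h5, e]; norm_num)
    · rw [e, sumSlope_left (by norm_num)]; norm_num
    · filter_upwards [eventually_fst_lt (by rw [e]; norm_num : w.1 < -1 / 2), self_mem_nhdsWithin]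
        with q hq hqZ
      rw [sumSlope_left hq, e]
      rcases (mem_sumArcs_iff_abs hqZ).2 with ⟨h3, h4, h5⟩ | ⟨h3, h4, h5⟩ | ⟨h3, h4, h5⟩ <;> linarith
  · have e : w.1 = -1 / 4 := by linarith
    refine ⟨by rw [e, abs_of_pos] <;> norm_num, h5, hz, ?_⟩
    apply signed_meet h5
    · rw [e, sumSlope_middle (by norm_num) (by norm_num)]; norm_num
    · filter_upwards [eventually_fst_lt (by rw [e]; norm_num : w.1 < 1 / 2), self_mem_nhdsWithin,
        eventually_lt_fst (by rw [e]; norm_num : -1 / 2 < w.1)] with q hq hqZ hq'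
      rw [sumSlope_middle hq'.le hq, e]
      rcases (mem_sumArcs_iff_abs hqZ).2 with ⟨h3, h4, h5⟩ | ⟨h3, h4, h5⟩ | ⟨h3, h4, h5⟩ <;> linarith
  · linarith

theorem sumArcs_meet_right {w : Point} (hw : w ∈ sumArcs) (h : |w.1 - 1 / 2| ≤ 1 / 4) :
    |w.1 - 1 / 2| = 1 / 4 ∧ |w.2.1| = 1 / 4 ∧ w.2.2 = 0 ∧
      signed sumSlope w = 16 * 2 * (w.1 - 1 / 2) * w.2.1 ∧
        ∀ᶠ q in 𝓝[sumArcs] w, 16 * (w.1 - 1 / 2) * w.2.1 * signed sumSlope q ≤ 2 := by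
  obtain ⟨h1, h2⟩ := abs_le.1 h
  obtain ⟨hz, hw'⟩ := mem_sumArcs_iff_abs hw
  rcases hw' with ⟨h3, h4, h5⟩ | ⟨h3, h4, h5⟩ | ⟨h3, h4, h5⟩
  · linarith
  · have e : w.1 = 1 / 4 := by linarith
    refine ⟨by rw [e, abs_of_neg] <;> norm_num, h5, hz, ?_⟩
    apply signed_meet h5
    · rw [e, sumSlope_middle (by norm_num) (by norm_num)]; norm_num
    · filter_upwards [eventually_fst_lt (by rw [e]; norm_num : w.1 < 1 / 2), self_mem_nhdsWithin,
        eventually_lt_fst (by rw [e]; norm_num : -1 / 2 < w.1)] with q hq hqZ hq'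
      rw [sumSlope_middle hq'.le hq, e]
      rcases (mem_sumArcs_iff_abs hqZ).2 with ⟨h3, h4, h5⟩ | ⟨h3, h4, h5⟩ | ⟨h3, h4, h5⟩ <;> linarith
  · have e : w.1 = 3 / 4 := by linarith
    refine ⟨by rw [e, abs_of_pos] <;> norm_num, by rw [h5, e]; norm_num, hz, ?_⟩
    apply signed_meet (by rw [h5, e]; norm_num)
    · rw [e, sumSlope_right (by norm_num)]; norm_num
    · filter_upwards [eventually_lt_fst (by rw [e]; norm_num : 1 / 2 < w.1), self_mem_nhdsWithin]
        with q hq hqZ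
      rw [sumSlope_right hq.le, e]
      rcases (mem_sumArcs_iff_abs hqZ).2 with ⟨h3, h4, h5⟩ | ⟨h3, h4, h5⟩ | ⟨h3, h4, h5⟩ <;> linarith

theorem sumArcs_corner {w : Point} (hw : w ∈ sumArcs) (h : |w.1| = 1 ∨ |w.2.1| = 1) :
    |w.1| = 1 ∧ |w.2.1| = 1 ∧ w.2.2 = 0 ∧ signed sumSlope w = w.1 * w.2.1 ∧
      ∀ᶠ q in 𝓝[sumArcs] w, 1 ≤ w.1 * w.2.1 * signed sumSlope q := by
  obtain ⟨hz, hw'⟩ := mem_sumArcs_iff_abs hw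
  have main : |w.2.1| = 1 → (w.1 = 1 ∨ w.1 = -1) → |w.1| = 1 ∧ |w.2.1| = 1 ∧ w.2.2 = 0 ∧
      signed sumSlope w = w.1 * w.2.1 ∧
      ∀ᶠ q in 𝓝[sumArcs] w, 1 ≤ w.1 * w.2.1 * signed sumSlope q := by
    intro hy hx
    have h0 : w.2.1 ≠ 0 := fun h => by norm_num [h] at hy
    have h1 := eventually_signed_eq sumSlope h0
    simp only [hy, one_mul] at h1
    have h2 : w.2.1 * w.2.1 = 1 := by rw [← abs_mul_abs_self, hy]; norm_num
    refine ⟨(abs_eq zero_le_one).2 hx, hy, hz, ?_, ?_⟩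
    · rw [h1.self_of_nhds, mul_comm]
      rcases hx with hx | hx
      · rw [hx, sumSlope_right (by norm_num)]; norm_num
      · rw [hx, sumSlope_left (by norm_num)]; norm_num
    · have h3 : ∀ᶠ q in 𝓝[sumArcs] w, 1 ≤ w.1 * sumSlope q.1 := by
        rcases hx with hx | hx
        · filter_upwards [eventually_lt_fst (by rw [hx]; norm_num : 1 / 2 < w.1),
            self_mem_nhdsWithin] with q hq hqZ
          rw [sumSlope_right hq.le, hx]
          rcases (mem_sumArcs_iff_abs hqZ).2 with ⟨h3, h4, h5⟩ | ⟨h3, h4, h5⟩ | ⟨h3, h4, h5⟩ <;>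
          linarith
        · filter_upwards [eventually_fst_lt (by rw [hx]; norm_num : w.1 < -1 / 2),
            self_mem_nhdsWithin] with q hq hqZ
          rw [sumSlope_left hq, hx]
          rcases (mem_sumArcs_iff_abs hqZ).2 with ⟨h3, h4, h5⟩ | ⟨h3, h4, h5⟩ | ⟨h3, h4, h5⟩ <;>
          linarith
      filter_upwards [h3, h1.filter_mono nhdsWithin_le_nhds] with q hq hq1
      rw [hq1]
      calc 1 ≤ w.1 * sumSlope q.1 * 1 := by rwa [mul_one]
        _ = _ := by rw [← h2]; ring
  rcases hw' with ⟨h3, h4, h5⟩ | ⟨h3, h4, h5⟩ | ⟨h3, h4, h5⟩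
  · have e : w.1 = -1 := by
      rcases h with h | h
      · rw [abs_of_neg (by linarith)] at h; linarith
      · linarith
    exact main (by rw [h5, e]; norm_num) (Or.inr e)
  · exfalso
    rcases h with h | h
    · rcases (abs_eq zero_le_one).1 h with h | h <;> linarith
    · linarith
  · have e : w.1 = 1 := by
      rcases h with h | h
      · rw [abs_of_pos (by linarith)] at h; linarith
      · linarith
    exact main (by rw [h5, e]; norm_num) (Or.inl e)

theorem sum_eq_union_arcs (S T : Set Point) :
    sum S T = boxHomeo (1 / 2) '' T ∪ (boxHomeo (-1 / 2) '' S ∪ sumArcs) := by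
  rw [sum_eq_union]; ext; simp only [mem_union]; tauto

theorem IsTangleProfile.sum {S T : Set Point} {f g : Point → ℝ} (hS : IsTangleProfile S f)
    (hT : IsTangleProfile T g) : ∃ h, IsTangleProfile (sum S T) h := by
  rw [sum_eq_union_arcs]
  have hSc : IsClosed (boxHomeo (-1 / 2) '' S) := (boxHomeo _).isClosedMap _ hS.isProfile.isClosed
  have hTc : IsClosed (boxHomeo (1 / 2) '' T) := (boxHomeo _).isClosedMap _ hT.isProfile.isClosed
  obtain ⟨F, hF, hFp⟩ := hS.insert two_pos (-1 / 2) isProfile_sumArcs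
    fun w hw h _ => sumArcs_meet_left hw h
  obtain ⟨h, hh, hp⟩ := hT.insert two_pos (1 / 2) hFp fun w hw hw1 _ => by
    have hwS : w ∉ boxHomeo (-1 / 2) '' S := fun hw' => by
      have := (abs_le.1 (hS.abs_fst_boxHomeo_le hw').1).2
      linarith [(abs_le.1 hw1).1]
    have hwZ := hw.resolve_left hwS
    obtain ⟨h1, h2, h3, h4, h5⟩ := sumArcs_meet_right hwZ hw1
    refine ⟨h1, h2, h3, (hF hwZ).trans h4, ?_⟩
    rw [nhdsWithin_union_of_notMem hSc hwS]
    filter_upwards [h5, self_mem_nhdsWithin] with q hq hqZ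
    rwa [hF hqZ]
  have hcor : ∀ p ∈ boxHomeo (1 / 2) '' T ∪ (boxHomeo (-1 / 2) '' S ∪ sumArcs),
      |p.1| = 1 ∨ |p.2.1| = 1 →
      p ∉ boxHomeo (1 / 2) '' T ∧ p ∉ boxHomeo (-1 / 2) '' S ∧ p ∈ sumArcs := by
    intro p hp hc
    have h1 : p ∉ boxHomeo (1 / 2) '' T := fun h1 => by
      obtain ⟨h2, h3⟩ := hT.abs_fst_boxHomeo_le h1
      rw [abs_le] at h2
      rcases hc with hc | hc
      · rcases (abs_eq zero_le_one).1 hc with h | h <;> linarith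
      · linarith
    have h2 : p ∉ boxHomeo (-1 / 2) '' S := fun h1 => by
      obtain ⟨h2, h3⟩ := hS.abs_fst_boxHomeo_le h1
      rw [abs_le] at h2
      rcases hc with hc | hc
      · rcases (abs_eq zero_le_one).1 hc with h | h <;> linarith
      · linarith
    exact ⟨h1, h2, (hp.resolve_left h1).resolve_left h2⟩
  refine ⟨h, hp, ?_, ?_, ?_, ?_⟩
  · rintro p (hp | hp | hp)
    · obtain ⟨h2, h3⟩ := hT.abs_fst_boxHomeo_le hp
      rw [abs_le] at h2 ⊢
      exact ⟨⟨by linarith, by linarith⟩, by linarith⟩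
    · obtain ⟨h2, h3⟩ := hS.abs_fst_boxHomeo_le hp
      rw [abs_le] at h2 ⊢
      exact ⟨⟨by linarith, by linarith⟩, by linarith⟩
    · have := (norm_le_one_iff p).1 (mem_sumArcs hp).1
      exact ⟨this.1, this.2.1⟩
  · intro p hp hc
    obtain ⟨h1, h2, h3, -⟩ := sumArcs_corner (hcor p hp hc).2.2 hc
    exact ⟨h1, h2, h3⟩
  · intro p hp hc
    obtain ⟨-, -, hZ⟩ := hcor p hp (Or.inl hc)
    rw [hh (Or.inr hZ), hF hZ]
    exact (sumArcs_corner hZ (Or.inl hc)).2.2.2.1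
  · intro p hp hc
    obtain ⟨h1, h2, hZ⟩ := hcor p hp (Or.inl hc)
    rw [nhdsWithin_union_of_notMem hTc h1, nhdsWithin_union_of_notMem hSc h2]
    filter_upwards [(sumArcs_corner hZ (Or.inl hc)).2.2.2.2, self_mem_nhdsWithin] with q hq hqZ
    rwa [hh (Or.inr hqZ), hF hqZ]

theorem IsTangleProfile.inv {T : Set Point} {f : Point → ℝ} (hT : IsTangleProfile T f) :
    ∃ h, IsTangleProfile (inv T) h := by
  have e : SolidTorusLinks.inv T = invHomeo '' T := rfl
  have es (p : Point) : invHomeo.symm (invHomeo p) = p := invHomeo.symm_apply_apply p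
  have e1 (p : Point) : (invHomeo p).1 = -p.2.1 := rfl
  have e2 (p : Point) : (invHomeo p).2.1 = -p.1 := rfl
  have e3 (p : Point) : (invHomeo p).2.2 = p.2.2 := rfl
  rw [e]
  refine ⟨fun p => f (invHomeo.symm p), hT.isProfile.image invHomeo fun p q => ?_, ?_, ?_, ?_, ?_⟩
  · rw [e1, e1, e2, e2, e3, e3, neg_inj, neg_inj]; tauto
  · rintro _ ⟨p, hp, rfl⟩
    rw [e1, e2, abs_neg, abs_neg]
    exact (hT.inSquare p hp).symm
  · rintro _ ⟨p, hp, rfl⟩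
    rw [e1, e2, e3, abs_neg, abs_neg]
    intro h
    obtain ⟨h1, h2, h3⟩ := hT.corner p hp h.symm
    exact ⟨h2, h1, h3⟩
  · rintro _ ⟨p, hp, rfl⟩
    rw [e1, e2, es, abs_neg]
    intro h
    rw [hT.value p hp (hT.corner p hp (Or.inr h)).1]; ring
  · rintro _ ⟨p, hp, rfl⟩
    rw [e1, e2, abs_neg]
    intro h
    have h1 := hT.side p hp (hT.corner p hp (Or.inr h)).1
    refine (tendsto_symm_nhdsWithin_image invHomeo T _).eventually
      (p := fun q => 1 ≤ -p.2.1 * -p.1 * f q) ?_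
    rw [es]
    filter_upwards [h1] with q hq
    linarith

/-! ### Positive tangles are alternating -/

/-- A profile along the upper connecting arcs and the upper arc of `[0]` in a sum `[0] + T`. -/
noncomputable def zeroSumSlope (x : ℝ) : ℝ := if x < 1 / 2 then -3 / 4 - x else 7 / 4 - x

theorem zeroSumSlope_left {x : ℝ} (hx : x < 1 / 2) : zeroSumSlope x = -3 / 4 - x := if_pos hx

theorem zeroSumSlope_right {x : ℝ} (hx : 1 / 2 ≤ x) : zeroSumSlope x = 7 / 4 - x :=
  if_neg (not_lt.2 hx)

theorem decreasesAt_zeroSumSlope {x : ℝ} (h' : x ≠ 1 / 2) : DecreasesAt zeroSumSlope x := by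
  rcases lt_or_gt_of_ne h' with h' | h'
  · refine ⟨-3 / 4, -1, by norm_num, ?_⟩
    filter_upwards [gt_mem_nhds h'] with y hy
    rw [zeroSumSlope_left hy]; ring
  · refine ⟨7 / 4, -1, by norm_num, ?_⟩
    filter_upwards [lt_mem_nhds h'] with y hy
    rw [zeroSumSlope_right hy.le]; ring

theorem mem_zeroSum {p : Point} (hp : p ∈ boxHomeo (-1 / 2) '' zeroTangle ∪ sumArcs) :
    p.2.2 = 0 ∧
      ((p.1 ≤ -3 / 4 ∧ -1 ≤ p.1 ∧ |p.2.1| = -3 * p.1 - 2) ∨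
      (-3 / 4 ≤ p.1 ∧ p.1 ≤ -1 / 4 ∧ |p.2.1| = 1 / 8 + |p.1 + 1 / 2| / 2) ∨
      (-1 / 4 ≤ p.1 ∧ p.1 ≤ 1 / 4 ∧ |p.2.1| = 1 / 4) ∨
      (3 / 4 ≤ p.1 ∧ p.1 ≤ 1 ∧ |p.2.1| = 3 * p.1 - 2)) := by
  rcases hp with ⟨s, hs, rfl⟩ | hp
  · obtain ⟨h1, h2, h3⟩ := mem_zeroTangle_abs hs
    rw [boxHomeo_fst, boxHomeo_snd, boxHomeo_height]
    obtain ⟨h4, h5⟩ := abs_le.1 h2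
    refine ⟨by rw [h1, zero_div], Or.inr (Or.inl ⟨by linarith, by linarith, ?_⟩)⟩
    rw [abs_div, h3, show -1 / 2 + s.1 / 4 + 1 / 2 = s.1 / 4 by ring, abs_div]
    norm_num; ring
  · obtain ⟨h1, h2 | h2 | h2⟩ := mem_sumArcs_iff_abs hp
    · exact ⟨h1, Or.inl h2⟩
    · exact ⟨h1, Or.inr (Or.inr (Or.inl h2))⟩
    · exact ⟨h1, Or.inr (Or.inr (Or.inr h2))⟩

theorem isProfile_zeroSum :
    IsProfile (boxHomeo (-1 / 2) '' zeroTangle ∪ sumArcs) (signed zeroSumSlope) := by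
  refine isProfile_signed (((boxHomeo _).isClosedMap _ isClosed_zeroTangle).union isClosed_sumArcs)
    (fun p hp => (mem_zeroSum hp).1) ?_ ?_ ?_
  · intro p hp h
    rcases (mem_zeroSum hp).2 with ⟨h1, h2, h3⟩ | ⟨h1, h2, h3⟩ | ⟨h1, h2, h3⟩ | ⟨h1, h2, h3⟩ <;>
    rw [h, abs_zero] at h3
    · linarith
    · linarith [abs_nonneg (p.1 + 1 / 2)]
    · linarith
    · linarith
  · have key : ∀ {x y : ℝ}, -3 / 4 ≤ x → x ≤ -1 / 4 → y = 1 / 8 + |x + 1 / 2| / 2 →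
        (x ≤ -3 / 4 ∨ -1 / 4 ≤ x → y = 1 / 4) := by
      rintro x y h1 h2 rfl (h | h)
      · rw [show x = -3 / 4 by linarith, abs_of_neg] <;> norm_num
      · rw [show x = -1 / 4 by linarith, abs_of_pos] <;> norm_num
    intro p hp q hq h
    rcases (mem_zeroSum hp).2 with ⟨h1, h2, h3⟩ | ⟨h1, h2, h3⟩ | ⟨h1, h2, h3⟩ | ⟨h1, h2, h3⟩ <;>
    rcases (mem_zeroSum hq).2 with ⟨h4, h5, h6⟩ | ⟨h4, h5, h6⟩ | ⟨h4, h5, h6⟩ | ⟨h4, h5, h6⟩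
    · linarith
    · linarith [key h4 h5 h6 (Or.inl (by linarith))]
    · linarith
    · linarith
    · linarith [key h1 h2 h3 (Or.inl (by linarith))]
    · rw [h3, h6, h]
    · linarith [key h1 h2 h3 (Or.inr (by linarith))]
    · linarith
    · linarith
    · linarith [key h4 h5 h6 (Or.inr (by linarith))]
    · linarith
    · linarith
    · linarith
    · linarith
    · linarith
    · linarith
  · intro p hp
    rcases (mem_zeroSum hp).2 with ⟨h1, h2, h3⟩ | ⟨h1, h2, h3⟩ | ⟨h1, h2, h3⟩ | ⟨h1, h2, h3⟩ <;>
    apply decreasesAt_zeroSumSlope <;> intro h <;> linarith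

theorem IsTangleProfile.isAlternating_zero_add {T : Set Point} {f : Point → ℝ}
    (hT : IsTangleProfile T f) : IsAlternating (SolidTorusLinks.sum zeroTangle T) := by
  rw [sum_eq_union_arcs]
  obtain ⟨h, -, hp⟩ := hT.insert one_pos (1 / 2) isProfile_zeroSum fun w hw hw1 _ => by
    obtain ⟨h1, h2⟩ := abs_le.1 hw1
    obtain ⟨hz, hw'⟩ := mem_zeroSum hw
    rcases hw' with ⟨h3, h4, h5⟩ | ⟨h3, h4, h5⟩ | ⟨h3, h4, h5⟩ | ⟨h3, h4, h5⟩
    · linarith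
    · linarith
    · have e : w.1 = 1 / 4 := by linarith
      refine ⟨by rw [e, abs_of_neg] <;> norm_num, h5, hz, ?_⟩
      apply signed_meet h5
      · rw [e, zeroSumSlope_left (by norm_num)]; norm_num
      · filter_upwards [eventually_fst_lt (by rw [e]; norm_num : w.1 < 1 / 2), self_mem_nhdsWithin]
          with q hq hqZ
        rw [zeroSumSlope_left hq, e]
        rcases (mem_zeroSum hqZ).2 with ⟨h3, h4, h5⟩ | ⟨h3, h4, h5⟩ | ⟨h3, h4, h5⟩ | ⟨h3, h4, h5⟩ <;>
        linarith
    · have e : w.1 = 3 / 4 := by linarith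
      refine ⟨by rw [e, abs_of_pos] <;> norm_num, by rw [h5, e]; norm_num, hz, ?_⟩
      apply signed_meet (by rw [h5, e]; norm_num)
      · rw [e, zeroSumSlope_right (by norm_num)]; norm_num
      · filter_upwards [eventually_lt_fst (by rw [e]; norm_num : 1 / 2 < w.1), self_mem_nhdsWithin]
          with q hq hqZ
        rw [zeroSumSlope_right hq.le, e]
        rcases (mem_zeroSum hqZ).2 with ⟨h3, h4, h5⟩ | ⟨h3, h4, h5⟩ | ⟨h3, h4, h5⟩ | ⟨h3, h4, h5⟩ <;>
        linarith
  exact hp.isAlternating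

/-- The straightened strands of `[1]`: the upper one for `e = 1`, the lower one for `e = -1`. -/
def strand (e : ℝ) : Set Point := {p | |p.1| ≤ 1 ∧ p.2.1 = e * p.1 ∧ p.2.2 = e * (1 - |p.1|) / 2}

theorem isClosed_strand (e : ℝ) : IsClosed (strand e) :=
  have h1 : IsClosed {p : Point | |p.1| ≤ 1} := isClosed_le (by fun_prop) continuous_const
  have h2 : IsClosed {p : Point | p.2.1 = e * p.1} := isClosed_eq (by fun_prop) (by fun_prop)
  have h3 : IsClosed {p : Point | p.2.2 = e * (1 - |p.1|) / 2} :=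
    isClosed_eq (by fun_prop) (by fun_prop)
  h1.inter (h2.inter h3)

theorem exists_mem_strand {p : Point} (hp : p ∈ oneTangle) :
    ∃ e, (e = 1 ∨ e = -1) ∧ p ∈ strand e := by
  rcases hp with (⟨a, b, ha, hb, hab, rfl⟩ | ⟨a, b, ha, hb, hab, rfl⟩) |
    (⟨a, b, ha, hb, hab, rfl⟩ | ⟨a, b, ha, hb, hab, rfl⟩) <;>
  simp only [strand, mem_ofPred_eq, Prod.fst_add, Prod.snd_add, Prod.smul_fst, Prod.smul_snd,
    smul_eq_mul] <;>
  obtain rfl : b = 1 - a := by linarith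
  · refine ⟨1, Or.inl rfl, ?_⟩
    rw [abs_of_nonpos (by linarith)]
    exact ⟨by linarith, by ring, by ring⟩
  · refine ⟨1, Or.inl rfl, ?_⟩
    rw [abs_of_nonneg (by linarith)]
    exact ⟨by linarith, by ring, by ring⟩
  · refine ⟨-1, Or.inr rfl, ?_⟩
    rw [abs_of_nonpos (by linarith)]
    exact ⟨by linarith, by ring, by ring⟩
  · refine ⟨-1, Or.inr rfl, ?_⟩
    rw [abs_of_nonneg (by linarith)]
    exact ⟨by linarith, by ring, by ring⟩

theorem notMem_strand_neg {e : ℝ} (he : e = 1 ∨ e = -1) {p : Point} (hp : p ∈ strand e) :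
    p ∉ strand (-e) := by
  rintro ⟨-, h1, h2⟩
  obtain ⟨-, h3, h4⟩ := hp
  have h : p.1 = 0 := by rcases he with rfl | rfl <;> linarith
  rw [h, abs_zero] at h2 h4
  rcases he with rfl | rfl <;> linarith

theorem eventually_mem_strand {e : ℝ} (he : e = 1 ∨ e = -1) {p : Point} (hp : p ∈ strand e) :
    ∀ᶠ q in 𝓝[oneTangle] p, q ∈ strand e := by
  have h := (isClosed_strand (-e)).isOpen_compl.mem_nhds (notMem_strand_neg he hp)
  filter_upwards [mem_nhdsWithin_of_mem_nhds h, self_mem_nhdsWithin] with q hq hq1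
  obtain ⟨e', he', hqe⟩ := exists_mem_strand hq1
  have : e' = e ∨ e' = -e := by rcases he with rfl | rfl <;> rcases he' with rfl | rfl <;> norm_num
  rcases this with rfl | rfl
  · exact hqe
  · exact absurd hqe hq

/-- A profile on the tangle `[1]`. -/
noncomputable def oneProfile (p : Point) : ℝ :=
  if 0 < p.1 * p.2.1 ∨ 0 < p.2.2 then 1 + p.2.2 else -1 + p.2.2

theorem oneProfile_strand {e : ℝ} (he : e = 1 ∨ e = -1) {p : Point} (hp : p ∈ strand e) :
    oneProfile p = e + p.2.2 := by
  obtain ⟨h1, h2, h3⟩ := hp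
  rcases he with rfl | rfl
  · refine if_pos ?_
    rcases eq_or_ne p.1 0 with h | h
    · right; rw [h3, h, abs_zero]; norm_num
    · left; rw [h2, one_mul]; exact mul_self_pos.2 h
  · refine if_neg ?_
    rintro (h | h)
    · rw [h2] at h; nlinarith [mul_self_nonneg p.1]
    · linarith

theorem fst_eq_zero_of_over_one {p : Point} (hp : IsOver oneTangle p) : p.1 = 0 ∧ p ∈ strand 1 := by
  obtain ⟨hp, q, hq, e1, e2, e3⟩ := hp
  obtain ⟨e, he, hpe⟩ := exists_mem_strand hp
  obtain ⟨e', he', hqe⟩ := exists_mem_strand hq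
  obtain ⟨h1, h2, h3⟩ := id hpe
  obtain ⟨h4, h5, h6⟩ := hqe
  rw [e1] at h4 h5 h6
  rcases he with rfl | rfl <;> rcases he' with rfl | rfl
  · linarith
  · exact ⟨by linarith, hpe⟩
  · linarith
  · linarith

theorem fst_eq_zero_of_under_one {p : Point} (hp : IsUnder oneTangle p) :
    p.1 = 0 ∧ p ∈ strand (-1) := by
  obtain ⟨hp, q, hq, e1, e2, e3⟩ := hp
  obtain ⟨e, he, hpe⟩ := exists_mem_strand hp
  obtain ⟨e', he', hqe⟩ := exists_mem_strand hq
  obtain ⟨h1, h2, h3⟩ := id hpe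
  obtain ⟨h4, h5, h6⟩ := hqe
  rw [e1] at h4 h5 h6
  rcases he with rfl | rfl <;> rcases he' with rfl | rfl
  · linarith
  · linarith
  · exact ⟨by linarith, hpe⟩
  · linarith

theorem mem_oneTangle_top : ((0, 0, 1 / 2) : Point) ∈ oneTangle :=
  Or.inl (Or.inl (right_mem_segment ℝ _ _))

theorem mem_oneTangle_bot : ((0, 0, -1 / 2) : Point) ∈ oneTangle :=
  Or.inr (Or.inl (right_mem_segment ℝ _ _))

theorem isProfile_oneTangle : IsProfile oneTangle oneProfile where
  isClosed := isClosed_oneTangle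
  continuousOn p hp := by
    obtain ⟨e, he, hpe⟩ := exists_mem_strand hp
    have hc : ContinuousWithinAt (fun q : Point => e + q.2.2) oneTangle p := by fun_prop
    exact hc.congr_of_eventuallyEq
      ((eventually_mem_strand he hpe).mono fun q hq => oneProfile_strand he hq)
      (oneProfile_strand he hpe)
  le_over p hp := by
    obtain ⟨h0, hpe⟩ := fst_eq_zero_of_over_one hp
    filter_upwards [eventually_mem_strand (Or.inl rfl) hpe] with q hq
    rw [oneProfile_strand (Or.inl rfl) hpe, oneProfile_strand (Or.inl rfl) hq, hpe.2.2, hq.2.2, h0,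
      abs_zero]
    linarith [abs_nonneg q.1]
  under_le p hp := by
    obtain ⟨h0, hpe⟩ := fst_eq_zero_of_under_one hp
    filter_upwards [eventually_mem_strand (Or.inr rfl) hpe] with q hq
    rw [oneProfile_strand (Or.inr rfl) hpe, oneProfile_strand (Or.inr rfl) hq, hpe.2.2, hq.2.2, h0,
      abs_zero]
    linarith [abs_nonneg q.1]
  inj p hp ho hu := by
    obtain ⟨e, he, hpe⟩ := exists_mem_strand hp
    have h0 : p.1 ≠ 0 := by
      intro h
      obtain ⟨-, h2, h3⟩ := hpe
      rw [h, mul_zero] at h2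
      rw [h, abs_zero] at h3
      rcases he with rfl | rfl
      · exact ho ⟨hp, _, mem_oneTangle_bot, h.symm, h2.symm, by rw [h3]; norm_num⟩
      · exact hu ⟨hp, _, mem_oneTangle_top, h.symm, h2.symm, by rw [h3]; norm_num⟩
    have h1 : ∀ᶠ q : Point in 𝓝 p, 0 < p.1 * q.1 :=
      (Continuous.continuousAt (by fun_prop : Continuous fun q : Point => p.1 * q.1)).eventually
        (lt_mem_nhds (mul_self_pos.2 h0))
    refine ⟨_, inter_mem h1 (eventually_nhdsWithin_iff.1 (eventually_mem_strand he hpe)), ?_⟩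
    rintro q ⟨⟨hq1, hq2⟩, hq⟩ r ⟨⟨hr1, hr2⟩, hr⟩ hqr
    have hqs : q ∈ strand e := hq2 hq
    have hrs : r ∈ strand e := hr2 hr
    rw [oneProfile_strand he hqs, oneProfile_strand he hrs] at hqr
    have e3 := add_left_cancel hqr
    have e1 : |q.1| = |r.1| := by
      have := e3
      rw [hqs.2.2, hrs.2.2] at this
      rcases he with rfl | rfl <;> linarith
    have e2 : q.1 = r.1 := by
      rcases abs_eq_abs.1 e1 with h | h
      · exact h
      · simp only [mem_ofPred_eq] at hq1 hr1
        rw [h] at hq1; nlinarith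
    exact Prod.ext e2 (Prod.ext (by rw [hqs.2.1, hrs.2.1, e2]) e3)

theorem isTangleProfile_oneTangle : IsTangleProfile oneTangle oneProfile where
  isProfile := isProfile_oneTangle
  inSquare p hp := by
    have := (norm_le_one_iff p).1 (norm_le_of_mem_oneTangle p hp)
    exact ⟨this.1, this.2.1⟩
  corner p hp h := by
    obtain ⟨e, he, h1, h2, h3⟩ := exists_mem_strand hp
    have h4 : |p.2.1| = |p.1| := by
      rw [h2, abs_mul, (abs_eq zero_le_one).2 he, one_mul]
    rw [h4, or_self] at h
    refine ⟨h, h4.trans h, ?_⟩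
    rw [h3, h]; ring
  value p hp h := by
    obtain ⟨e, he, hpe⟩ := exists_mem_strand hp
    rw [oneProfile_strand he hpe, hpe.2.2, h, hpe.2.1]
    have : p.1 * p.1 = 1 := by rw [← abs_mul_abs_self, h, one_mul]
    linear_combination -e * this
  side p hp h := by
    obtain ⟨e, he, hpe⟩ := exists_mem_strand hp
    have h1 : p.1 * p.1 = 1 := by rw [← abs_mul_abs_self, h, one_mul]
    have h2 : p.1 * p.2.1 = e := by rw [hpe.2.1]; linear_combination e * h1
    filter_upwards [eventually_mem_strand he hpe] with q hq
    rw [oneProfile_strand he hq, h2, hq.2.2]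
    rcases he with rfl | rfl <;> linarith [hq.1]

theorem exists_isTangleProfile_natTangle (n : ℕ) : ∃ f, IsTangleProfile (natTangle (n + 1)) f := by
  induction n with
  | zero => exact ⟨_, isTangleProfile_oneTangle⟩
  | succ n ih =>
    obtain ⟨f, hf⟩ := ih
    exact isTangleProfile_oneTangle.sum hf

theorem exists_isTangleProfile_posTangle (b : ℕ) (l : List ℕ) (hl : ∀ a ∈ l, 0 < a) :
    ∃ f, IsTangleProfile (posTangle b l) f := by
  induction l using List.reverseRecOn with
  | nil => exact exists_isTangleProfile_natTangle b
  | append_singleton l a ih =>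
    obtain ⟨f, hf⟩ := ih fun x hx => hl x (by simp [hx])
    obtain ⟨g, hg⟩ := hf.inv
    obtain ⟨n, rfl⟩ := Nat.exists_eq_succ_of_ne_zero (hl a (by simp)).ne'
    obtain ⟨h, hh⟩ := exists_isTangleProfile_natTangle n
    rw [posTangle_concat]
    exact hh.sum hg

theorem isAlternating_posTangle (b : ℕ) (l : List ℕ) (hl : ∀ a ∈ l.dropLast, 0 < a) :
    IsAlternating (posTangle b l) := by
  induction l using List.reverseRecOn with
  | nil =>
    obtain ⟨f, hf⟩ := exists_isTangleProfile_posTangle b [] (by simp)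
    exact hf.isProfile.isAlternating
  | append_singleton l a _ =>
    rw [List.dropLast_concat] at hl
    rcases Nat.eq_zero_or_pos a with rfl | ha
    · obtain ⟨f, hf⟩ := exists_isTangleProfile_posTangle b l hl
      obtain ⟨g, hg⟩ := hf.inv
      rw [posTangle_concat]
      exact hg.isAlternating_zero_add
    · obtain ⟨f, hf⟩ := exists_isTangleProfile_posTangle b (l ++ [a]) (by
        simp only [List.mem_append, List.mem_singleton]
        rintro x (hx | rfl)
        exacts [hl x hx, ha])
      exact hf.isProfile.isAlternating

theorem IsAlternating.mirror {T : Set Point} (hT : IsAlternating T) :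
    IsAlternating (mirror T) := by
  have e : SolidTorusLinks.mirror T = mirrorHomeo '' T := rfl
  have ho : ∀ p, IsOver (SolidTorusLinks.mirror T) p ↔ IsUnder T (mirrorHomeo p) := fun p => by
    obtain ⟨p, rfl⟩ := mirrorHomeo.surjective p
    have : mirrorHomeo (mirrorHomeo p) = p := mirrorHomeo.symm_apply_apply p
    rw [this, e]
    simp only [IsOver, IsUnder, mirrorHomeo.injective.mem_set_image, exists_mem_image]
    simp [mirrorHomeo]
  have hu : ∀ p, IsUnder (SolidTorusLinks.mirror T) p ↔ IsOver T (mirrorHomeo p) := fun p => by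
    obtain ⟨p, rfl⟩ := mirrorHomeo.surjective p
    have : mirrorHomeo (mirrorHomeo p) = p := mirrorHomeo.symm_apply_apply p
    rw [this, e]
    simp only [IsOver, IsUnder, mirrorHomeo.injective.mem_set_image, exists_mem_image]
    simp [mirrorHomeo]
  intro γ hγ hinj hmem hcross
  have hm : ∀ t, mirrorHomeo (γ t) ∈ T := fun t => by
    obtain ⟨p, hp, h⟩ := hmem t
    rw [← h]
    convert hp
    exact mirrorHomeo.symm_apply_apply p
  simp only [ho, hu] at hcross ⊢
  have h1 := hT (fun t => mirrorHomeo (γ (unitInterval.symm t)))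
    (mirrorHomeo.continuous.comp (hγ.comp unitInterval.continuous_symm))
    (mirrorHomeo.injective.comp (hinj.comp unitInterval.symm_bijective.injective))
    (fun t => hm _) (fun t => by
      rw [or_comm, hcross, unitInterval.symm_eq_zero, unitInterval.symm_eq_one, or_comm])
  simpa [iff_comm] using h1

/-! ### Canonical forms -/

theorem mirror_natTangle : ∀ n : ℕ, mirror (natTangle n) = intTangle (-(n : ℤ))
  | 0 => mirror_zeroTangle
  | _ + 1 => rfl

theorem mirror_posTangle (b : ℕ) (l : List ℕ) : mirror (posTangle b l) =
    rationalTangle ((-(b + 1 : ℕ) : ℤ) : WithTop ℤ) (l.map fun n : ℕ => -(n : ℤ)) := by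
  induction l using List.reverseRecOn with
  | nil => exact mirror_natTangle (b + 1)
  | append_singleton l a ih =>
    rw [posTangle_concat, List.map_append, List.map_singleton, rationalTangle_concat, ← ih,
      mirror_sum, mirror_inv, mirror_natTangle]

theorem exists_canonical (a : WithTop ℤ) (l : List ℤ) : ∃ a' l', IsCanonicalTangle a' l' ∧
    Isotopic (rationalTangle a l) (rationalTangle a' l') := by
  have hz : ∀ p ∈ zeroTangle, p.2.2 = 0 := fun p hp => (mem_zeroTangle_abs hp).1
  rcases rat_rationalTangle a l with h | h | h | h
  · exact ⟨(0 : ℤ), [], ⟨by simp, isAlternating_of_flat hz, by simp, by simp⟩, h⟩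
  · refine ⟨⊤, [], ⟨by simp, isAlternating_of_flat ?_, by simp, by simp⟩, h⟩
    rintro _ ⟨p, hp, rfl⟩
    exact hz p hp
  · obtain ⟨b, l', he, hpos, hiso⟩ := h.exists_isotopic_posTangle
    refine ⟨_, _, ⟨?_, ?_, ?_, ?_⟩, posTangle_eq b l' ▸ hiso⟩
    · rw [List.length_map]; exact he.add_one
    · rw [← posTangle_eq]; exact isAlternating_posTangle b l' hpos
    · refine fun _ => ⟨?_, WithTop.coe_ne_top⟩
      rw [Ne, WithTop.coe_eq_zero]
      omega
    · rw [← List.map_dropLast]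
      intro a ha
      obtain ⟨n, hn, rfl⟩ := List.mem_map.1 ha
      exact_mod_cast (hpos n hn).ne'
  · obtain ⟨b, l', he, hpos, hiso⟩ := h.exists_isotopic_posTangle
    have hiso' := hiso.mirror
    rw [mirror_mirror, mirror_posTangle] at hiso'
    refine ⟨_, _, ⟨?_, ?_, ?_, ?_⟩, hiso'⟩
    · rw [List.length_map]; exact he.add_one
    · rw [← mirror_posTangle]; exact (isAlternating_posTangle b l' hpos).mirror
    · refine fun _ => ⟨?_, WithTop.coe_ne_top⟩
      rw [Ne, WithTop.coe_eq_zero]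
      omega
    · rw [← List.map_dropLast]
      intro a ha
      obtain ⟨n, hn, rfl⟩ := List.mem_map.1 ha
      exact neg_ne_zero.2 (by exact_mod_cast (hpos n hn).ne')

theorem AmbientIsotopic.trans {X : Type*} [TopologicalSpace X] {A B C : Set X}
    (h : AmbientIsotopic A B) (h' : AmbientIsotopic B C) : AmbientIsotopic A C := by
  obtain ⟨H, hc, hh, h0, h1⟩ := h
  obtain ⟨K, kc, kh, k0, k1⟩ := h'
  refine ⟨fun p => K (p.1, H p), kc.comp (continuous_fst.prodMk hc),
    fun t => (kh t).comp (hh t), fun x => by simp only [h0, k0], ?_⟩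
  rw [← k1, ← h1, image_image]

end SolidTorusLinks

theorem mainTheorem10 (L : Set SolidTorusLinks.SolidTorus)
    (hL : SolidTorusLinks.IsRationalLink L) :
    ∃ L' : Set SolidTorusLinks.SolidTorus,
      SolidTorusLinks.IsInCanonicalForm L' ∧ SolidTorusLinks.AmbientIsotopic L L' := by
  obtain ⟨-, a, l, h⟩ := hL
  obtain ⟨a', l', hcan, hiso⟩ := SolidTorusLinks.exists_canonical a l
  exact ⟨_, ⟨a', l', hcan, rfl⟩,
    h.trans (hiso.closure (SolidTorusLinks.norm_le_of_mem_rationalTangle a l))⟩
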